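/- **Setting.** Consider a mechanical model with two degrees of freedom $q=(q^1,q^2)$ and Lagrangian $L=\frac1{2N}\tilde g_{\mu\nu}\dot q^\mu\dot q^\nu-N\tilde U(q)$. For a choice of lapse $N=N(q)\neq0$ put $g=\tilde g/N$ and $H=\frac12g^{\mu\nu}p_\mu p_\nu+N\tilde U$. For a constant $U_0$ put $U=N\tilde U-U_0$ and $Q_0=H-U_0$. A smooth vector field $\xi$ is *admissible* of weight $\lambda\in\mathbb R$ if $\pounds_\xi g=\lambda g$ and $\pounds_\xi U=-\lambda U$. It defines the charge $C_\xi=p_\mu\xi^\mu$, and two such fields define $V_{\xi\eta}=g_{\mu\nu}\xi^\mu\eta^\nu$. * The construction *gives an $\mathfrak{sl}(2,\mathbb R)$ algebra* for $(N,U_0,\xi)$, with $\xi$ admissible, if the span of $C_\xi,V_{\xi\xi},Q_0$ is a Lie algebra under the Poisson bracket isomorphic to $\mathfrak{sl}(2,\mathbb R)$. * For the lapse $N$ it *gives the full algebra* $\mathcal A=(\mathfrak{sl}(2,\mathbb R)\oplus\mathbb R)\ltimes\mathfrak h_2$ if for some $U_0$ there are admissible $\xi_t,\xi_x,\xi_b,\xi_d$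 of weights $0,0,0,1$ with the following property. Put $V_1=V_{bt}$, $V_2=V_{bx}$, $V_3=V_{bb}$, and let the time-dependent functions $\mathcal L_n=\frac14\ddot fV_3+\dot fC_d-fQ_0$ ($f=t^{n+1}$, $n\in\{-1,0,1\}$), $\mathcal D_0=C_b$, $\mathcal S^\pm_s=\frac12\big((\dot kV_2+kC_t)\pm(\dot kV_1+kC_x)\big)$ ($k=t^{s+1/2}$, $s=\pm\frac12$). They are conserved, at each time they are linearly independent together with the constant $1$, and they satisfy $\{\mathcal L_n,\mathcal L_m\}=(n-m)\mathcal L_{n+m}$, $\{\mathcal L_n,\mathcal D_0\}=0$, $\{\mathcal L_n,\mathcal S^\pm_s\}=(\frac n2-s)\mathcal S^\pm_{n+s}$, $\{\mathcal D_0,\mathcal S^\pm_s\}=\pm\mathcal S^\pm_s$, $\{\mathcal S^\epsilon_s,\mathcal S^{\epsilon'}_{s'}\}=2s\,\delta_{\epsilon+\epsilon'}\delta_{s+s'}$. **Models.** Let $L_s>0$, $G>0$. The models are the Bianchi models III, IV, V, VI$_0$, VII$_h$ ($h\in\mathbb R$), VIII, IX and Kantowski–Sachs (KS), with spatial metric $\gamma_{ij}(a,b)e^ie^j$,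 $a,b>0$, where $\gamma=\mathrm{diag}(a^2,b^2,b^2)$ for III, VI$_0$, VIII, IX, KS and $\gamma=\mathrm{diag}(a^2,a^4/b^2,b^2)$ for IV, V, VII$_h$. The triads $(e^1,e^2,e^3)$ are III: $(dx,\,L_sdy,\,L_s\sinh y\,d\phi)$; IV: $(L_sdx,\,e^{-x}dy,\,e^{-x}(dz-x\,dy))$; V: $(L_sdx,\,e^{-x}dy,\,e^{-x}dz)$; VI$_0$: $(L_sdx,\,e^{-x}dy,\,e^{x}dz)$; VII$_h$: $(L_sdx,\,e^{-hx}(\cos x\,dy+\sin x\,dz),\,e^{-hx}(\cos x\,dz-\sin x\,dy))$; VIII: $(dx+L_s\cosh y\,d\phi,\,L_sdy,\,L_s\sinh y\,d\phi)$; IX: $(dx+L_s\cos\theta\,d\phi,\,L_sd\theta,\,L_s\sin\theta\,d\phi)$; KS: $(dx,\,L_sd\theta,\,L_s\sin\theta\,d\phi)$. Here $y>0$ in III and VIII, and $0<\theta<\pi$ in IX and KS. Let $\Sigma$ be a fiducial cell with $0<\mathcal V_0=\frac1{16\pi}\int_\Sigma|e|<\infty$. The Einstein–Hilbert Lagrangian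 $\frac1{16\pi G}\int_\Sigma N\sqrt q\,(K_{\alpha\beta}K^{\alpha\beta}-K^2+R^{(3)})$ then reduces to a model $L$ as above in $q=(a,b)$, with kinetic term $-\frac{\mathcal V_0}{4GN}\sqrt\gamma\big((\gamma^{ij}\dot\gamma_{ij})^2+\dot\gamma_{ij}\dot\gamma^{ij}\big)$ and potential $\tilde U=-\frac1{16\pi G}\int_\Sigma|e|\sqrt\gamma R^{(3)}$. **Theorem.** 1. *(Criterion.)* Let $\mathcal V_0,G>0$ and $n_i,m_i\in\mathbb R\setminus\{-1\}$ with $n_1\ne n_2$, $m_1\neq m_2$, and let $c_1,c_2\in\mathbb R$ with $c_2\ne0$. Consider $L=\frac{\mathcal V_0}G\big[-\frac1N\dot{\tilde u}\dot{\tilde v}+N(c_1\tilde u^{n_1}\tilde v^{m_1}+c_2\tilde u^{n_2}\tilde v^{m_2})\big]$ on $\tilde u,\tilde v>0$, with lapse $N=\frac{\mathcal V_0}G\tilde u^{-n_1}\tilde v^{-m_1}$ and $U_0=-\frac{\mathcal V_0^2}{G^2}c_1$. Up to constant factors there is exactly one nonzero admissible vector field, and it gives an $\mathfrak{sl}(2,\mathbb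 R)$ algebra if and only if $$2+n_1+n_2+m_1+m_2+n_1m_2+n_2m_1=0.\qquad(*)$$ 2. *(Null form.)* Let $\sigma>0$. Put $\tilde u=\frac{2\sigma\sqrt2}{\sqrt3}a\sqrt b$, $\tilde v=\frac{2\sqrt2}{\sigma\sqrt3}b^{3/2}$ for III, VI$_0$, VIII, IX, KS, and $\tilde u=\frac{2\sigma\sqrt2}{\sqrt3}a^{(3+\sqrt3)/2}b^{-\sqrt3/2}$, $\tilde v=\frac{2\sqrt2}{\sigma\sqrt3}a^{(3-\sqrt3)/2}b^{\sqrt3/2}$ for IV, V, VII$_h$. Every model becomes $L=-\frac{\mathcal V_0}{GN}\dot{\tilde u}\dot{\tilde v}-N\tilde U$. Here $\tilde U$ is a combination, with nonzero coefficients, of the monomials $\tilde u^n\tilde v^m$ with exponents $(n,m)$ equal to: $(1,-\frac13)$ for III and KS; $(\frac13,\frac13)$ for V; $(-1,\frac53)$ for VI$_0$; $(1,-\frac13),(3,-\frac73)$ for VIII and IX; $(\frac13,\frac13),(\frac13-\frac4{\sqrt3},\frac13+\frac4{\sqrt3})$ for IV; $(\frac13,\frac13),(\frac13\pm\frac4{\sqrt3},\frac13\mp\frac4{\sqrt3})$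 for VII$_h$, where $(\frac13,\frac13)$ is absent if $6h^2=1$. 3. *(III, V, VI$_0$, KS.)* For every lapse $N=\kappa/\tilde U$ with a constant $\kappa\ne0$, the metric $g$ is flat and the construction gives the full algebra $\mathcal A$. 4. *(VIII, IX.)* The two exponent pairs satisfy $(*)$. If $N=\kappa\,\tilde u^{-n}\tilde v^{-m}$, where $(n,m)$ is either of the two pairs and $\kappa\neq0$, then $g$ is flat. Moreover for a suitable constant $U_0$ there is, up to constant factors, exactly one nonzero admissible vector field, and it gives an $\mathfrak{sl}(2,\mathbb R)$ algebra. The full algebra $\mathcal A$ is not obtained for any smooth nonvanishing lapse, not even on a nonempty open subset of $\{a,b>0\}$. 5. *(IV, VII$_h$.)* No two distinct exponent pairs of the model satisfy $(*)$. Let $N$ be a lapse on a nonempty open subset of $\{a,b>0\}$ for which either $N\tilde U$, or $N\tilde u^n\tilde v^m$ for one of the exponent pairs $(n,m)$, is a nonzero constant. Then no constant $U_0$ and no admissible vector field give an $\mathfrak{sl}(2,\mathbb R)$ algebra. -/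

import Mathlib

open scoped ContDiff Matrix
open MeasureTheory

noncomputable section

namespace Minisuperspace

/-! ### Tensor calculus in a coordinate chart of dimension `n` -/

/-- Partial derivative with respect to the `i`-th coordinate. -/
def pd {n : ℕ} (i : Fin n) (f : (Fin n → ℝ) → ℝ) (x : Fin n → ℝ) : ℝ :=
  deriv (fun s => f (Function.update x i s)) (x i)

/-- Christoffel symbols `Γ^k_{ij}` of the (pseudo-)Riemannian metric `g`. -/
def christoffel {n : ℕ} (g : (Fin n → ℝ) → Matrix (Fin n) (Fin n) ℝ) (k i j : Fin n)
    (x : Fin n → ℝ) : ℝ :=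
  (1 / 2) * ∑ l, (g x)⁻¹ k l *
    (pd i (fun y => g y j l) x + pd j (fun y => g y i l) x - pd l (fun y => g y i j) x)

/-- Riemann tensor `R^k_{l i j}`. -/
def riemann {n : ℕ} (g : (Fin n → ℝ) → Matrix (Fin n) (Fin n) ℝ) (k l i j : Fin n)
    (x : Fin n → ℝ) : ℝ :=
  pd i (christoffel g k j l) x - pd j (christoffel g k i l) x
    + ∑ m, (christoffel g k i m x * christoffel g m j l x
      - christoffel g k j m x * christoffel g m i l x)

/-- Scalar curvature `R = g^{lj} R^k_{l k j}`. -/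
def scalarCurvature {n : ℕ} (g : (Fin n → ℝ) → Matrix (Fin n) (Fin n) ℝ) (x : Fin n → ℝ) : ℝ :=
  ∑ l, ∑ j, (g x)⁻¹ l j * ∑ k, riemann g k l k j x

/-- Lie derivative of the metric, `(£_ξ g)_{μν}`. -/
def lieMetric {n : ℕ} (ξ : (Fin n → ℝ) → (Fin n → ℝ))
    (g : (Fin n → ℝ) → Matrix (Fin n) (Fin n) ℝ) (x : Fin n → ℝ) : Matrix (Fin n) (Fin n) ℝ :=
  Matrix.of fun μ ν =>
    ∑ ρ, (ξ x ρ * pd ρ (fun y => g y μ ν) x + g x ρ ν * pd μ (fun y => ξ y ρ) x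
      + g x μ ρ * pd ν (fun y => ξ y ρ) x)

/-! ### Mechanical models `L = (1 / 2N) g̃_{μν} q̇^μ q̇^ν - N Ũ` with two degrees of freedom -/

/-- The data of the Lagrangian: the field space metric `g̃` and the potential `Ũ`. -/
structure Mechanics where
  metric : (Fin 2 → ℝ) → Matrix (Fin 2) (Fin 2) ℝ
  potential : (Fin 2 → ℝ) → ℝ

/-- Phase space points are pairs `(q, p)`. -/
abbrev Phase : Type := (Fin 2 → ℝ) × (Fin 2 → ℝ)

/-- Poisson bracket with `{q^μ, p_ν} = δ^μ_ν`. -/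
def poisson (F K : Phase → ℝ) (z : Phase) : ℝ :=
  ∑ μ, (pd μ (fun q => F (q, z.2)) z.1 * pd μ (fun p => K (z.1, p)) z.2
    - pd μ (fun p => F (z.1, p)) z.2 * pd μ (fun q => K (q, z.2)) z.1)

/-- The part of phase space over the region `D` of field space. -/
def phaseOver (D : Set (Fin 2 → ℝ)) : Set Phase := {z | z.1 ∈ D}

namespace Mechanics

/-- The rescaled metric `g = g̃ / N`. -/
def lapseMetric (S : Mechanics) (N : (Fin 2 → ℝ) → ℝ) (q : Fin 2 → ℝ) :
    Matrix (Fin 2) (Fin 2) ℝ :=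
  (N q)⁻¹ • S.metric q

/-- The Hamiltonian `H = g^{μν} p_μ p_ν / 2 + N Ũ`. -/
def hamiltonian (S : Mechanics) (N : (Fin 2 → ℝ) → ℝ) (z : Phase) : ℝ :=
  (1 / 2) * (z.2 ⬝ᵥ ((S.lapseMetric N z.1)⁻¹ *ᵥ z.2)) + N z.1 * S.potential z.1

/-- `Q₀ = H - U₀`. -/
def Qzero (S : Mechanics) (N : (Fin 2 → ℝ) → ℝ) (U₀ : ℝ) (z : Phase) : ℝ :=
  S.hamiltonian N z - U₀

/-- `C_ξ = p_μ ξ^μ`. -/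
def Ccharge (ξ : (Fin 2 → ℝ) → (Fin 2 → ℝ)) (z : Phase) : ℝ := z.2 ⬝ᵥ ξ z.1

/-- `V_{ξη} = g_{μν} ξ^μ η^ν`. -/
def Vcharge (S : Mechanics) (N : (Fin 2 → ℝ) → ℝ) (ξ η : (Fin 2 → ℝ) → (Fin 2 → ℝ))
    (z : Phase) : ℝ :=
  ξ z.1 ⬝ᵥ (S.lapseMetric N z.1 *ᵥ η z.1)

/-- `ξ` is a smooth homothetic Killing vector of `g = g̃ / N` on `D` with constant weight `lam`
(a true Killing vector if `lam = 0`) and the potential `U = N Ũ - U₀` scales oppositely: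
`£_ξ g = lam g` and `£_ξ U = - lam U`. -/
def IsAdmissible (S : Mechanics) (D : Set (Fin 2 → ℝ)) (N : (Fin 2 → ℝ) → ℝ) (U₀ lam : ℝ)
    (ξ : (Fin 2 → ℝ) → (Fin 2 → ℝ)) : Prop :=
  ContDiffOn ℝ ∞ ξ D ∧
    ∀ q ∈ D, lieMetric ξ (S.lapseMetric N) q = lam • S.lapseMetric N q ∧
      ∑ μ, ξ q μ * pd μ (fun y => N y * S.potential y - U₀) q
        = - lam * (N q * S.potential q - U₀)

end Mechanics

/-- The linear span of the three phase space functions `F 0, F 1, F 2`, regarded as functions over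
`D`, is a Lie algebra for the Poisson bracket that is isomorphic to `sl(2, ℝ)`. -/
def SpansSL2 (D : Set (Fin 2 → ℝ)) (F : Fin 3 → Phase → ℝ) : Prop :=
  ∃ e h f : Phase → ℝ,
    e ∈ Submodule.span ℝ (Set.range F) ∧ h ∈ Submodule.span ℝ (Set.range F) ∧
    f ∈ Submodule.span ℝ (Set.range F) ∧
    LinearIndependent ℝ (fun i : Fin 3 => (phaseOver D).domRestrict ((![e, h, f] : Fin 3 → Phase → ℝ) i)) ∧
    ∀ z ∈ phaseOver D,
      poisson h e z = 2 * e z ∧ poisson h f z = -2 * f z ∧ poisson e f z = h z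

namespace Mechanics

/-- The charges `(C_ξ, V_{ξξ}, Q₀)` span `sl(2, ℝ)`. -/
def ChargesSpanSL2 (S : Mechanics) (D : Set (Fin 2 → ℝ)) (N : (Fin 2 → ℝ) → ℝ) (U₀ : ℝ)
    (ξ : (Fin 2 → ℝ) → (Fin 2 → ℝ)) : Prop :=
  SpansSL2 D ![Ccharge ξ, S.Vcharge N ξ ξ, S.Qzero N U₀]

/-- Up to a constant factor, `ξ` is the only admissible vector field for the lapse `N` and the
splitting `N Ũ = U + U₀`. -/
def IsUniqueAdmissible (S : Mechanics) (D : Set (Fin 2 → ℝ)) (N : (Fin 2 → ℝ) → ℝ) (U₀ : ℝ)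
    (ξ : (Fin 2 → ℝ) → (Fin 2 → ℝ)) : Prop :=
  (∃ q ∈ D, ξ q ≠ 0) ∧
    ∀ η : (Fin 2 → ℝ) → (Fin 2 → ℝ),
      (∃ lam, S.IsAdmissible D N U₀ lam η) ↔ ∃ c : ℝ, ∀ q ∈ D, η q = c • ξ q

/-- `𝓛_n = f̈ V₃ / 4 + ḟ C_d - f Q₀` with `f(t) = t^(n+1)`, `V₃ = V_{bb}`; used for
`n ∈ {-1, 0, 1}`. -/
def genL (S : Mechanics) (N : (Fin 2 → ℝ) → ℝ) (U₀ : ℝ) (ξb ξd : (Fin 2 → ℝ) → (Fin 2 → ℝ))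
    (n : ℤ) (t : ℝ) (z : Phase) : ℝ :=
  (1 / 4) * ((n + 1) * n * t ^ (n - 1).toNat) * S.Vcharge N ξb ξb z
    + (n + 1) * t ^ n.toNat * Ccharge ξd z - t ^ (n + 1).toNat * S.Qzero N U₀ z

/-- `𝓢^ε_s = ((ġ V₂ + g C_t) + ε (ġ V₁ + g C_x)) / 2` with `g(t) = t^k`, `k = s + 1/2`,
`V₁ = V_{bt}`, `V₂ = V_{bx}`; used for `k ∈ {0, 1}` and `ε ∈ {1, -1}`. -/
def genS (S : Mechanics) (N : (Fin 2 → ℝ) → ℝ) (ξt ξx ξb : (Fin 2 → ℝ) → (Fin 2 → ℝ))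
    (ε k : ℤ) (t : ℝ) (z : Phase) : ℝ :=
  (1 / 2) * ((k * S.Vcharge N ξb ξx z + t ^ k.toNat * Ccharge ξt z)
    + ε * (k * S.Vcharge N ξb ξt z + t ^ k.toNat * Ccharge ξx z))

/-- The time-dependent phase space function `O` is a constant of the motion over `D`. -/
def IsConserved (S : Mechanics) (D : Set (Fin 2 → ℝ)) (N : (Fin 2 → ℝ) → ℝ)
    (O : ℝ → Phase → ℝ) : Prop :=
  ∀ t, ∀ z ∈ phaseOver D, deriv (fun s => O s z) t + poisson (O t) (S.hamiltonian N) z = 0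

/-- With the lapse `N`, the construction gives the full algebra
`𝓐 = (sl(2, ℝ) ⊕ ℝ) ⋉ 𝔥₂` over `D`: there are admissible vector fields of weights `0, 0, 0, 1`
whose charges `𝓛_n` (`n = -1, 0, 1`), `𝓓₀ = C_b` and `𝓢^±_s` (`s = ±1/2`) are conserved, are
linearly independent together with the central element `1`, and have the brackets of `𝓐`. -/
def HasFullAlgebra (S : Mechanics) (D : Set (Fin 2 → ℝ)) (N : (Fin 2 → ℝ) → ℝ) : Prop :=
  ∃ (U₀ : ℝ) (ξt ξx ξb ξd : (Fin 2 → ℝ) → (Fin 2 → ℝ)),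
    S.IsAdmissible D N U₀ 0 ξt ∧ S.IsAdmissible D N U₀ 0 ξx ∧
    S.IsAdmissible D N U₀ 0 ξb ∧ S.IsAdmissible D N U₀ 1 ξd ∧
    (∀ n ∈ ({-1, 0, 1} : Set ℤ), S.IsConserved D N (S.genL N U₀ ξb ξd n)) ∧
    S.IsConserved D N (fun _ => Ccharge ξb) ∧
    (∀ ε ∈ ({1, -1} : Set ℤ), ∀ k ∈ ({0, 1} : Set ℤ),
      S.IsConserved D N (S.genS N ξt ξx ξb ε k)) ∧
    (∀ t : ℝ, LinearIndependent ℝ (fun i : Fin 9 => (phaseOver D).domRestrict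
      ((![fun _ => 1, S.genL N U₀ ξb ξd (-1) t, S.genL N U₀ ξb ξd 0 t, S.genL N U₀ ξb ξd 1 t,
        Ccharge ξb, S.genS N ξt ξx ξb 1 0 t, S.genS N ξt ξx ξb 1 1 t,
        S.genS N ξt ξx ξb (-1) 0 t, S.genS N ξt ξx ξb (-1) 1 t] : Fin 9 → Phase → ℝ) i))) ∧
    (∀ t : ℝ, ∀ z ∈ phaseOver D, ∀ n ∈ ({-1, 0, 1} : Set ℤ),
      (∀ m ∈ ({-1, 0, 1} : Set ℤ),
        poisson (S.genL N U₀ ξb ξd n t) (S.genL N U₀ ξb ξd m t) z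
          = (n - m) * S.genL N U₀ ξb ξd (n + m) t z) ∧
      poisson (S.genL N U₀ ξb ξd n t) (Ccharge ξb) z = 0 ∧
      ∀ ε ∈ ({1, -1} : Set ℤ), ∀ k ∈ ({0, 1} : Set ℤ),
        poisson (S.genL N U₀ ξb ξd n t) (S.genS N ξt ξx ξb ε k t) z
          = ((n : ℝ) / 2 - (k - 1 / 2)) * S.genS N ξt ξx ξb ε (n + k) t z) ∧
    (∀ t : ℝ, ∀ z ∈ phaseOver D, ∀ ε ∈ ({1, -1} : Set ℤ), ∀ k ∈ ({0, 1} : Set ℤ),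
      poisson (Ccharge ξb) (S.genS N ξt ξx ξb ε k t) z = ε * S.genS N ξt ξx ξb ε k t z ∧
      ∀ ε' ∈ ({1, -1} : Set ℤ), ∀ k' ∈ ({0, 1} : Set ℤ),
        poisson (S.genS N ξt ξx ξb ε k t) (S.genS N ξt ξx ξb ε' k' t) z
          = if ε + ε' = 0 ∧ k + k' = 1 then 2 * ((k : ℝ) - 1 / 2) else 0)

end Mechanics

/-! ### The homogeneous models -/

/-- The diagonal homogeneous models with two scale factors `a, b`: the Bianchi models of types
III, IV, V, VI₀, VII_h, VIII, IX and the Kantowski–Sachs model. -/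
inductive Model
  | III
  | IV
  | V
  | VI0
  | VII (h : ℝ)
  | VIII
  | IX
  | KS

/-- The region `a > 0`, `b > 0` of field space, `q = (a, b)`. -/
def quadrant : Set (Fin 2 → ℝ) := {q | 0 < q 0 ∧ 0 < q 1}

namespace Model

/-- The spatial triad `e^i_α(x)` (row index `i`), with length scale `L`. -/
def triad (L : ℝ) : Model → (Fin 3 → ℝ) → Matrix (Fin 3) (Fin 3) ℝ
  | III, x => !![1, 0, 0; 0, L, 0; 0, 0, L * Real.sinh (x 1)]
  | IV, x => !![L, 0, 0; 0, Real.exp (-x 0), 0; 0, -(x 0 * Real.exp (-x 0)), Real.exp (-x 0)]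
  | V, x => !![L, 0, 0; 0, Real.exp (-x 0), 0; 0, 0, Real.exp (-x 0)]
  | VI0, x => !![L, 0, 0; 0, Real.exp (-x 0), 0; 0, 0, Real.exp (x 0)]
  | VII h, x => !![L, 0, 0;
      0, Real.exp (-(h * x 0)) * Real.cos (x 0), Real.exp (-(h * x 0)) * Real.sin (x 0);
      0, -(Real.exp (-(h * x 0)) * Real.sin (x 0)), Real.exp (-(h * x 0)) * Real.cos (x 0)]
  | VIII, x => !![1, 0, L * Real.cosh (x 1); 0, L, 0; 0, 0, L * Real.sinh (x 1)]
  | IX, x => !![1, 0, L * Real.cos (x 1); 0, L, 0; 0, 0, L * Real.sin (x 1)]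
  | KS, x => !![1, 0, 0; 0, L, 0; 0, 0, L * Real.sin (x 1)]

/-- The region of the spatial coordinates on which the triad is used. -/
def chart : Model → Set (Fin 3 → ℝ)
  | III => {x | 0 < x 1}
  | VIII => {x | 0 < x 1}
  | IX => {x | 0 < x 1 ∧ x 1 < Real.pi}
  | KS => {x | 0 < x 1 ∧ x 1 < Real.pi}
  | _ => Set.univ

/-- The internal metric `γ_{ij}(a, b)`. -/
def internalMetric (M : Model) (q : Fin 2 → ℝ) : Matrix (Fin 3) (Fin 3) ℝ :=
  match M with
  | IV | V | VII _ => Matrix.diagonal ![q 0 ^ 2, q 0 ^ 4 / q 1 ^ 2, q 1 ^ 2]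
  | III | VI0 | VIII | IX | KS => Matrix.diagonal ![q 0 ^ 2, q 1 ^ 2, q 1 ^ 2]

/-- The spatial metric `e^i_α e^j_β γ_{ij}` at fixed scale factors `q`. -/
def spatialMetric (M : Model) (L : ℝ) (q : Fin 2 → ℝ) (x : Fin 3 → ℝ) :
    Matrix (Fin 3) (Fin 3) ℝ :=
  (M.triad L x)ᵀ * M.internalMetric q * M.triad L x

/-- A fiducial cell: a region of the chart with finite and nonzero coordinate volume
`∫ |det e|`. -/
def IsCell (M : Model) (L : ℝ) (cell : Set (Fin 3 → ℝ)) : Prop :=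
  MeasurableSet cell ∧ cell ⊆ M.chart ∧
    IntegrableOn (fun x => |(M.triad L x).det|) cell ∧
    0 < ∫ x in cell, |(M.triad L x).det|

/-- The fiducial volume `𝒱₀ = (1 / 16π) ∫ |e|`. -/
def fiducialVolume (M : Model) (L : ℝ) (cell : Set (Fin 3 → ℝ)) : ℝ :=
  1 / (16 * Real.pi) * ∫ x in cell, |(M.triad L x).det|

/-- The field space metric of the reduced Einstein–Hilbert Lagrangian
`(1/16πG) ∫ N √q (K_{αβ}K^{αβ} - K² + R⁽³⁾)`. Its kinetic term is
`-(𝒱₀ / 4GN) √γ ((γ^{ij} γ̇_{ij})² + γ̇_{ij} γ̇^{ij}) = (1 / 2N) g̃_{μν} q̇^μ q̇^ν`, where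
`γ̇^{ij} = -(γ⁻¹ γ̇ γ⁻¹)^{ij}`. -/
def supermetric (M : Model) (L G : ℝ) (cell : Set (Fin 3 → ℝ)) (q : Fin 2 → ℝ) :
    Matrix (Fin 2) (Fin 2) ℝ :=
  let γ := M.internalMetric q
  let dγ : Fin 2 → Matrix (Fin 3) (Fin 3) ℝ :=
    fun ρ => Matrix.of fun i j => pd ρ (fun y => M.internalMetric y i j) q
  Matrix.of fun μ ν =>
    -(M.fiducialVolume L cell / (2 * G)) * √γ.det *
      ((γ⁻¹ * dγ μ).trace * (γ⁻¹ * dγ ν).trace - (γ⁻¹ * dγ μ * (γ⁻¹ * dγ ν)).trace)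

/-- The potential `-(1/16πG) ∫ |e| √γ R⁽³⁾` of the reduced Einstein–Hilbert Lagrangian. -/
def reducedPotential (M : Model) (L G : ℝ) (cell : Set (Fin 3 → ℝ)) (q : Fin 2 → ℝ) : ℝ :=
  -(1 / (16 * Real.pi * G)) * ∫ x in cell, |(M.triad L x).det| *
    √(M.internalMetric q).det * scalarCurvature (M.spatialMetric L q) x

/-- The mechanical model obtained by homogeneous reduction of general relativity. -/
def reduction (M : Model) (L G : ℝ) (cell : Set (Fin 3 → ℝ)) : Mechanics where
  metric := M.supermetric L G cell
  potential := M.reducedPotential L G cell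

/-- The null coordinate `ũ` on the quadrant. -/
def nullU (M : Model) (σ : ℝ) (q : Fin 2 → ℝ) : ℝ :=
  match M with
  | IV | V | VII _ => 2 * σ * √2 / √3 * (q 0 ^ ((3 + √3) / 2) * q 1 ^ (-(√3 / 2)))
  | III | VI0 | VIII | IX | KS => 2 * σ * √2 / √3 * (q 0 * √(q 1))

/-- The null coordinate `ṽ` on the quadrant. -/
def nullV (M : Model) (σ : ℝ) (q : Fin 2 → ℝ) : ℝ :=
  match M with
  | IV | V | VII _ => 2 * √2 / (σ * √3) * (q 0 ^ ((3 - √3) / 2) * q 1 ^ (√3 / 2))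
  | III | VI0 | VIII | IX | KS => 2 * √2 / (σ * √3) * q 1 ^ (3 / 2 : ℝ)

/-- The monomial `ũ^n ṽ^m` with exponents `e = (n, m)`. -/
def monomial (M : Model) (σ : ℝ) (e : ℝ × ℝ) (q : Fin 2 → ℝ) : ℝ :=
  M.nullU σ q ^ e.1 * M.nullV σ q ^ e.2

/-- The exponents `(n, m)` of the monomials `ũ^n ṽ^m` in the potential. -/
def exponents : Model → List (ℝ × ℝ)
  | III => [(1, -1 / 3)]
  | IV => [(1 / 3, 1 / 3), (1 / 3 - 4 / √3, 1 / 3 + 4 / √3)]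
  | V => [(1 / 3, 1 / 3)]
  | VI0 => [(-1, 5 / 3)]
  | VII h =>
      if 6 * h ^ 2 = 1 then
        [(1 / 3 + 4 / √3, 1 / 3 - 4 / √3), (1 / 3 - 4 / √3, 1 / 3 + 4 / √3)]
      else
        [(1 / 3, 1 / 3), (1 / 3 + 4 / √3, 1 / 3 - 4 / √3), (1 / 3 - 4 / √3, 1 / 3 + 4 / √3)]
  | VIII => [(1, -1 / 3), (3, -7 / 3)]
  | IX => [(1, -1 / 3), (3, -7 / 3)]
  | KS => [(1, -1 / 3)]

end Model

/-- The condition `2 + n₁ + n₂ + m₁ + m₂ + n₁ m₂ + n₂ m₁ = 0` on two pairs of exponents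
`e = (n₁, m₁)` and `e' = (n₂, m₂)`. -/
def PowerCondition (e e' : ℝ × ℝ) : Prop :=
  2 + e.1 + e'.1 + e.2 + e'.2 + e.1 * e'.2 + e'.1 * e.2 = 0

/-- The two-monomial model
`L = (V₀ / G) (-(1/N) ũ̇ ṽ̇ + N (c₁ ũ^{n₁} ṽ^{m₁} + c₂ ũ^{n₂} ṽ^{m₂}))` in the coordinates
`q = (ũ, ṽ)`, with `e = (n₁, m₁)` and `e' = (n₂, m₂)`. -/
def twoMonomial (V₀ G c₁ c₂ : ℝ) (e e' : ℝ × ℝ) : Mechanics where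
  metric _ := !![0, -(V₀ / G); -(V₀ / G), 0]
  potential q := -(V₀ / G) * (c₁ * (q 0 ^ e.1 * q 1 ^ e.2) + c₂ * (q 0 ^ e'.1 * q 1 ^ e'.2))

end Minisuperspace

end

open scoped ContDiff Matrix
open MeasureTheory

noncomputable section

namespace Minisuperspace

open Filter Topology

/-! ### Partial derivatives -/

section PartialDerivatives

variable {n : ℕ}

/-! Every notion in the theorem is covariant under changes of coordinates, so each model may be
studied in null coordinates `(u, v)`, where `g = 2ρ du dv` and the potential is `W = N Ũ`
(`nullModel`, the lapse being absorbed). `Transport` moves admissible fields, charges and brackets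
between the two descriptions. As `ρ` is a constant multiple of `1 / N`, the product `ρ W` does not
see the lapse: it is a multiple of `Ũ`, hence a sum of monomials `u^n v^m`.

In null coordinates an admissible field has `ξ⁰` independent of `v` and `ξ¹` independent of `u`,
with `∂_u (ρ ξ⁰) + ∂_v (ρ ξ¹) = lam ρ` and `ξ(W) = -lam (W - U₀)`. The brackets `{C, V} = -lam V`
and `{C, Q₀} = lam Q₀` are then automatic. The bracket `{V, Q₀}` is odd in the momenta, so closure
means `{V, Q₀} = b C`, and perfectness of `sl(2, ℝ)` gives `lam, b ≠ 0`. Where `ξ⁰ ξ¹ ≠ 0` this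
splits the divergence equation in halves: `∂_u (ρ ξ⁰) = ∂_v (ρ ξ¹) = lam ρ / 2`
(`nullModel_chargesSpanSL2_iff`, `nullModel_weights_of_chargesSpanSL2`).

Existence. If `ρ` and `W - U₀` are monomials, separation of variables in the potential equation
leaves a single linear field, and the half-weight equations for it are `PowerCondition`
(`powerModel_isUniqueAdmissible`, `powerModel_chargesSpanSL2_iff`). If `ρ` is a monomial and `W` is
constant, then `u^(n+1)` (or `log u` when `n = -1`) and `v^(m+1)` are flat coordinates, in which
translations, boost and dilation generate the full algebra out of quadratic polynomials
(`flat_hasFullAlgebra`).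

Obstruction. The full algebra forces `W` to be constant and `ρ` to be, locally, a function of `u`
times a function of `v` (`nullModel_isProductOn_of_hasFullAlgebra`). Then `Ũ` would be such a
product, which a sum of two or more monomials of equal total degree is not
(`not_isProductOn_mono_sum`). For IV and VII with `N Ũ` constant, the half-weight equations alone
already make `ρ` a product. If instead `N` is inverse to a monomial, equality of the degrees makes
`W` a function of `u / v`; homogeneity then forces `ξ` to be linear, and comparison of coefficients
gives `PowerCondition` for two exponent pairs, which fails.

What remains is explicit: the spatial metrics depend on one coordinate and have block form, so their
scalar curvature is given by `blockCurvature`, and the kinetic form is factored into its null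
directions. -/

lemma tendsto_update_self (x : Fin n → ℝ) (i : Fin n) :
    Tendsto (fun t => Function.update x i t) (𝓝 (x i)) (𝓝 x) := by
  have h := (hasDerivAt_update x i (x i)).continuousAt
  simpa [ContinuousAt] using h

lemma pd_congr {f g : (Fin n → ℝ) → ℝ} {x : Fin n → ℝ} (i : Fin n) (h : f =ᶠ[𝓝 x] g) :
    pd i f x = pd i g x :=
  Filter.EventuallyEq.deriv_eq ((tendsto_update_self x i).eventually h)

lemma pd_congr_on {f g : (Fin n → ℝ) → ℝ} {D : Set (Fin n → ℝ)} (hD : IsOpen D)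
    (h : ∀ y ∈ D, f y = g y) {x : Fin n → ℝ} (hx : x ∈ D) (i : Fin n) :
    pd i f x = pd i g x :=
  pd_congr i (Filter.eventuallyEq_of_mem (hD.mem_nhds hx) h)

lemma pd_of_hasFDerivAt {f : (Fin n → ℝ) → ℝ} {f' : (Fin n → ℝ) →L[ℝ] ℝ} {x : Fin n → ℝ}
    (i : Fin n) (h : HasFDerivAt f f' x) : pd i f x = f' (Pi.single i 1) := by
  have h1 : HasFDerivAt f f' (Function.update x i (x i)) := by simpa using h
  exact (h1.comp_hasDerivAt (x i) (hasDerivAt_update x i (x i))).deriv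

lemma pd_eq_fderiv {f : (Fin n → ℝ) → ℝ} {x : Fin n → ℝ} (i : Fin n)
    (h : DifferentiableAt ℝ f x) : pd i f x = fderiv ℝ f x (Pi.single i 1) :=
  pd_of_hasFDerivAt i h.hasFDerivAt

lemma fderiv_eq_sum_pd {f : (Fin n → ℝ) → ℝ} {x : Fin n → ℝ}
    (h : DifferentiableAt ℝ f x) (v : Fin n → ℝ) : fderiv ℝ f x v = ∑ i, pd i f x * v i := by
  conv_lhs => rw [← Finset.univ_sum_single v]
  rw [map_sum]
  refine Finset.sum_congr rfl fun i _ => ?_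
  rw [pd_eq_fderiv i h, show (Pi.single i (v i) : Fin n → ℝ) = v i • Pi.single i 1 by
    rw [← Pi.single_smul]; simp, map_smul, smul_eq_mul, mul_comm]

@[simp] lemma pd_const (i : Fin n) (c : ℝ) (x : Fin n → ℝ) : pd i (fun _ => c) x = 0 := by
  simp [pd]

lemma pd_coord (i j : Fin n) (x : Fin n → ℝ) :
    pd i (fun y => y j) x = if i = j then 1 else 0 := by
  refine (pd_of_hasFDerivAt i
    (ContinuousLinearMap.proj (R := ℝ) (φ := fun _ : Fin n => ℝ) j).hasFDerivAt).trans ?_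
  simp [Pi.single_apply, eq_comm]

lemma pd_add {f g : (Fin n → ℝ) → ℝ} {x : Fin n → ℝ} (i : Fin n)
    (hf : DifferentiableAt ℝ f x) (hg : DifferentiableAt ℝ g x) :
    pd i (fun y => f y + g y) x = pd i f x + pd i g x := by
  rw [pd_of_hasFDerivAt i (hf.hasFDerivAt.fun_add hg.hasFDerivAt), pd_eq_fderiv i hf,
    pd_eq_fderiv i hg]
  rfl

lemma pd_sub {f g : (Fin n → ℝ) → ℝ} {x : Fin n → ℝ} (i : Fin n)
    (hf : DifferentiableAt ℝ f x) (hg : DifferentiableAt ℝ g x) :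
    pd i (fun y => f y - g y) x = pd i f x - pd i g x := by
  rw [pd_of_hasFDerivAt i (hf.hasFDerivAt.fun_sub hg.hasFDerivAt), pd_eq_fderiv i hf,
    pd_eq_fderiv i hg]
  rfl

lemma pd_mul {f g : (Fin n → ℝ) → ℝ} {x : Fin n → ℝ} (i : Fin n)
    (hf : DifferentiableAt ℝ f x) (hg : DifferentiableAt ℝ g x) :
    pd i (fun y => f y * g y) x = pd i f x * g x + f x * pd i g x := by
  rw [pd_of_hasFDerivAt i (hf.hasFDerivAt.fun_mul hg.hasFDerivAt), pd_eq_fderiv i hf,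
    pd_eq_fderiv i hg]
  simp [mul_comm, add_comm]

lemma pd_const_mul {f : (Fin n → ℝ) → ℝ} {x : Fin n → ℝ} (i : Fin n) (c : ℝ) :
    pd i (fun y => c * f y) x = c * pd i f x := by
  simp [pd]

lemma pd_sub_const {f : (Fin n → ℝ) → ℝ} {x : Fin n → ℝ} (i : Fin n) (c : ℝ) :
    pd i (fun y => f y - c) x = pd i f x := by
  simp [pd]

lemma pd_sum {ι : Type*} {s : Finset ι} {f : ι → (Fin n → ℝ) → ℝ} {x : Fin n → ℝ} (i : Fin n)
    (hf : ∀ a ∈ s, DifferentiableAt ℝ (f a) x) :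
    pd i (fun y => ∑ a ∈ s, f a y) x = ∑ a ∈ s, pd i (f a) x := by
  rw [pd_of_hasFDerivAt i (HasFDerivAt.fun_sum fun a ha => (hf a ha).hasFDerivAt),
    sum_apply]
  exact Finset.sum_congr rfl fun a ha => (pd_eq_fderiv i (hf a ha)).symm

lemma pd_comp {m : ℕ} {f : (Fin m → ℝ) → ℝ} {Φ : (Fin n → ℝ) → Fin m → ℝ} {x : Fin n → ℝ}
    (i : Fin n) (hf : DifferentiableAt ℝ f (Φ x)) (hΦ : DifferentiableAt ℝ Φ x) :
    pd i (fun y => f (Φ y)) x = ∑ α, pd α f (Φ x) * pd i (fun y => Φ y α) x := by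
  refine (pd_of_hasFDerivAt i (hf.hasFDerivAt.comp x hΦ.hasFDerivAt)).trans ?_
  rw [ContinuousLinearMap.comp_apply, fderiv_eq_sum_pd hf]
  refine Finset.sum_congr rfl fun α _ => ?_
  rw [pd_of_hasFDerivAt i (hasFDerivAt_pi'.1 hΦ.hasFDerivAt α)]
  rfl

lemma contDiffAt_pd {f : (Fin n → ℝ) → ℝ} {x : Fin n → ℝ} (hf : ContDiffAt ℝ ∞ f x) (i : Fin n) :
    ContDiffAt ℝ ∞ (pd i f) x := by
  have h1 : ContDiffAt ℝ ∞ (fun y => fderiv ℝ f y (Pi.single i 1)) x :=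
    (hf.fderiv_right (m := ∞) (by simp)).clm_apply contDiffAt_const
  refine h1.congr_of_eventuallyEq ?_
  filter_upwards [(hf.of_le (m := 1) (by simp)).eventually (by simp)] with y hy
  exact pd_eq_fderiv i (hy.differentiableAt (by simp))

lemma pd_pd_comm {f : (Fin n → ℝ) → ℝ} {x : Fin n → ℝ} (hf : ContDiffAt ℝ ∞ f x)
    (i j : Fin n) : pd i (pd j f) x = pd j (pd i f) x := by
  have hd : DifferentiableAt ℝ (fderiv ℝ f) x :=
    (hf.fderiv_right (m := ∞) (by simp)).differentiableAt (by simp)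
  have key : ∀ k l : Fin n, pd k (pd l f) x
      = fderiv ℝ (fderiv ℝ f) x (Pi.single k 1) (Pi.single l 1) := by
    intro k l
    have h1 : pd l f =ᶠ[𝓝 x] fun y => fderiv ℝ f y (Pi.single l 1) := by
      filter_upwards [(hf.of_le (m := 1) (by simp)).eventually (by simp)] with y hy
      exact pd_eq_fderiv l (hy.differentiableAt (by simp))
    rw [pd_congr k h1, pd_of_hasFDerivAt k (hd.hasFDerivAt.clm_apply (hasFDerivAt_const _ _))]
    simp
  rw [key, key]
  have h2 : minSmoothness ℝ 2 ≤ (∞ : ℕ∞ω) := by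
    rw [minSmoothness_of_isRCLikeNormedField]; exact WithTop.coe_le_coe.2 le_top
  exact (hf.isSymmSndFDerivAt h2).eq _ _

end PartialDerivatives

/-! ### Partial derivatives on phase space -/

lemma pd_position {F : Phase → ℝ} {z : Phase} (hF : DifferentiableAt ℝ F z) (μ : Fin 2) :
    pd μ (fun q => F (q, z.2)) z.1 = fderiv ℝ F z (Pi.single μ 1, 0) := by
  have h : HasFDerivAt (fun q : Fin 2 → ℝ => (q, z.2))
      ((ContinuousLinearMap.id ℝ (Fin 2 → ℝ)).prod 0) z.1 :=
    (hasFDerivAt_id z.1).prodMk (hasFDerivAt_const z.2 z.1)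
  have hF' : HasFDerivAt F (fderiv ℝ F z) (z.1, z.2) := hF.hasFDerivAt
  exact pd_of_hasFDerivAt μ (hF'.comp z.1 h)

lemma pd_momentum {F : Phase → ℝ} {z : Phase} (hF : DifferentiableAt ℝ F z) (μ : Fin 2) :
    pd μ (fun p => F (z.1, p)) z.2 = fderiv ℝ F z (0, Pi.single μ 1) := by
  have h : HasFDerivAt (fun p : Fin 2 → ℝ => (z.1, p))
      ((0 : (Fin 2 → ℝ) →L[ℝ] (Fin 2 → ℝ)).prod (ContinuousLinearMap.id ℝ (Fin 2 → ℝ))) z.2 :=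
    (hasFDerivAt_const z.1 z.2).prodMk (hasFDerivAt_id z.2)
  have hF' : HasFDerivAt F (fderiv ℝ F z) (z.1, z.2) := hF.hasFDerivAt
  exact pd_of_hasFDerivAt μ (hF'.comp z.2 h)

lemma fderiv_phase {F : Phase → ℝ} {z : Phase} (hF : DifferentiableAt ℝ F z) (v : Phase) :
    fderiv ℝ F z v = ∑ μ, (pd μ (fun q => F (q, z.2)) z.1 * v.1 μ
      + pd μ (fun p => F (z.1, p)) z.2 * v.2 μ) := by
  have hv : v = ∑ μ, (v.1 μ • ((Pi.single μ 1, 0) : Phase) + v.2 μ • ((0, Pi.single μ 1) : Phase)) := by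
    ext i <;> fin_cases i <;> simp [Fin.sum_univ_two]
  conv_lhs => rw [hv]
  simp only [map_sum, map_add, map_smul, smul_eq_mul]
  refine Finset.sum_congr rfl fun μ _ => ?_
  rw [pd_position hF, pd_momentum hF]
  ring

/-- The bracket uses only derivatives at a point: positions vary in an open set and `phaseOver D`
leaves the momenta free, so identities valid over `D` may be substituted inside brackets. -/
lemma poisson_congr {D : Set (Fin 2 → ℝ)} (hD : IsOpen D) {F F' K K' : Phase → ℝ}
    (hF : ∀ z ∈ phaseOver D, F z = F' z) (hK : ∀ z ∈ phaseOver D, K z = K' z) {z : Phase}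
    (hz : z ∈ phaseOver D) : poisson F K z = poisson F' K' z := by
  unfold poisson
  refine Finset.sum_congr rfl fun μ _ => ?_
  have hq : ∀ {A B : Phase → ℝ}, (∀ z ∈ phaseOver D, A z = B z) →
      pd μ (fun q => A (q, z.2)) z.1 = pd μ (fun q => B (q, z.2)) z.1 := fun h =>
    pd_congr_on hD (fun y hy => h (y, z.2) hy) hz μ
  have hp : ∀ {A B : Phase → ℝ}, (∀ z ∈ phaseOver D, A z = B z) →
      pd μ (fun p => A (z.1, p)) z.2 = pd μ (fun p => B (z.1, p)) z.2 := fun h =>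
    pd_congr_on isOpen_univ (fun y _ => h (z.1, y) hz) (Set.mem_univ _) μ
  rw [hq hF, hp hF, hq hK, hp hK]

lemma poisson_eq_fderiv {F K : Phase → ℝ} {z : Phase} (hF : DifferentiableAt ℝ F z)
    (hK : DifferentiableAt ℝ K z) : poisson F K z =
      ∑ μ, (fderiv ℝ F z (Pi.single μ 1, 0) * fderiv ℝ K z (0, Pi.single μ 1)
        - fderiv ℝ F z (0, Pi.single μ 1) * fderiv ℝ K z (Pi.single μ 1, 0)) := by
  simp only [poisson, pd_position hF, pd_position hK, pd_momentum hF, pd_momentum hK]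

lemma poisson_antisymm (F K : Phase → ℝ) (z : Phase) : poisson F K z = -poisson K F z := by
  unfold poisson
  rw [← Finset.sum_neg_distrib]
  exact Finset.sum_congr rfl fun μ _ => by ring

lemma poisson_self (F : Phase → ℝ) (z : Phase) : poisson F F z = 0 := by
  have := poisson_antisymm F F z
  linarith

lemma poisson_sum_left {ι : Type*} {s : Finset ι} {c : ι → ℝ} {F : ι → Phase → ℝ} {K : Phase → ℝ}
    {z : Phase} (hF : ∀ i ∈ s, DifferentiableAt ℝ (F i) z) (hK : DifferentiableAt ℝ K z) :
    poisson (fun y => ∑ i ∈ s, c i * F i y) K z = ∑ i ∈ s, c i * poisson (F i) K z := by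
  have h : HasFDerivAt (fun y => ∑ i ∈ s, c i * F i y) (∑ i ∈ s, c i • fderiv ℝ (F i) z) z :=
    HasFDerivAt.fun_sum fun i hi => (hF i hi).hasFDerivAt.const_mul (c i)
  have h1 : ∀ i ∈ s, c i * poisson (F i) K z = c i *
      ∑ μ, (fderiv ℝ (F i) z (Pi.single μ 1, 0) * fderiv ℝ K z (0, Pi.single μ 1)
        - fderiv ℝ (F i) z (0, Pi.single μ 1) * fderiv ℝ K z (Pi.single μ 1, 0)) :=
    fun i hi => by rw [poisson_eq_fderiv (hF i hi) hK]
  rw [poisson_eq_fderiv h.differentiableAt hK, h.fderiv, Finset.sum_congr rfl h1]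
  simp only [sum_apply, smul_apply, smul_eq_mul,
    Fin.sum_univ_two, Finset.sum_mul, ← Finset.sum_sub_distrib, ← Finset.sum_add_distrib]
  exact Finset.sum_congr rfl fun i _ => by ring

lemma poisson_sum_right {ι : Type*} {s : Finset ι} {c : ι → ℝ} {F : ι → Phase → ℝ} {K : Phase → ℝ}
    {z : Phase} (hF : ∀ i ∈ s, DifferentiableAt ℝ (F i) z) (hK : DifferentiableAt ℝ K z) :
    poisson K (fun y => ∑ i ∈ s, c i * F i y) z = ∑ i ∈ s, c i * poisson K (F i) z := by
  rw [poisson_antisymm, poisson_sum_left hF hK, ← Finset.sum_neg_distrib]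
  exact Finset.sum_congr rfl fun i _ => by rw [poisson_antisymm K]; ring

/-! ### Changes of coordinates -/

/-- The Jacobian matrix `∂Φ^α / ∂q^μ`. -/
def jac (Φ : (Fin 2 → ℝ) → Fin 2 → ℝ) (q : Fin 2 → ℝ) : Matrix (Fin 2) (Fin 2) ℝ :=
  Matrix.of fun α μ => pd μ (fun y => Φ y α) q

/-- `Φ` is a diffeomorphism from `D` to `D'` with inverse `Ψ`. -/
structure ChartMap (D D' : Set (Fin 2 → ℝ)) (Φ Ψ : (Fin 2 → ℝ) → Fin 2 → ℝ) : Prop where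
  isOpen : IsOpen D
  isOpen' : IsOpen D'
  mapsTo : ∀ q ∈ D, Φ q ∈ D'
  mapsTo' : ∀ q ∈ D', Ψ q ∈ D
  leftInv : ∀ q ∈ D, Ψ (Φ q) = q
  rightInv : ∀ q ∈ D', Φ (Ψ q) = q
  smooth : ContDiffOn ℝ ∞ Φ D
  smooth' : ContDiffOn ℝ ∞ Ψ D'

namespace ChartMap

variable {D D' : Set (Fin 2 → ℝ)} {Φ Ψ : (Fin 2 → ℝ) → Fin 2 → ℝ}

lemma symm (h : ChartMap D D' Φ Ψ) : ChartMap D' D Ψ Φ :=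
  ⟨h.isOpen', h.isOpen, h.mapsTo', h.mapsTo, h.rightInv, h.leftInv, h.smooth', h.smooth⟩

lemma contDiffAt (h : ChartMap D D' Φ Ψ) {q : Fin 2 → ℝ} (hq : q ∈ D) : ContDiffAt ℝ ∞ Φ q :=
  h.smooth.contDiffAt (h.isOpen.mem_nhds hq)

lemma contDiffAt_apply (h : ChartMap D D' Φ Ψ) {q : Fin 2 → ℝ} (hq : q ∈ D) (α : Fin 2) :
    ContDiffAt ℝ ∞ (fun y => Φ y α) q :=
  contDiffAt_pi.1 (h.contDiffAt hq) α

lemma differentiableAt (h : ChartMap D D' Φ Ψ) {q : Fin 2 → ℝ} (hq : q ∈ D) :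
    DifferentiableAt ℝ Φ q :=
  (h.contDiffAt hq).differentiableAt (by simp)

lemma contDiffAt_jac (h : ChartMap D D' Φ Ψ) {q : Fin 2 → ℝ} (hq : q ∈ D) (α μ : Fin 2) :
    ContDiffAt ℝ ∞ (fun y => jac Φ y α μ) q :=
  contDiffAt_pd (h.contDiffAt_apply hq α) μ

lemma pd_jac_comm (h : ChartMap D D' Φ Ψ) {q : Fin 2 → ℝ} (hq : q ∈ D) (α μ ν : Fin 2) :
    pd ν (fun y => jac Φ y α μ) q = pd μ (fun y => jac Φ y α ν) q :=
  pd_pd_comm (h.contDiffAt_apply hq α) ν μ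

lemma jac_mul_jac (h : ChartMap D D' Φ Ψ) {q : Fin 2 → ℝ} (hq : q ∈ D) :
    jac Ψ (Φ q) * jac Φ q = 1 := by
  ext α μ
  have h1 := pd_comp μ (f := fun y => Ψ y α) (Φ := Φ) (x := q)
    ((h.symm.contDiffAt_apply (h.mapsTo q hq) α).differentiableAt (by simp)) (h.differentiableAt hq)
  have h2 : pd μ (fun y => Ψ (Φ y) α) q = pd μ (fun y => y α) q :=
    pd_congr_on h.isOpen (fun y hy => by rw [h.leftInv y hy]) hq μ
  rw [h2, pd_coord] at h1
  simp only [Matrix.mul_apply, jac, Matrix.of_apply, ← h1, Matrix.one_apply, eq_comm]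

lemma jac_mul_jac' (h : ChartMap D D' Φ Ψ) {q : Fin 2 → ℝ} (hq : q ∈ D) :
    jac Φ q * jac Ψ (Φ q) = 1 :=
  mul_eq_one_comm.1 (h.jac_mul_jac hq)

/-- Phase space functions that correspond to each other under the change of coordinates. -/
def Related (D : Set (Fin 2 → ℝ)) (Φ : (Fin 2 → ℝ) → Fin 2 → ℝ) (F F' : Phase → ℝ) : Prop :=
  ∀ q ∈ D, ∀ P : Fin 2 → ℝ, F (q, (jac Φ q)ᵀ *ᵥ P) = F' (Φ q, P)

/-- The total derivative along a section of phase space. It is applied to `Ξ y = (jac Φ y)ᵀ P` with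
`P` fixed, where the transformed momentum varies with the base point. -/
lemma pd_section {F : Phase → ℝ} {Ξ : (Fin 2 → ℝ) → Fin 2 → ℝ} {q : Fin 2 → ℝ}
    (hF : DifferentiableAt ℝ F (q, Ξ q)) (hΞ : DifferentiableAt ℝ Ξ q) (ν : Fin 2) :
    pd ν (fun y => F (y, Ξ y)) q = pd ν (fun y => F (y, Ξ q)) q
      + ∑ μ, pd μ (fun p => F (q, p)) (Ξ q) * pd ν (fun y => Ξ y μ) q := by
  have h : HasFDerivAt (fun y => (y, Ξ y)) ((ContinuousLinearMap.id ℝ _).prod (fderiv ℝ Ξ q)) q :=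
    (hasFDerivAt_id q).prodMk hΞ.hasFDerivAt
  have hv : ∀ μ, fderiv ℝ Ξ q (Pi.single ν 1) μ = pd ν (fun y => Ξ y μ) q := fun μ =>
    (pd_of_hasFDerivAt ν (hasFDerivAt_pi'.1 hΞ.hasFDerivAt μ)).symm
  refine (pd_of_hasFDerivAt ν (hF.hasFDerivAt.comp q h)).trans ?_
  rw [ContinuousLinearMap.comp_apply, fderiv_phase hF]
  simp only [ContinuousLinearMap.prod_apply, ContinuousLinearMap.id_apply, hv,
    Finset.sum_add_distrib]
  congr 1
  fin_cases ν <;> simp [Fin.sum_univ_two]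

/-- The cotangent lift of a diffeomorphism is canonical: the chain rule produces the Jacobian in
positions and its inverse transpose in momenta, and the leftover terms contain second derivatives of
`Φ`, which cancel by symmetry. -/
lemma poisson_eq (h : ChartMap D D' Φ Ψ) {F F' K K' : Phase → ℝ}
    (hF : Related D Φ F F') (hK : Related D Φ K K') {q P : Fin 2 → ℝ} (hq : q ∈ D)
    (dF : ∀ z ∈ phaseOver D, DifferentiableAt ℝ F z)
    (dF' : ∀ z ∈ phaseOver D', DifferentiableAt ℝ F' z)
    (dK : ∀ z ∈ phaseOver D, DifferentiableAt ℝ K z)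
    (dK' : ∀ z ∈ phaseOver D', DifferentiableAt ℝ K' z) :
    poisson F K (q, (jac Φ q)ᵀ *ᵥ P) = poisson F' K' (Φ q, P) := by
  have hΞ : DifferentiableAt ℝ (fun y => (jac Φ y)ᵀ *ᵥ P) q := by
    rw [differentiableAt_pi]
    intro μ
    simp only [Matrix.mulVec, dotProduct, Matrix.transpose_apply]
    exact DifferentiableAt.fun_sum fun α _ =>
      ((h.contDiffAt_jac hq α μ).differentiableAt (by simp)).mul_const _
  have hpdΞ : ∀ ν μ, pd ν (fun y => ((jac Φ y)ᵀ *ᵥ P) μ) q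
      = pd ν (fun y => jac Φ y 0 μ) q * P 0 + pd ν (fun y => jac Φ y 1 μ) q * P 1 := by
    intro ν μ
    simp only [Matrix.mulVec, dotProduct, Matrix.transpose_apply, Fin.sum_univ_two]
    have d := fun α => (h.contDiffAt_jac hq α μ).differentiableAt (by simp)
    rw [pd_add ν ((d 0).mul_const _) ((d 1).mul_const _), pd_mul ν (d 0) (by fun_prop),
      pd_mul ν (d 1) (by fun_prop)]
    simp
  have hA : ∀ {F F' : Phase → ℝ}, Related D Φ F F' → (∀ z ∈ phaseOver D, DifferentiableAt ℝ F z) →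
      (∀ z ∈ phaseOver D', DifferentiableAt ℝ F' z) → ∀ ν,
      ∑ α, pd α (fun y => F' (y, P)) (Φ q) * jac Φ q α ν
        = pd ν (fun y => F (y, (jac Φ q)ᵀ *ᵥ P)) q
          + ∑ μ, pd μ (fun p => F (q, p)) ((jac Φ q)ᵀ *ᵥ P)
            * pd ν (fun y => ((jac Φ y)ᵀ *ᵥ P) μ) q := by
    intro F F' hF dF dF' ν
    rw [← pd_section (Ξ := fun y => (jac Φ y)ᵀ *ᵥ P) (dF (q, _) hq) hΞ ν]
    have h2 : pd ν (fun y => F (y, (jac Φ y)ᵀ *ᵥ P)) q = pd ν (fun y => F' (Φ y, P)) q :=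
      pd_congr_on h.isOpen (fun y hy => hF y hy P) hq ν
    rw [h2, pd_comp ν (f := fun y => F' (y, P)) (Φ := Φ) _ (h.differentiableAt hq)]
    · rfl
    · exact (dF' (Φ q, P) (h.mapsTo q hq)).comp (Φ q) (by fun_prop : DifferentiableAt ℝ
        (fun y : Fin 2 → ℝ => (y, P)) (Φ q))
  have hB : ∀ {F F' : Phase → ℝ}, Related D Φ F F' → (∀ z ∈ phaseOver D, DifferentiableAt ℝ F z) →
      ∀ α, pd α (fun p => F' (Φ q, p)) P
        = ∑ μ, pd μ (fun p => F (q, p)) ((jac Φ q)ᵀ *ᵥ P) * jac Φ q α μ := by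
    intro F F' hF dF α
    have h2 : (fun p => F' (Φ q, p)) = fun p => F (q, (jac Φ q)ᵀ *ᵥ p) :=
      funext fun p => (hF q hq p).symm
    have hlin : ∀ μ, HasFDerivAt (fun y : Fin 2 → ℝ => ((jac Φ q)ᵀ *ᵥ y) μ)
        (∑ β, jac Φ q β μ • ContinuousLinearMap.proj (R := ℝ) (φ := fun _ : Fin 2 => ℝ) β) P := by
      intro μ
      simp only [Matrix.mulVec, dotProduct, Matrix.transpose_apply]
      exact HasFDerivAt.fun_sum fun β _ => (ContinuousLinearMap.proj (R := ℝ)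
        (φ := fun _ : Fin 2 => ℝ) β).hasFDerivAt.const_mul _
    rw [h2, pd_comp α (f := fun p => F (q, p)) (Φ := fun p => (jac Φ q)ᵀ *ᵥ p)]
    · refine Finset.sum_congr rfl fun μ _ => ?_
      rw [pd_of_hasFDerivAt α (hlin μ)]
      congr 1
      fin_cases α <;> simp [Fin.sum_univ_two]
    · exact (dF (q, _) hq).comp _ (by fun_prop : DifferentiableAt ℝ
        (fun y : Fin 2 → ℝ => (q, y)) ((jac Φ q)ᵀ *ᵥ P))
    · exact differentiableAt_pi.2 fun μ => (hlin μ).differentiableAt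
  have aF0 := hA hF dF dF' 0
  have aF1 := hA hF dF dF' 1
  have aK0 := hA hK dK dK' 0
  have aK1 := hA hK dK dK' 1
  simp only [hpdΞ, Fin.sum_univ_two] at aF0 aF1 aK0 aK1
  -- Symmetry of the second derivatives of `Φ`: after it the Hessian terms of the two components
  -- agree and drop out of the antisymmetric combination.
  rw [h.pd_jac_comm hq 0 0 1, h.pd_jac_comm hq 1 0 1] at aF1 aK1
  simp only [poisson, hB hF dF, hB hK dK, Fin.sum_univ_two]
  set m0 := pd 0 (fun p => F (q, p)) ((jac Φ q)ᵀ *ᵥ P)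
  set m1 := pd 1 (fun p => F (q, p)) ((jac Φ q)ᵀ *ᵥ P)
  set k0 := pd 0 (fun p => K (q, p)) ((jac Φ q)ᵀ *ᵥ P)
  set k1 := pd 1 (fun p => K (q, p)) ((jac Φ q)ᵀ *ᵥ P)
  linear_combination m0 * aK0 + m1 * aK1 - k0 * aF0 - k1 * aF1

/-- Naturality of the Lie derivative. Differentiating `g = Jᵀ g' J` and `J ξ = ξ'` brings in
derivatives of `J` twice, with opposite effect once the Hessian of `Φ` is symmetrised. -/
lemma lieMetric_eq (h : ChartMap D D' Φ Ψ) {g g' : (Fin 2 → ℝ) → Matrix (Fin 2) (Fin 2) ℝ}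
    {ξ ξ' : (Fin 2 → ℝ) → Fin 2 → ℝ}
    (hg : ∀ q ∈ D, g q = (jac Φ q)ᵀ * g' (Φ q) * jac Φ q)
    (hξ : ∀ q ∈ D, jac Φ q *ᵥ ξ q = ξ' (Φ q))
    (dg' : ∀ q ∈ D', ∀ i j, DifferentiableAt ℝ (fun y => g' y i j) q)
    (dξ : ∀ q ∈ D, DifferentiableAt ℝ ξ q) (dξ' : ∀ q ∈ D', DifferentiableAt ℝ ξ' q)
    {q : Fin 2 → ℝ} (hq : q ∈ D) :
    lieMetric ξ g q = (jac Φ q)ᵀ * lieMetric ξ' g' (Φ q) * jac Φ q := by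
  have dJ : ∀ α μ, DifferentiableAt ℝ (fun y => jac Φ y α μ) q := fun α μ =>
    (h.contDiffAt_jac hq α μ).differentiableAt (by simp)
  have dgΦ : ∀ α β, DifferentiableAt ℝ (fun y => g' (Φ y) α β) q := fun α β =>
    (dg' (Φ q) (h.mapsTo q hq) α β).comp q (h.differentiableAt hq)
  have dξi : ∀ μ, DifferentiableAt ℝ (fun y => ξ y μ) q := differentiableAt_pi.1 (dξ q hq)
  have hpg : ∀ ρ μ ν, pd ρ (fun y => g y μ ν) q = ∑ α, ∑ β,
      (pd ρ (fun y => jac Φ y α μ) q * g' (Φ q) α β * jac Φ q β ν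
        + jac Φ q α μ * (∑ γ, pd γ (fun y => g' y α β) (Φ q) * jac Φ q γ ρ) * jac Φ q β ν
        + jac Φ q α μ * g' (Φ q) α β * pd ρ (fun y => jac Φ y β ν) q) := by
    intro ρ μ ν
    have h1 : pd ρ (fun y => g y μ ν) q
        = pd ρ (fun y => ∑ α, ∑ β, jac Φ y α μ * g' (Φ y) α β * jac Φ y β ν) q := by
      refine pd_congr_on h.isOpen (fun y hy => ?_) hq ρ
      rw [hg y hy]
      simp only [Matrix.mul_apply, Matrix.transpose_apply, Fin.sum_univ_two]
      ring
    rw [h1, pd_sum ρ fun α _ => DifferentiableAt.fun_sum fun β _ =>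
      ((dJ α μ).fun_mul (dgΦ α β)).fun_mul (dJ β ν)]
    refine Finset.sum_congr rfl fun α _ => ?_
    rw [pd_sum ρ fun β _ => ((dJ α μ).fun_mul (dgΦ α β)).fun_mul (dJ β ν)]
    refine Finset.sum_congr rfl fun β _ => ?_
    rw [pd_mul ρ ((dJ α μ).fun_mul (dgΦ α β)) (dJ β ν), pd_mul ρ (dJ α μ) (dgΦ α β),
      pd_comp ρ (f := fun y => g' y α β) (dg' (Φ q) (h.mapsTo q hq) α β) (h.differentiableAt hq)]
    simp only [jac, Matrix.of_apply]
    ring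
  have hpξ : ∀ μ α, ∑ γ, pd γ (fun y => ξ' y α) (Φ q) * jac Φ q γ μ
      = ∑ ρ, (pd μ (fun y => jac Φ y α ρ) q * ξ q ρ + jac Φ q α ρ * pd μ (fun y => ξ y ρ) q) := by
    intro μ α
    have h1 := pd_comp μ (f := fun y => ξ' y α) (Φ := Φ)
      (differentiableAt_pi.1 (dξ' (Φ q) (h.mapsTo q hq)) α) (h.differentiableAt hq)
    have h2 : pd μ (fun y => ξ' (Φ y) α) q = pd μ (fun y => ∑ ρ, jac Φ y α ρ * ξ y ρ) q :=
      pd_congr_on h.isOpen (fun y hy => by rw [← hξ y hy]; rfl) hq μ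
    rw [h2, pd_sum μ fun ρ _ => (dJ α ρ).fun_mul (dξi ρ)] at h1
    simp only [jac, Matrix.of_apply] at h1 ⊢
    rw [← h1]
    exact Finset.sum_congr rfl fun ρ _ => pd_mul μ (dJ α ρ) (dξi ρ)
  have hx : ∀ α, ξ' (Φ q) α = jac Φ q α 0 * ξ q 0 + jac Φ q α 1 * ξ q 1 := by
    intro α
    rw [← hξ q hq]
    simp [Matrix.mulVec, dotProduct, Fin.sum_univ_two]
  have hgq : ∀ μ ν, g q μ ν = ∑ α, ∑ β, jac Φ q α μ * g' (Φ q) α β * jac Φ q β ν := by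
    intro μ ν
    rw [hg q hq]
    simp only [Matrix.mul_apply, Matrix.transpose_apply, Fin.sum_univ_two]
    ring
  have key : ∀ μ ν, lieMetric ξ g q μ ν
      = ∑ α, ∑ β, jac Φ q α μ * lieMetric ξ' g' (Φ q) α β * jac Φ q β ν := by
    intro μ ν
    have e0 := hpξ μ 0
    have e1 := hpξ μ 1
    have f0 := hpξ ν 0
    have f1 := hpξ ν 1
    simp only [lieMetric, Matrix.of_apply, Fin.sum_univ_two, hpg, hgq, hx] at e0 e1 f0 f1 ⊢
    have s := fun α => h.pd_jac_comm hq α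
    rw [s 0 0 μ, s 0 1 μ] at e0
    rw [s 1 0 μ, s 1 1 μ] at e1
    rw [s 0 0 ν, s 0 1 ν] at f0
    rw [s 1 0 ν, s 1 1 ν] at f1
    linear_combination
      -(g' (Φ q) 0 0 * jac Φ q 0 ν + g' (Φ q) 0 1 * jac Φ q 1 ν) * e0
      - (g' (Φ q) 1 0 * jac Φ q 0 ν + g' (Φ q) 1 1 * jac Φ q 1 ν) * e1
      - (g' (Φ q) 0 0 * jac Φ q 0 μ + g' (Φ q) 1 0 * jac Φ q 1 μ) * f0
      - (g' (Φ q) 0 1 * jac Φ q 0 μ + g' (Φ q) 1 1 * jac Φ q 1 μ) * f1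
  ext μ ν
  rw [key]
  simp only [Matrix.mul_apply, Matrix.transpose_apply, Fin.sum_univ_two]
  ring

end ChartMap

/-! ### Regular data and differentiability of the charges -/

namespace Mechanics

/-- Smoothness and nondegeneracy of the data `g = g̃ / N` and `N Ũ` on an open set. -/
structure IsRegular (S : Mechanics) (D : Set (Fin 2 → ℝ)) (N : (Fin 2 → ℝ) → ℝ) : Prop where
  isOpen : IsOpen D
  metric : ∀ i j, ContDiffOn ℝ ∞ (fun q => S.lapseMetric N q i j) D
  det : ∀ q ∈ D, (S.lapseMetric N q).det ≠ 0
  potential : ContDiffOn ℝ ∞ (fun q => N q * S.potential q) D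

variable {S : Mechanics} {D : Set (Fin 2 → ℝ)} {N : (Fin 2 → ℝ) → ℝ}

lemma IsAdmissible.congr {U₀ lam : ℝ} {ξ η : (Fin 2 → ℝ) → Fin 2 → ℝ} (hD : IsOpen D)
    (h : S.IsAdmissible D N U₀ lam ξ) (e : ∀ q ∈ D, η q = ξ q) :
    S.IsAdmissible D N U₀ lam η := by
  refine ⟨h.1.congr e, fun q hq => ?_⟩
  have hl : lieMetric η (S.lapseMetric N) q = lieMetric ξ (S.lapseMetric N) q := by
    ext μ ν
    simp only [lieMetric, Matrix.of_apply, e q hq]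
    refine Finset.sum_congr rfl fun ρ _ => ?_
    rw [pd_congr_on hD (f := fun y => η y ρ) (g := fun y => ξ y ρ)
      (fun y hy => by rw [e y hy]) hq, pd_congr_on hD (f := fun y => η y ρ) (g := fun y => ξ y ρ)
      (fun y hy => by rw [e y hy]) hq]
  rw [hl, e q hq]
  exact h.2 q hq

lemma differentiableAt_fst_comp {f : (Fin 2 → ℝ) → ℝ} {z : Phase}
    (hf : DifferentiableAt ℝ f z.1) : DifferentiableAt ℝ (fun y : Phase => f y.1) z :=
  hf.comp z differentiableAt_fst

lemma differentiableAt_momentum (i : Fin 2) (z : Phase) :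
    DifferentiableAt ℝ (fun y : Phase => y.2 i) z :=
  (differentiableAt_pi.1 differentiableAt_snd) i

lemma differentiableAt_Ccharge {ξ : (Fin 2 → ℝ) → Fin 2 → ℝ} (hD : IsOpen D)
    (hξ : ContDiffOn ℝ ∞ ξ D) {z : Phase} (hz : z ∈ phaseOver D) :
    DifferentiableAt ℝ (Ccharge ξ) z := by
  have h1 : DifferentiableAt ℝ ξ z.1 :=
    (hξ.contDiffAt (hD.mem_nhds hz)).differentiableAt (by simp)
  unfold Ccharge dotProduct
  exact DifferentiableAt.fun_sum fun i _ => (differentiableAt_momentum i z).fun_mul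
    (differentiableAt_fst_comp (differentiableAt_pi.1 h1 i))

namespace IsRegular

lemma differentiableAt_metric (h : S.IsRegular D N) {q : Fin 2 → ℝ} (hq : q ∈ D) (i j : Fin 2) :
    DifferentiableAt ℝ (fun y => S.lapseMetric N y i j) q :=
  ((h.metric i j).contDiffAt (h.isOpen.mem_nhds hq)).differentiableAt (by simp)

lemma differentiableAt_potential (h : S.IsRegular D N) {q : Fin 2 → ℝ} (hq : q ∈ D) :
    DifferentiableAt ℝ (fun y => N y * S.potential y) q :=
  (h.potential.contDiffAt (h.isOpen.mem_nhds hq)).differentiableAt (by simp)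

lemma differentiableAt_Vcharge (h : S.IsRegular D N) {ξ η : (Fin 2 → ℝ) → Fin 2 → ℝ}
    (hξ : ContDiffOn ℝ ∞ ξ D) (hη : ContDiffOn ℝ ∞ η D) {z : Phase} (hz : z ∈ phaseOver D) :
    DifferentiableAt ℝ (S.Vcharge N ξ η) z := by
  have h1 : DifferentiableAt ℝ ξ z.1 :=
    (hξ.contDiffAt (h.isOpen.mem_nhds hz)).differentiableAt (by simp)
  have h2 : DifferentiableAt ℝ η z.1 :=
    (hη.contDiffAt (h.isOpen.mem_nhds hz)).differentiableAt (by simp)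
  unfold Vcharge dotProduct Matrix.mulVec dotProduct
  exact DifferentiableAt.fun_sum fun i _ =>
    (differentiableAt_fst_comp (differentiableAt_pi.1 h1 i)).fun_mul
      (DifferentiableAt.fun_sum fun j _ =>
        (differentiableAt_fst_comp (h.differentiableAt_metric hz i j)).fun_mul
          (differentiableAt_fst_comp (differentiableAt_pi.1 h2 j)))

lemma differentiableAt_hamiltonian (h : S.IsRegular D N) {z : Phase} (hz : z ∈ phaseOver D) :
    DifferentiableAt ℝ (S.hamiltonian N) z := by
  have hg := fun i j => differentiableAt_fst_comp (h.differentiableAt_metric hz i j)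
  have hdet : DifferentiableAt ℝ (fun y : Phase => (S.lapseMetric N y.1).det) z := by
    simp only [Matrix.det_fin_two]
    exact ((hg 0 0).fun_mul (hg 1 1)).fun_sub ((hg 0 1).fun_mul (hg 1 0))
  have hadj : ∀ i j, DifferentiableAt ℝ (fun y : Phase => (S.lapseMetric N y.1).adjugate i j) z := by
    intro i j
    simp only [Matrix.adjugate_fin_two]
    fin_cases i <;> fin_cases j <;> simp <;> exact hg _ _
  have hinv : ∀ i j, DifferentiableAt ℝ (fun y : Phase => (S.lapseMetric N y.1)⁻¹ i j) z := by
    intro i j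
    simp only [Matrix.inv_def, Ring.inverse_eq_inv', Matrix.smul_apply, smul_eq_mul]
    exact (hdet.fun_inv (h.det z.1 hz)).fun_mul (hadj i j)
  unfold hamiltonian dotProduct Matrix.mulVec dotProduct
  refine DifferentiableAt.fun_add (DifferentiableAt.const_mul (DifferentiableAt.fun_sum fun i _ =>
    (differentiableAt_momentum i z).fun_mul (DifferentiableAt.fun_sum fun j _ =>
      (hinv i j).fun_mul (differentiableAt_momentum j z))) _) ?_
  exact differentiableAt_fst_comp (h.differentiableAt_potential hz)

lemma differentiableAt_Qzero (h : S.IsRegular D N) (U₀ : ℝ) {z : Phase} (hz : z ∈ phaseOver D) :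
    DifferentiableAt ℝ (S.Qzero N U₀) z :=
  (h.differentiableAt_hamiltonian hz).sub_const _

lemma differentiableAt_genL (h : S.IsRegular D N) (U₀ : ℝ) {ξb ξd : (Fin 2 → ℝ) → Fin 2 → ℝ}
    (hb : ContDiffOn ℝ ∞ ξb D) (hd : ContDiffOn ℝ ∞ ξd D) (n : ℤ) (t : ℝ) {z : Phase}
    (hz : z ∈ phaseOver D) : DifferentiableAt ℝ (S.genL N U₀ ξb ξd n t) z :=
  (((h.differentiableAt_Vcharge hb hb hz).const_mul _).fun_add
    ((differentiableAt_Ccharge h.isOpen hd hz).const_mul _)).fun_sub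
      ((h.differentiableAt_Qzero U₀ hz).const_mul _)

lemma differentiableAt_genS (h : S.IsRegular D N) {ξt ξx ξb : (Fin 2 → ℝ) → Fin 2 → ℝ}
    (ht : ContDiffOn ℝ ∞ ξt D) (hx : ContDiffOn ℝ ∞ ξx D) (hb : ContDiffOn ℝ ∞ ξb D)
    (ε k : ℤ) (t : ℝ) {z : Phase} (hz : z ∈ phaseOver D) :
    DifferentiableAt ℝ (S.genS N ξt ξx ξb ε k t) z :=
  ((((h.differentiableAt_Vcharge hb hx hz).const_mul _).fun_add
    ((differentiableAt_Ccharge h.isOpen ht hz).const_mul _)).fun_add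
    ((((h.differentiableAt_Vcharge hb ht hz).const_mul _).fun_add
    ((differentiableAt_Ccharge h.isOpen hx hz).const_mul _)).const_mul _)).const_mul _

end IsRegular

end Mechanics

open Mechanics

/-- Two regular models, each with a choice of lapse, that are related by a change of
coordinates. -/
structure Transport (D D' : Set (Fin 2 → ℝ)) (Φ Ψ : (Fin 2 → ℝ) → Fin 2 → ℝ)
    (S : Mechanics) (N : (Fin 2 → ℝ) → ℝ) (S' : Mechanics) (N' : (Fin 2 → ℝ) → ℝ) : Prop where
  chart : ChartMap D D' Φ Ψ
  regular : S.IsRegular D N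
  regular' : S'.IsRegular D' N'
  metric : ∀ q ∈ D, S.lapseMetric N q = (jac Φ q)ᵀ * S'.lapseMetric N' (Φ q) * jac Φ q
  potential : ∀ q ∈ D, N q * S.potential q = N' (Φ q) * S'.potential (Φ q)

/-- The pullback of a vector field along the change of coordinates with inverse `Ψ`. -/
def pullField (Φ Ψ ξ' : (Fin 2 → ℝ) → Fin 2 → ℝ) (q : Fin 2 → ℝ) : Fin 2 → ℝ :=
  jac Ψ (Φ q) *ᵥ ξ' (Φ q)

lemma ChartMap.jac_mulVec_pullField {D D' : Set (Fin 2 → ℝ)} {Φ Ψ : (Fin 2 → ℝ) → Fin 2 → ℝ}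
    (h : ChartMap D D' Φ Ψ) (ξ' : (Fin 2 → ℝ) → Fin 2 → ℝ) {q : Fin 2 → ℝ} (hq : q ∈ D) :
    jac Φ q *ᵥ pullField Φ Ψ ξ' q = ξ' (Φ q) := by
  rw [pullField, Matrix.mulVec_mulVec, h.jac_mul_jac' hq, Matrix.one_mulVec]

lemma ChartMap.pullField_pullField {D D' : Set (Fin 2 → ℝ)} {Φ Ψ : (Fin 2 → ℝ) → Fin 2 → ℝ}
    (h : ChartMap D D' Φ Ψ) (ξ : (Fin 2 → ℝ) → Fin 2 → ℝ) {q : Fin 2 → ℝ} (hq : q ∈ D) :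
    pullField Φ Ψ (pullField Ψ Φ ξ) q = ξ q := by
  rw [pullField, pullField, h.leftInv q hq, Matrix.mulVec_mulVec, h.jac_mul_jac hq,
    Matrix.one_mulVec]

lemma ChartMap.contDiffOn_pullField {D D' : Set (Fin 2 → ℝ)} {Φ Ψ : (Fin 2 → ℝ) → Fin 2 → ℝ}
    (h : ChartMap D D' Φ Ψ) {ξ' : (Fin 2 → ℝ) → Fin 2 → ℝ} (hξ' : ContDiffOn ℝ ∞ ξ' D') :
    ContDiffOn ℝ ∞ (pullField Φ Ψ ξ') D := by
  intro q hq
  refine ContDiffAt.contDiffWithinAt ?_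
  rw [contDiffAt_pi]
  intro μ
  simp only [pullField, Matrix.mulVec, dotProduct]
  refine ContDiffAt.sum fun α _ => ContDiffAt.mul ?_ ?_
  · exact (h.symm.contDiffAt_jac (h.mapsTo q hq) μ α).comp q (h.contDiffAt hq)
  · exact (contDiffAt_pi.1 (hξ'.contDiffAt (h.isOpen'.mem_nhds (h.mapsTo q hq))) α).comp q
      (h.contDiffAt hq)

/-! ### Invariance of all the notions under a change of coordinates -/

namespace Transport

variable {D D' : Set (Fin 2 → ℝ)} {Φ Ψ : (Fin 2 → ℝ) → Fin 2 → ℝ} {S S' : Mechanics}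
  {N N' : (Fin 2 → ℝ) → ℝ}

lemma symm (T : Transport D D' Φ Ψ S N S' N') : Transport D' D Ψ Φ S' N' S N where
  chart := T.chart.symm
  regular := T.regular'
  regular' := T.regular
  metric q hq := by
    have h1 := T.chart.symm.jac_mul_jac hq
    rw [T.metric _ (T.chart.mapsTo' q hq), T.chart.rightInv q hq]
    rw [← mul_assoc, ← mul_assoc, ← Matrix.transpose_mul, h1, mul_assoc, h1]
    simp
  potential q hq := by rw [T.potential _ (T.chart.mapsTo' q hq), T.chart.rightInv q hq]

lemma isAdmissible (T : Transport D D' Φ Ψ S N S' N') {U₀ lam : ℝ}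
    {ξ' : (Fin 2 → ℝ) → Fin 2 → ℝ} (h : S'.IsAdmissible D' N' U₀ lam ξ') :
    S.IsAdmissible D N U₀ lam (pullField Φ Ψ ξ') := by
  have hs := T.chart.contDiffOn_pullField h.1
  refine ⟨hs, fun q hq => ?_⟩
  have hq' := T.chart.mapsTo q hq
  have hd : ∀ q ∈ D, DifferentiableAt ℝ (pullField Φ Ψ ξ') q := fun q hq =>
    (hs.contDiffAt (T.chart.isOpen.mem_nhds hq)).differentiableAt (by simp)
  have hd' : ∀ q ∈ D', DifferentiableAt ℝ ξ' q := fun q hq =>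
    (h.1.contDiffAt (T.chart.isOpen'.mem_nhds hq)).differentiableAt (by simp)
  constructor
  · rw [T.chart.lieMetric_eq T.metric (fun q hq => T.chart.jac_mulVec_pullField ξ' hq)
      (fun q hq => T.regular'.differentiableAt_metric hq) hd hd' hq, (h.2 _ hq').1, T.metric q hq]
    simp
  · have h2 := (h.2 _ hq').2
    rw [T.potential q hq, ← h2]
    have h3 : ∀ μ, pd μ (fun y => N y * S.potential y - U₀) q
        = ∑ α, pd α (fun y => N' y * S'.potential y - U₀) (Φ q) * jac Φ q α μ := by
      intro μ
      have := pd_comp μ (f := fun y => N' y * S'.potential y - U₀)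
        ((T.regular'.differentiableAt_potential hq').sub_const _) (T.chart.differentiableAt hq)
      rw [pd_congr_on T.chart.isOpen (g := fun y => N' (Φ y) * S'.potential (Φ y) - U₀)
        (fun y hy => by rw [T.potential y hy]) hq, this]
      rfl
    rw [← T.chart.jac_mulVec_pullField ξ' hq]
    simp only [h3, Matrix.mulVec, dotProduct, Fin.sum_univ_two]
    ring

open ChartMap

lemma related_Ccharge (T : Transport D D' Φ Ψ S N S' N') (ξ' : (Fin 2 → ℝ) → Fin 2 → ℝ) :
    Related D Φ (Ccharge (pullField Φ Ψ ξ')) (Ccharge ξ') := by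
  intro q hq P
  simp only [Ccharge]
  rw [← T.chart.jac_mulVec_pullField ξ' hq, Matrix.mulVec_transpose, Matrix.dotProduct_mulVec]

lemma related_Vcharge (T : Transport D D' Φ Ψ S N S' N') (ξ' η' : (Fin 2 → ℝ) → Fin 2 → ℝ) :
    Related D Φ (S.Vcharge N (pullField Φ Ψ ξ') (pullField Φ Ψ η')) (S'.Vcharge N' ξ' η') := by
  intro q hq P
  simp only [Vcharge]
  rw [← T.chart.jac_mulVec_pullField ξ' hq, ← T.chart.jac_mulVec_pullField η' hq, T.metric q hq]
  simp only [Matrix.mulVec_mulVec, Matrix.dotProduct_mulVec, Matrix.vecMul_mulVec, mul_assoc]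

/-- The factors by which the momenta change are absorbed by `J (Jᵀ g' J)⁻¹ Jᵀ = g'⁻¹`. -/
lemma related_hamiltonian (T : Transport D D' Φ Ψ S N S' N') :
    Related D Φ (S.hamiltonian N) (S'.hamiltonian N') := by
  intro q hq P
  have hJ := T.chart.jac_mul_jac' hq
  have hJu : jac Φ q * (jac Φ q)⁻¹ = 1 :=
    Matrix.mul_nonsing_inv _ ((Matrix.isUnit_iff_isUnit_det _).1 (IsUnit.of_mul_eq_one _ hJ))
  simp only [hamiltonian]
  rw [T.potential q hq, T.metric q hq]
  congr 2
  have h1 : jac Φ q * ((jac Φ q)ᵀ * S'.lapseMetric N' (Φ q) * jac Φ q)⁻¹ * (jac Φ q)ᵀ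
      = (S'.lapseMetric N' (Φ q))⁻¹ := by
    have hJt : ((jac Φ q)ᵀ)⁻¹ * (jac Φ q)ᵀ = 1 := by
      rw [← Matrix.transpose_nonsing_inv, ← Matrix.transpose_mul, hJu, Matrix.transpose_one]
    rw [Matrix.mul_inv_rev, Matrix.mul_inv_rev, ← mul_assoc, hJu, one_mul, mul_assoc, hJt, mul_one]
  rw [Matrix.mulVec_mulVec, Matrix.mulVec_transpose, ← Matrix.dotProduct_mulVec,
    Matrix.mulVec_mulVec, ← mul_assoc, h1]

lemma related_Qzero (T : Transport D D' Φ Ψ S N S' N') (U₀ : ℝ) :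
    Related D Φ (S.Qzero N U₀) (S'.Qzero N' U₀) := by
  intro q hq P
  simp only [Qzero, T.related_hamiltonian q hq P]

lemma related_genL (T : Transport D D' Φ Ψ S N S' N') (U₀ : ℝ)
    (ξb ξd : (Fin 2 → ℝ) → Fin 2 → ℝ) (n : ℤ) (t : ℝ) :
    Related D Φ (S.genL N U₀ (pullField Φ Ψ ξb) (pullField Φ Ψ ξd) n t)
      (S'.genL N' U₀ ξb ξd n t) := by
  intro q hq P
  simp only [genL, T.related_Qzero U₀ q hq P, T.related_Ccharge ξd q hq P,
    T.related_Vcharge ξb ξb q hq P]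

lemma related_genS (T : Transport D D' Φ Ψ S N S' N') (ξt ξx ξb : (Fin 2 → ℝ) → Fin 2 → ℝ)
    (ε k : ℤ) (t : ℝ) :
    Related D Φ (S.genS N (pullField Φ Ψ ξt) (pullField Φ Ψ ξx) (pullField Φ Ψ ξb) ε k t)
      (S'.genS N' ξt ξx ξb ε k t) := by
  intro q hq P
  simp only [genS, T.related_Ccharge ξt q hq P, T.related_Ccharge ξx q hq P,
    T.related_Vcharge ξb ξx q hq P, T.related_Vcharge ξb ξt q hq P]

/-- `Jᵀ` is onto, so identities checked at transformed momenta hold on all of `phaseOver D`. -/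
lemma exists_momentum (h : ChartMap D D' Φ Ψ) {z : Phase} (hz : z ∈ phaseOver D) :
    ∃ P, z = (z.1, (jac Φ z.1)ᵀ *ᵥ P) := by
  refine ⟨(jac Ψ (Φ z.1))ᵀ *ᵥ z.2, ?_⟩
  rw [Matrix.mulVec_mulVec, ← Matrix.transpose_mul, h.jac_mul_jac hz]
  simp

lemma linearIndependent (h : ChartMap D D' Φ Ψ) {ι : Type*} [Fintype ι] {F F' : ι → Phase → ℝ}
    (hF : ∀ i, Related D Φ (F i) (F' i))
    (hl : LinearIndependent ℝ (fun i => (phaseOver D').domRestrict (F' i))) :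
    LinearIndependent ℝ (fun i => (phaseOver D).domRestrict (F i)) := by
  rw [Fintype.linearIndependent_iff] at hl ⊢
  intro c hc
  refine hl c (funext fun z => ?_)
  have hz : z.1.1 ∈ D' := z.2
  have h1 := congrFun hc ⟨(Ψ z.1.1, (jac Φ (Ψ z.1.1))ᵀ *ᵥ z.1.2), h.mapsTo' _ hz⟩
  simp only [Finset.sum_apply, Pi.smul_apply, Set.domRestrict_apply, Pi.zero_apply,
    hF _ _ (h.mapsTo' _ hz), h.rightInv _ hz] at h1 ⊢
  exact h1

lemma chargesSpanSL2 (T : Transport D D' Φ Ψ S N S' N') {U₀ : ℝ} {ξ' : (Fin 2 → ℝ) → Fin 2 → ℝ}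
    (hξ' : ContDiffOn ℝ ∞ ξ' D') (h : S'.ChargesSpanSL2 D' N' U₀ ξ') :
    S.ChargesSpanSL2 D N U₀ (pullField Φ Ψ ξ') := by
  have hs := T.chart.contDiffOn_pullField hξ'
  set F : Fin 3 → Phase → ℝ := ![Ccharge (pullField Φ Ψ ξ'),
    S.Vcharge N (pullField Φ Ψ ξ') (pullField Φ Ψ ξ'), S.Qzero N U₀] with hFdef
  set F' : Fin 3 → Phase → ℝ := ![Ccharge ξ', S'.Vcharge N' ξ' ξ', S'.Qzero N' U₀] with hFdef'
  have hF : ∀ i, Related D Φ (F i) (F' i) := by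
    intro i
    fin_cases i
    exacts [T.related_Ccharge ξ', T.related_Vcharge ξ' ξ', T.related_Qzero U₀]
  have dF : ∀ i, ∀ z ∈ phaseOver D, DifferentiableAt ℝ (F i) z := by
    intro i z hz
    fin_cases i
    exacts [differentiableAt_Ccharge T.chart.isOpen hs hz,
      T.regular.differentiableAt_Vcharge hs hs hz, T.regular.differentiableAt_Qzero U₀ hz]
  have dF' : ∀ i, ∀ z ∈ phaseOver D', DifferentiableAt ℝ (F' i) z := by
    intro i z hz
    fin_cases i
    exacts [differentiableAt_Ccharge T.chart.isOpen' hξ' hz,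
      T.regular'.differentiableAt_Vcharge hξ' hξ' hz, T.regular'.differentiableAt_Qzero U₀ hz]
  -- Combinations are lifted with the same coefficients. Differentiability is recorded along the way
  -- because `poisson_eq` needs it for all four functions.
  have lift : ∀ e' ∈ Submodule.span ℝ (Set.range F'), ∃ e ∈ Submodule.span ℝ (Set.range F),
      Related D Φ e e' ∧ (∀ z ∈ phaseOver D, DifferentiableAt ℝ e z) ∧
      ∀ z ∈ phaseOver D', DifferentiableAt ℝ e' z := by
    intro e' he'
    obtain ⟨c, rfl⟩ := (Submodule.mem_span_range_iff_exists_fun ℝ).1 he'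
    refine ⟨∑ i, c i • F i, (Submodule.mem_span_range_iff_exists_fun ℝ).2 ⟨c, rfl⟩, ?_, ?_, ?_⟩
    · intro q hq P
      simp only [Finset.sum_apply, Pi.smul_apply, hF _ q hq P]
    · exact fun z hz => DifferentiableAt.sum fun i _ => (dF i z hz).const_smul _
    · exact fun z hz => DifferentiableAt.sum fun i _ => (dF' i z hz).const_smul _
  obtain ⟨e', h', f', he', hh', hf', hl, hb⟩ := h
  obtain ⟨e, he, re, de, de'⟩ := lift e' he'
  obtain ⟨k, hk, rk, dk, dk'⟩ := lift h' hh'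
  obtain ⟨f, hf, rf, df, df'⟩ := lift f' hf'
  refine ⟨e, k, f, he, hk, hf, linearIndependent T.chart (F' := ![e', h', f']) ?_ hl, ?_⟩
  · intro i
    fin_cases i
    exacts [re, rk, rf]
  · intro z hz
    obtain ⟨P, hP⟩ := exists_momentum T.chart hz
    rw [hP]
    rw [T.chart.poisson_eq rk re hz dk dk' de de', T.chart.poisson_eq rk rf hz dk dk' df df',
      T.chart.poisson_eq re rf hz de de' df df', re _ hz, rk _ hz, rf _ hz]
    exact hb _ (T.chart.mapsTo _ hz)

lemma isUniqueAdmissible (T : Transport D D' Φ Ψ S N S' N') {U₀ : ℝ}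
    {ξ' : (Fin 2 → ℝ) → Fin 2 → ℝ} (h : S'.IsUniqueAdmissible D' N' U₀ ξ') :
    S.IsUniqueAdmissible D N U₀ (pullField Φ Ψ ξ') := by
  obtain ⟨⟨q', hq', hne⟩, hη⟩ := h
  refine ⟨⟨Ψ q', T.chart.mapsTo' q' hq', fun h0 => hne ?_⟩, fun η => ⟨?_, ?_⟩⟩
  · have h1 := T.chart.jac_mulVec_pullField ξ' (T.chart.mapsTo' q' hq')
    rw [h0, T.chart.rightInv q' hq', Matrix.mulVec_zero] at h1
    exact h1.symm
  · rintro ⟨lam, ha⟩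
    obtain ⟨c, hc⟩ := (hη _).1 ⟨lam, T.symm.isAdmissible ha⟩
    refine ⟨c, fun q hq => ?_⟩
    rw [← T.chart.pullField_pullField η hq, pullField, hc _ (T.chart.mapsTo q hq),
      Matrix.mulVec_smul]
    rfl
  · rintro ⟨c, hc⟩
    -- The hypothesis fixes `η` only on `D`, so the multiple of `ξ'` is transported and `η` is
    -- compared with it afterwards by `IsAdmissible.congr`.
    obtain ⟨lam, ha⟩ := (hη (fun q => c • ξ' q)).2 ⟨c, fun q _ => rfl⟩
    refine ⟨lam, (T.isAdmissible ha).congr T.chart.isOpen fun q hq => ?_⟩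
    rw [hc q hq, pullField, pullField, Matrix.mulVec_smul]

lemma isConserved (T : Transport D D' Φ Ψ S N S' N') {O O' : ℝ → Phase → ℝ}
    (hO : ∀ t, Related D Φ (O t) (O' t))
    (dO : ∀ t, ∀ z ∈ phaseOver D, DifferentiableAt ℝ (O t) z)
    (dO' : ∀ t, ∀ z ∈ phaseOver D', DifferentiableAt ℝ (O' t) z)
    (h : S'.IsConserved D' N' O') : S.IsConserved D N O := by
  intro t z hz
  obtain ⟨P, hP⟩ := exists_momentum T.chart hz
  rw [hP, T.chart.poisson_eq (hO t) T.related_hamiltonian hz (dO t) (dO' t)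
    (fun z hz => T.regular.differentiableAt_hamiltonian hz)
    (fun z hz => T.regular'.differentiableAt_hamiltonian hz)]
  rw [show (fun s => O s (z.1, (jac Φ z.1)ᵀ *ᵥ P)) = fun s => O' s (Φ z.1, P) from
    funext fun s => hO s z.1 hz P]
  exact h t _ (T.chart.mapsTo _ hz)

lemma hasFullAlgebra (T : Transport D D' Φ Ψ S N S' N') (h : S'.HasFullAlgebra D' N') :
    S.HasFullAlgebra D N := by
  obtain ⟨U₀, ξt, ξx, ξb, ξd, at', ax', ab', ad', cL, cC, cS, hl, hL, hS⟩ := h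
  have st := T.chart.contDiffOn_pullField at'.1
  have sx := T.chart.contDiffOn_pullField ax'.1
  have sb := T.chart.contDiffOn_pullField ab'.1
  have sd := T.chart.contDiffOn_pullField ad'.1
  have rL := T.related_genL U₀ ξb ξd
  have rS := T.related_genS ξt ξx ξb
  have rC := T.related_Ccharge ξb
  have dL := fun n t z hz => T.regular.differentiableAt_genL U₀ sb sd n t (z := z) hz
  have dL' := fun n t z hz => T.regular'.differentiableAt_genL U₀ ab'.1 ad'.1 n t (z := z) hz
  have dS := fun ε k t z hz => T.regular.differentiableAt_genS st sx sb ε k t (z := z) hz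
  have dS' := fun ε k t z hz =>
    T.regular'.differentiableAt_genS at'.1 ax'.1 ab'.1 ε k t (z := z) hz
  have dC := fun z hz => differentiableAt_Ccharge T.chart.isOpen sb (z := z) hz
  have dC' := fun z hz => differentiableAt_Ccharge T.chart.isOpen' ab'.1 (z := z) hz
  refine ⟨U₀, pullField Φ Ψ ξt, pullField Φ Ψ ξx, pullField Φ Ψ ξb, pullField Φ Ψ ξd,
    T.isAdmissible at', T.isAdmissible ax', T.isAdmissible ab', T.isAdmissible ad',
    ?_, ?_, ?_, ?_, ?_, ?_⟩
  · exact fun n hn => T.isConserved (rL n) (dL n) (dL' n) (cL n hn)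
  · exact T.isConserved (fun _ => rC) (fun _ => dC) (fun _ => dC') cC
  · exact fun ε hε k hk => T.isConserved (rS ε k) (dS ε k) (dS' ε k) (cS ε hε k hk)
  · intro t
    refine linearIndependent T.chart ?_ (hl t)
    intro i
    fin_cases i
    exacts [fun _ _ _ => rfl, rL _ t, rL _ t, rL _ t, rC, rS _ _ t, rS _ _ t, rS _ _ t, rS _ _ t]
  · intro t z hz n hn
    obtain ⟨P, hP⟩ := exists_momentum T.chart hz
    obtain ⟨h1, h2, h3⟩ := hL t (Φ z.1, P) (T.chart.mapsTo _ hz) n hn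
    rw [hP]
    refine ⟨fun m hm => ?_, ?_, fun ε hε k hk => ?_⟩
    · rw [T.chart.poisson_eq (rL n t) (rL m t) hz (dL n t) (dL' n t) (dL m t) (dL' m t),
        rL _ _ _ hz]
      exact h1 m hm
    · rw [T.chart.poisson_eq (rL n t) rC hz (dL n t) (dL' n t) dC dC']
      exact h2
    · rw [T.chart.poisson_eq (rL n t) (rS ε k t) hz (dL n t) (dL' n t) (dS ε k t) (dS' ε k t),
        rS _ _ _ _ hz]
      exact h3 ε hε k hk
  · intro t z hz ε hε k hk
    obtain ⟨P, hP⟩ := exists_momentum T.chart hz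
    obtain ⟨h1, h2⟩ := hS t (Φ z.1, P) (T.chart.mapsTo _ hz) ε hε k hk
    rw [hP]
    refine ⟨?_, fun ε' hε' k' hk' => ?_⟩
    · rw [T.chart.poisson_eq rC (rS ε k t) hz dC dC' (dS ε k t) (dS' ε k t), rS _ _ _ _ hz]
      exact h1
    · rw [T.chart.poisson_eq (rS ε k t) (rS ε' k' t) hz (dS ε k t) (dS' ε k t) (dS ε' k' t)
        (dS' ε' k' t)]
      exact h2 ε' hε' k' hk'

end Transport

/-! ### Models in null coordinates -/

/-- The model with metric `2 ρ dq⁰ dq¹` and potential `W`; it is used with the lapse `1`. -/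
def nullModel (ρ W : (Fin 2 → ℝ) → ℝ) : Mechanics where
  metric q := !![0, ρ q; ρ q, 0]
  potential := W

section NullModel

variable {ρ W : (Fin 2 → ℝ) → ℝ} {D : Set (Fin 2 → ℝ)}

lemma nullModel_lapseMetric (q : Fin 2 → ℝ) :
    (nullModel ρ W).lapseMetric (fun _ => 1) q = !![0, ρ q; ρ q, 0] := by
  simp [lapseMetric, nullModel]

lemma nullModel_isRegular (hD : IsOpen D) (hρ : ContDiffOn ℝ ∞ ρ D) (hW : ContDiffOn ℝ ∞ W D)
    (h0 : ∀ q ∈ D, ρ q ≠ 0) : (nullModel ρ W).IsRegular D (fun _ => 1) where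
  isOpen := hD
  metric i j := by
    simp only [nullModel_lapseMetric]
    fin_cases i <;> fin_cases j <;> simp <;> first | exact contDiffOn_const | exact hρ
  det q hq := by simp [nullModel_lapseMetric, Matrix.det_fin_two, h0 q hq]
  potential := by simpa [nullModel] using hW

lemma nullModel_Ccharge (ξ : (Fin 2 → ℝ) → Fin 2 → ℝ) (z : Phase) :
    Ccharge ξ z = z.2 0 * ξ z.1 0 + z.2 1 * ξ z.1 1 := by
  simp [Ccharge, dotProduct, Fin.sum_univ_two]

lemma nullModel_Vcharge (ξ η : (Fin 2 → ℝ) → Fin 2 → ℝ) (z : Phase) :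
    (nullModel ρ W).Vcharge (fun _ => 1) ξ η z
      = ρ z.1 * (ξ z.1 0 * η z.1 1 + ξ z.1 1 * η z.1 0) := by
  simp [Vcharge, nullModel_lapseMetric, dotProduct, Matrix.mulVec, Fin.sum_univ_two]
  ring

lemma nullModel_hamiltonian (z : Phase) :
    (nullModel ρ W).hamiltonian (fun _ => 1) z = z.2 0 * z.2 1 / ρ z.1 + W z.1 := by
  -- At `ρ = 0` the matrix inverse and the division both take the default value `0`, so the formula
  -- needs no nondegeneracy.
  rcases eq_or_ne (ρ z.1) 0 with h | h
  · have h0 : (!![0, ρ z.1; ρ z.1, 0] : Matrix (Fin 2) (Fin 2) ℝ) = 0 := by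
      ext i j
      fin_cases i <;> fin_cases j <;> simp [h]
    rw [hamiltonian, nullModel_lapseMetric, h0, h]
    simp [nullModel]
  · have hinv : (!![0, ρ z.1; ρ z.1, 0] : Matrix (Fin 2) (Fin 2) ℝ)⁻¹
        = !![0, (ρ z.1)⁻¹; (ρ z.1)⁻¹, 0] := by
      refine Matrix.inv_eq_right_inv ?_
      ext i j
      fin_cases i <;> fin_cases j <;> simp [Matrix.mul_apply, Fin.sum_univ_two, h]
    simp only [hamiltonian, nullModel_lapseMetric, hinv, dotProduct, Matrix.mulVec,
      Fin.sum_univ_two]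
    simp [nullModel]
    field_simp
    ring

lemma nullModel_Qzero (U₀ : ℝ) (z : Phase) :
    (nullModel ρ W).Qzero (fun _ => 1) U₀ z = z.2 0 * z.2 1 / ρ z.1 + W z.1 - U₀ := by
  rw [Qzero, nullModel_hamiltonian]

lemma differentiableAt_of_contDiffOn {E : Type*} [NormedAddCommGroup E] [NormedSpace ℝ E]
    {f : (Fin 2 → ℝ) → E} (hD : IsOpen D) (hf : ContDiffOn ℝ ∞ f D) {q : Fin 2 → ℝ}
    (hq : q ∈ D) : DifferentiableAt ℝ f q :=
  (hf.contDiffAt (hD.mem_nhds hq)).differentiableAt (by simp)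

/-- The diagonal components of `£_ξ g = lam g` read `2ρ ∂_u ξ¹ = 0` and `2ρ ∂_v ξ⁰ = 0`, which
decouples the null directions; both off-diagonal components give the divergence equation. -/
lemma nullModel_isAdmissible_iff (h0 : ∀ q ∈ D, ρ q ≠ 0) {U₀ lam : ℝ}
    {ξ : (Fin 2 → ℝ) → Fin 2 → ℝ} :
    (nullModel ρ W).IsAdmissible D (fun _ => 1) U₀ lam ξ ↔ ContDiffOn ℝ ∞ ξ D ∧ ∀ q ∈ D,
      pd 0 (fun y => ξ y 1) q = 0 ∧ pd 1 (fun y => ξ y 0) q = 0 ∧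
      ξ q 0 * pd 0 ρ q + ξ q 1 * pd 1 ρ q
        + ρ q * (pd 0 (fun y => ξ y 0) q + pd 1 (fun y => ξ y 1) q) = lam * ρ q ∧
      ξ q 0 * pd 0 W q + ξ q 1 * pd 1 W q = -lam * (W q - U₀) := by
  unfold IsAdmissible
  refine and_congr_right fun _ => forall₂_congr fun q hq => ?_
  have hU : (fun y => (fun _ : Fin 2 → ℝ => (1 : ℝ)) y * (nullModel ρ W).potential y - U₀)
      = fun y => W y - U₀ := by simp [nullModel]
  have hV : (fun _ : Fin 2 → ℝ => (1 : ℝ)) q * (nullModel ρ W).potential q = W q := by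
    simp [nullModel]
  rw [hV, hU]
  simp only [pd_sub_const]
  have hg : (nullModel ρ W).lapseMetric (fun _ => 1) = fun q => !![0, ρ q; ρ q, 0] :=
    funext nullModel_lapseMetric
  rw [hg, ← Matrix.ext_iff]
  simp only [Fin.forall_fin_two, lieMetric, Matrix.of_apply, Fin.sum_univ_two, Matrix.smul_apply,
    smul_eq_mul]
  simp only [Matrix.cons_val', Matrix.cons_val_zero, Matrix.cons_val_one, Matrix.cons_val_fin_one,
    Fin.isValue, pd_const]
  have := h0 q hq
  constructor
  · rintro ⟨⟨⟨h1, h2⟩, h3, h4⟩, h5⟩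
    have e1 : pd 0 (fun y => ξ y 1) q = 0 := by
      have : ρ q * pd 0 (fun y => ξ y 1) q = 0 := by linarith
      simpa [h0 q hq] using this
    have e2 : pd 1 (fun y => ξ y 0) q = 0 := by
      have : ρ q * pd 1 (fun y => ξ y 0) q = 0 := by linarith
      simpa [h0 q hq] using this
    exact ⟨e1, e2, by linarith, h5⟩
  · rintro ⟨h1, h2, h3, h4⟩
    rw [h1, h2]
    exact ⟨⟨⟨by ring, by linarith⟩, by linarith, by ring⟩, h4⟩

lemma differentiableAt_coord (i : Fin 2) (x : Fin 2 → ℝ) :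
    DifferentiableAt ℝ (fun y : Fin 2 → ℝ => y i) x :=
  (ContinuousLinearMap.proj (R := ℝ) (φ := fun _ : Fin 2 => ℝ) i).differentiableAt

lemma pd_momentum_linear (a b : ℝ) (p : Fin 2 → ℝ) :
    pd 0 (fun p => p 0 * a + p 1 * b) p = a ∧ pd 1 (fun p => p 0 * a + p 1 * b) p = b := by
  have d0 := fun c : ℝ => (differentiableAt_coord 0 p).mul_const c
  have d1 := fun c : ℝ => (differentiableAt_coord 1 p).mul_const c
  constructor <;> rw [pd_add _ (d0 a) (d1 b)] <;> simp only [mul_comm _ a, mul_comm _ b,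
    pd_const_mul, pd_coord] <;> simp

lemma poisson_Ccharge_position {ξ : (Fin 2 → ℝ) → Fin 2 → ℝ} (f : (Fin 2 → ℝ) → ℝ) (z : Phase) :
    poisson (Ccharge ξ) (fun y => f y.1) z = -(ξ z.1 0 * pd 0 f z.1 + ξ z.1 1 * pd 1 f z.1) := by
  simp only [poisson, nullModel_Ccharge, Fin.sum_univ_two, pd_momentum_linear, pd_const]
  ring

lemma pd_momentum_Qzero (U₀ : ℝ) (q p : Fin 2 → ℝ) :
    pd 0 (fun p => (nullModel ρ W).Qzero (fun _ => 1) U₀ (q, p)) p = p 1 / ρ q ∧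
    pd 1 (fun p => (nullModel ρ W).Qzero (fun _ => 1) U₀ (q, p)) p = p 0 / ρ q := by
  simp only [nullModel_Qzero, pd_sub_const]
  have d := fun i : Fin 2 => differentiableAt_coord i p
  have e : (fun p : Fin 2 → ℝ => p 0 * p 1 / ρ q + W q)
      = fun p => (ρ q)⁻¹ * (p 0 * p 1) + W q := by
    ext p
    ring
  rw [e]
  constructor <;> rw [pd_add _ (((d 0).fun_mul (d 1)).const_mul _) (by fun_prop), pd_const_mul,
    pd_mul _ (d 0) (d 1), pd_coord, pd_coord, pd_const] <;> simp <;> ring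

lemma poisson_position_Qzero (f : (Fin 2 → ℝ) → ℝ) (U₀ : ℝ) (z : Phase) :
    poisson (fun y => f y.1) ((nullModel ρ W).Qzero (fun _ => 1) U₀) z
      = (pd 0 f z.1 * z.2 1 + pd 1 f z.1 * z.2 0) / ρ z.1 := by
  simp only [poisson, Fin.sum_univ_two, pd_momentum_Qzero, pd_const]
  ring

/-- Bracketing with `C_ξ` is minus the Lie derivative. The inverse metric scales with weight `-lam`,
and so does `W - U₀`; it is the subtraction of `U₀` that makes the two parts scale together. -/
lemma poisson_Ccharge_Qzero (hD : IsOpen D) (hρ : ContDiffOn ℝ ∞ ρ D) (hW : ContDiffOn ℝ ∞ W D)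
    (h0 : ∀ q ∈ D, ρ q ≠ 0) {U₀ lam : ℝ} {ξ : (Fin 2 → ℝ) → Fin 2 → ℝ}
    (hξ : (nullModel ρ W).IsAdmissible D (fun _ => 1) U₀ lam ξ) {z : Phase}
    (hz : z ∈ phaseOver D) :
    poisson (Ccharge ξ) ((nullModel ρ W).Qzero (fun _ => 1) U₀) z
      = lam * (nullModel ρ W).Qzero (fun _ => 1) U₀ z := by
  have hq : z.1 ∈ D := hz
  obtain ⟨hs, hξ⟩ := (nullModel_isAdmissible_iff h0).1 hξ
  obtain ⟨h1, h2, h3, h4⟩ := hξ z.1 hq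
  have hr := h0 z.1 hq
  have dξ := differentiableAt_pi.1 (differentiableAt_of_contDiffOn hD hs hq)
  have dρ := differentiableAt_of_contDiffOn hD hρ hq
  have dW := differentiableAt_of_contDiffOn hD hW hq
  have e1 : ∀ μ, pd μ (fun q => Ccharge ξ (q, z.2)) z.1
      = z.2 0 * pd μ (fun y => ξ y 0) z.1 + z.2 1 * pd μ (fun y => ξ y 1) z.1 := by
    intro μ
    simp only [nullModel_Ccharge]
    rw [pd_add μ ((dξ 0).const_mul _) ((dξ 1).const_mul _), pd_const_mul, pd_const_mul]
  have hinv : ∀ μ, pd μ (fun y => (ρ y)⁻¹) z.1 = -pd μ ρ z.1 / ρ z.1 ^ 2 := by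
    intro μ
    refine (pd_of_hasFDerivAt μ ((hasDerivAt_inv hr).comp_hasFDerivAt z.1 dρ.hasFDerivAt)).trans ?_
    rw [pd_eq_fderiv μ dρ]
    simp
    ring
  have e2 : ∀ μ, pd μ (fun q => (nullModel ρ W).Qzero (fun _ => 1) U₀ (q, z.2)) z.1
      = -(z.2 0 * z.2 1) * pd μ ρ z.1 / ρ z.1 ^ 2 + pd μ W z.1 := by
    intro μ
    simp only [nullModel_Qzero, pd_sub_const, div_eq_mul_inv]
    rw [pd_add μ ((dρ.fun_inv hr).const_mul _) dW, pd_const_mul, hinv]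
    ring
  have e3 : pd 0 (fun p => Ccharge ξ (z.1, p)) z.2 = ξ z.1 0 ∧
      pd 1 (fun p => Ccharge ξ (z.1, p)) z.2 = ξ z.1 1 := by
    simp only [nullModel_Ccharge]
    exact pd_momentum_linear _ _ _
  simp only [poisson, Fin.sum_univ_two, e1, e2, pd_momentum_Qzero, e3, h1, h2]
  rw [nullModel_Qzero]
  field_simp
  linear_combination (z.2 0 * z.2 1) * h3 - (ρ z.1) ^ 2 * h4

/-- For an admissible field of weight `lam`, `V_{ξξ} = 2 ρ ξ⁰ ξ¹` has weight `lam`. -/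
lemma nullModel_lie_Vcharge (hD : IsOpen D) (hρ : ContDiffOn ℝ ∞ ρ D)
    (h0 : ∀ q ∈ D, ρ q ≠ 0) {U₀ lam : ℝ} {ξ : (Fin 2 → ℝ) → Fin 2 → ℝ}
    (hξ : (nullModel ρ W).IsAdmissible D (fun _ => 1) U₀ lam ξ) {q : Fin 2 → ℝ} (hq : q ∈ D) :
    pd 0 (fun y => ρ y * (ξ y 0 * ξ y 1 + ξ y 1 * ξ y 0)) q
        = 2 * ξ q 1 * pd 0 (fun y => ρ y * ξ y 0) q ∧
    pd 1 (fun y => ρ y * (ξ y 0 * ξ y 1 + ξ y 1 * ξ y 0)) q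
        = 2 * ξ q 0 * pd 1 (fun y => ρ y * ξ y 1) q ∧
    pd 0 (fun y => ρ y * ξ y 0) q + pd 1 (fun y => ρ y * ξ y 1) q = lam * ρ q := by
  obtain ⟨hs, hξ⟩ := (nullModel_isAdmissible_iff h0).1 hξ
  obtain ⟨h1, h2, h3, h4⟩ := hξ q hq
  have dξ := differentiableAt_pi.1 (differentiableAt_of_contDiffOn hD hs hq)
  have dρ := differentiableAt_of_contDiffOn hD hρ hq
  have e : (fun y => ρ y * (ξ y 0 * ξ y 1 + ξ y 1 * ξ y 0))
      = fun y => 2 * (ρ y * (ξ y 0 * ξ y 1)) := by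
    ext y
    ring
  rw [e, pd_const_mul, pd_const_mul]
  simp only [pd_mul _ dρ ((dξ 0).fun_mul (dξ 1)), pd_mul _ (dξ 0) (dξ 1), pd_mul _ dρ (dξ 0),
    pd_mul _ dρ (dξ 1), h1, h2]
  exact ⟨by ring, by ring, by linarith⟩

end NullModel

/-! ### When the charges span `sl(2, ℝ)` -/

section SL2

variable {D : Set (Fin 2 → ℝ)}

/-- Restriction of phase space functions to the region over `D`. -/
def restrictOver (D : Set (Fin 2 → ℝ)) : (Phase → ℝ) →ₗ[ℝ] (phaseOver D → ℝ) where
  toFun F := (phaseOver D).domRestrict F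
  map_add' _ _ := rfl
  map_smul' _ _ := rfl

@[simp] lemma restrictOver_apply (D : Set (Fin 2 → ℝ)) (F : Phase → ℝ) (z : phaseOver D) :
    restrictOver D F z = F z := rfl

/-- A Lie algebra spanned by three functions with `{F₀, F₁} = -λ F₁`, `{F₀, F₂} = λ F₂` and
isomorphic to `sl(2, ℝ)` is perfect: `{F₁, F₂}` is a combination of the `F i`, and if it is `b F₀`
then `b`, `λ` and all the `F i` are nonzero. -/
lemma SpansSL2.closed {F : Fin 3 → Phase → ℝ} (hD : IsOpen D) (h : SpansSL2 D F)
    (dF : ∀ i, ∀ z ∈ phaseOver D, DifferentiableAt ℝ (F i) z) :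
    (∃ δ : Fin 3 → ℝ, ∀ z ∈ phaseOver D, poisson (F 1) (F 2) z = ∑ l, δ l * F l z) ∧
    ∀ lam b : ℝ, (∀ z ∈ phaseOver D, poisson (F 0) (F 1) z = -lam * F 1 z) →
      (∀ z ∈ phaseOver D, poisson (F 0) (F 2) z = lam * F 2 z) →
      (∀ z ∈ phaseOver D, poisson (F 1) (F 2) z = b * F 0 z) →
      b ≠ 0 ∧ lam ≠ 0 ∧ ∃ z ∈ phaseOver D, F 1 z ≠ 0 := by
  obtain ⟨e, k, f, he, hk, hf, hl, hb⟩ := h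
  set E : Fin 3 → Phase → ℝ := ![e, k, f] with hE
  have hEF : ∀ i, ∃ c : Fin 3 → ℝ, ∑ j, c j • F j = E i := by
    intro i
    rw [← Submodule.mem_span_range_iff_exists_fun]
    fin_cases i
    exacts [he, hk, hf]
  choose A hA using hEF
  have hA' : ∀ i, E i = fun y => ∑ j, A i j * F j y := by
    intro i
    rw [← hA i]
    ext y
    simp
  have dE : ∀ i, ∀ z ∈ phaseOver D, DifferentiableAt ℝ (E i) z := by
    intro i z hz
    rw [hA' i]
    exact DifferentiableAt.fun_sum fun j _ => (dF j z hz).const_mul _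
  have hlE : LinearIndependent ℝ (fun i => restrictOver D (E i)) := hl
  have fd : ∀ K : Fin 3 → phaseOver D → ℝ,
      FiniteDimensional ℝ (Submodule.span ℝ (Set.range K)) :=
    fun K => FiniteDimensional.span_of_finite ℝ (Set.finite_range K)
  -- Three independent vectors inside the span of three vectors span the same space, so each `F i`
  -- is conversely a combination of `e, h, f`.
  have hspan : Submodule.span ℝ (Set.range fun i => restrictOver D (E i))
      = Submodule.span ℝ (Set.range fun i => restrictOver D (F i)) := by
    refine Submodule.eq_of_le_of_finrank_le ?_ ?_
    · rw [Submodule.span_le]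
      rintro _ ⟨i, rfl⟩
      refine (Submodule.mem_span_range_iff_exists_fun ℝ).2 ⟨A i, ?_⟩
      change _ = restrictOver D (E i)
      rw [← hA i, map_sum]
      exact Finset.sum_congr rfl fun j _ => (map_smul _ _ _).symm
    · rw [finrank_span_eq_card hlE]
      exact finrank_range_le_card _
  have hFE : ∀ i, ∃ c : Fin 3 → ℝ, ∀ z ∈ phaseOver D, F i z = ∑ j, c j * E j z := by
    intro i
    have hm : restrictOver D (F i) ∈ Submodule.span ℝ (Set.range fun i => restrictOver D (E i)) := by
      rw [hspan]
      exact Submodule.subset_span ⟨i, rfl⟩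
    obtain ⟨c, hc⟩ := (Submodule.mem_span_range_iff_exists_fun ℝ).1 hm
    refine ⟨c, fun z hz => ?_⟩
    have := congrFun hc ⟨z, hz⟩
    simp only [Finset.sum_apply, Pi.smul_apply, smul_eq_mul] at this
    exact this.symm
  choose B hB using hFE
  have hEE : ∀ i j, ∃ c : Fin 3 → ℝ, ∀ z ∈ phaseOver D, poisson (E i) (E j) z = ∑ l, c l * E l z := by
    have h1 := fun z hz => (hb z hz).1
    have h2 := fun z hz => (hb z hz).2.1
    have h3 := fun z hz => (hb z hz).2.2
    intro i j
    fin_cases i <;> fin_cases j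
    · exact ⟨0, fun z hz => by simp [poisson_self]⟩
    · exact ⟨![-2, 0, 0], fun z hz => by
        simp only [Fin.sum_univ_three]; simp [hE]; rw [poisson_antisymm, h1 z hz]⟩
    · exact ⟨![0, 1, 0], fun z hz => by
        simp only [Fin.sum_univ_three]; simp [hE]; rw [h3 z hz]⟩
    · exact ⟨![2, 0, 0], fun z hz => by
        simp only [Fin.sum_univ_three]; simp [hE]; rw [h1 z hz]⟩
    · exact ⟨0, fun z hz => by simp [poisson_self]⟩
    · exact ⟨![0, 0, -2], fun z hz => by
        simp only [Fin.sum_univ_three]; simp [hE]; rw [h2 z hz]; ring⟩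
    · exact ⟨![0, -1, 0], fun z hz => by
        simp only [Fin.sum_univ_three]; simp [hE]; rw [poisson_antisymm, h3 z hz]⟩
    · exact ⟨![0, 0, 2], fun z hz => by
        simp only [Fin.sum_univ_three]; simp [hE]; rw [poisson_antisymm, h2 z hz]; ring⟩
    · exact ⟨0, fun z hz => by simp [poisson_self]⟩
  choose C hC using hEE
  refine ⟨⟨fun m => ∑ j, B 1 j * ∑ k, B 2 k * ∑ l, C j k l * A l m, fun z hz => ?_⟩, ?_⟩
  · rw [poisson_congr hD (hB 1) (hB 2) hz, poisson_sum_left (fun i _ => dE i z hz)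
      (DifferentiableAt.fun_sum fun j _ => (dE j z hz).const_mul _)]
    simp only [poisson_sum_right (fun i _ => dE i z hz) (dE _ z hz), hC _ _ z hz]
    simp only [hA', Fin.sum_univ_three]
    ring
  · intro lam b h01 h02 h12
    -- The span of `G` contains every bracket of the `F i`. Since `e, h, f` are themselves brackets,
    -- it is three-dimensional, so no entry of `G` can vanish.
    set G : Fin 3 → phaseOver D → ℝ := ![b • restrictOver D (F 0), lam • restrictOver D (F 1),
      lam • restrictOver D (F 2)] with hG
    have hFF : ∀ i j, ∃ c : Fin 3 → ℝ, ∀ z : phaseOver D,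
        poisson (F i) (F j) z = ∑ l, c l * G l z := by
      intro i j
      fin_cases i <;> fin_cases j
      · exact ⟨0, fun z => by simp [poisson_self]⟩
      · exact ⟨![0, -1, 0], fun z => by
          simp only [Fin.sum_univ_three]; simp [hG, h01 z z.2]⟩
      · exact ⟨![0, 0, 1], fun z => by
          simp only [Fin.sum_univ_three]; simp [hG, h02 z z.2]⟩
      · exact ⟨![0, 1, 0], fun z => by
          simp only [Fin.sum_univ_three]; rw [poisson_antisymm]
          simp [hG, h01 z z.2]⟩
      · exact ⟨0, fun z => by simp [poisson_self]⟩
      · exact ⟨![1, 0, 0], fun z => by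
          simp only [Fin.sum_univ_three]; simp [hG, h12 z z.2]⟩
      · exact ⟨![0, 0, -1], fun z => by
          simp only [Fin.sum_univ_three]; rw [poisson_antisymm]
          simp [hG, h02 z z.2]⟩
      · exact ⟨![-1, 0, 0], fun z => by
          simp only [Fin.sum_univ_three]; rw [poisson_antisymm]
          simp [hG, h12 z z.2]⟩
      · exact ⟨0, fun z => by simp [poisson_self]⟩
    choose X hX using hFF
    have hEG : ∀ i j, ∃ c : Fin 3 → ℝ, ∀ z : phaseOver D,
        poisson (E i) (E j) z = ∑ l, c l * G l z := by
      intro i j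
      refine ⟨fun m => ∑ k, A i k * ∑ l, A j l * X k l m, fun z => ?_⟩
      rw [hA' i, hA' j, poisson_sum_left (fun i _ => dF i z z.2)
        (DifferentiableAt.fun_sum fun j _ => (dF j z z.2).const_mul _)]
      simp only [poisson_sum_right (fun i _ => dF i z z.2) (dF _ z z.2), hX]
      simp only [Fin.sum_univ_three]
      ring
    have hmem : ∀ i, restrictOver D (E i) ∈ Submodule.span ℝ (Set.range G) := by
      intro i
      -- Perfectness: `e = {h, e} / 2`, `h = {e, f}`, `f = -{h, f} / 2`.
      have : ∃ (r : ℝ) (j k : Fin 3), ∀ z ∈ phaseOver D, E i z = r * poisson (E j) (E k) z := by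
        fin_cases i
        · exact ⟨1 / 2, 1, 0, fun z hz => by simp [hE, (hb z hz).1]⟩
        · exact ⟨1, 0, 2, fun z hz => by simp [hE, (hb z hz).2.2]⟩
        · exact ⟨-1 / 2, 1, 2, fun z hz => by simp [hE, (hb z hz).2.1]; ring⟩
      obtain ⟨r, j, k, hr⟩ := this
      obtain ⟨c, hc⟩ := hEG j k
      refine (Submodule.mem_span_range_iff_exists_fun ℝ).2 ⟨fun l => r * c l, funext fun z => ?_⟩
      have h1 : restrictOver D (E i) z = E i z := rfl
      rw [h1, hr z z.2, hc z]
      simp only [Fin.sum_univ_three, Pi.add_apply, Pi.smul_apply, smul_eq_mul]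
      ring
    have hGl : LinearIndependent ℝ G := by
      rw [linearIndependent_iff_card_le_finrank_span]
      have hle : Submodule.span ℝ (Set.range fun i => restrictOver D (E i))
          ≤ Submodule.span ℝ (Set.range G) := by
        rw [Submodule.span_le]
        rintro _ ⟨i, rfl⟩
        exact hmem i
      calc Fintype.card (Fin 3)
          = Module.finrank ℝ (Submodule.span ℝ (Set.range fun i => restrictOver D (E i))) :=
            (finrank_span_eq_card hlE).symm
        _ ≤ _ := Submodule.finrank_mono hle
    have g0 : b • restrictOver D (F 0) ≠ 0 := hGl.ne_zero 0
    have g1 : lam • restrictOver D (F 1) ≠ 0 := hGl.ne_zero 1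
    refine ⟨fun h0 => g0 (by rw [h0, zero_smul]), fun h0 => g1 (by rw [h0, zero_smul]), ?_⟩
    by_contra! hcon
    refine g1 (funext fun z => ?_)
    have h1 : restrictOver D (F 1) z = F 1 z := rfl
    rw [Pi.smul_apply, h1, hcon z z.2]
    simp

variable {ρ W : (Fin 2 → ℝ) → ℝ}

/-- Admissibility already fixes `{C, V}` and `{C, Q₀}`, so only `{V, Q₀} = b C` is at stake. As `{V,
Q₀}` is linear in the momenta with the gradient of `V` as coefficients, this is a pair of equations
on field space. -/
lemma nullModel_chargesSpanSL2_iff (hD : IsOpen D) (hρ : ContDiffOn ℝ ∞ ρ D)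
    (hW : ContDiffOn ℝ ∞ W D) (h0 : ∀ q ∈ D, ρ q ≠ 0) {U₀ lam : ℝ}
    {ξ : (Fin 2 → ℝ) → Fin 2 → ℝ}
    (hξ : (nullModel ρ W).IsAdmissible D (fun _ => 1) U₀ lam ξ) :
    (nullModel ρ W).ChargesSpanSL2 D (fun _ => 1) U₀ ξ ↔
      lam ≠ 0 ∧ (∃ q ∈ D, ξ q 0 * ξ q 1 ≠ 0) ∧ ∃ b : ℝ, b ≠ 0 ∧ ∀ q ∈ D,
        pd 0 (fun y => ρ y * (ξ y 0 * ξ y 1 + ξ y 1 * ξ y 0)) q = b * (ρ q * ξ q 1) ∧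
        pd 1 (fun y => ρ y * (ξ y 0 * ξ y 1 + ξ y 1 * ξ y 0)) q = b * (ρ q * ξ q 0) := by
  have hreg := nullModel_isRegular hD hρ hW h0
  have hs := hξ.1
  set V : (Fin 2 → ℝ) → ℝ := fun y => ρ y * (ξ y 0 * ξ y 1 + ξ y 1 * ξ y 0) with hV
  have eV : (nullModel ρ W).Vcharge (fun _ => 1) ξ ξ = fun y => V y.1 :=
    funext fun z => nullModel_Vcharge ξ ξ z
  have dC := fun z hz => differentiableAt_Ccharge hD hs (z := z) hz
  have dV := fun z hz => hreg.differentiableAt_Vcharge hs hs (z := z) hz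
  have dQ := fun z hz => hreg.differentiableAt_Qzero U₀ (z := z) hz
  have bCV : ∀ z ∈ phaseOver D, poisson (Ccharge ξ) ((nullModel ρ W).Vcharge (fun _ => 1) ξ ξ) z
      = -lam * (nullModel ρ W).Vcharge (fun _ => 1) ξ ξ z := by
    intro z hz
    rw [eV, poisson_Ccharge_position]
    obtain ⟨e1, e2, e3⟩ := nullModel_lie_Vcharge hD hρ h0 hξ hz
    rw [e1, e2]
    simp only [hV]
    linear_combination -2 * ξ z.1 0 * ξ z.1 1 * e3
  have bCQ := fun z hz => poisson_Ccharge_Qzero hD hρ hW h0 hξ (z := z) hz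
  have bVQ : ∀ z, poisson ((nullModel ρ W).Vcharge (fun _ => 1) ξ ξ)
      ((nullModel ρ W).Qzero (fun _ => 1) U₀) z
      = (pd 0 V z.1 * z.2 1 + pd 1 V z.1 * z.2 0) / ρ z.1 := by
    intro z
    rw [eV, poisson_position_Qzero]
  constructor
  · intro h
    set F : Fin 3 → Phase → ℝ := ![Ccharge ξ, (nullModel ρ W).Vcharge (fun _ => 1) ξ ξ,
      (nullModel ρ W).Qzero (fun _ => 1) U₀]
    have dF : ∀ i, ∀ z ∈ phaseOver D, DifferentiableAt ℝ (F i) z := by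
      intro i z hz
      fin_cases i
      exacts [dC z hz, dV z hz, dQ z hz]
    obtain ⟨⟨δ, hδ⟩, hcl⟩ := SpansSL2.closed (F := F) hD h dF
    -- Reversing the momenta flips `C` and `{V, Q₀}` and fixes `V` and `Q₀`, so only `C` can occur
    -- in the expansion of the bracket.
    have hodd : ∀ z ∈ phaseOver D, poisson (F 1) (F 2) z = δ 0 * F 0 z := by
      intro z hz
      have h1 := hδ z hz
      have h2 := hδ (z.1, -z.2) hz
      simp only [Fin.sum_univ_three] at h1 h2
      have b1 : poisson (F 1) (F 2) (z.1, -z.2) = -poisson (F 1) (F 2) z := by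
        have e1 : poisson (F 1) (F 2) z = _ := bVQ z
        have e2 : poisson (F 1) (F 2) (z.1, -z.2) = _ := bVQ (z.1, -z.2)
        rw [e1, e2]
        simp only [Pi.neg_apply]
        ring
      have b2 : F 0 (z.1, -z.2) = -F 0 z := by
        simp [F, nullModel_Ccharge]
        ring
      have b3 : F 1 (z.1, -z.2) = F 1 z := by
        simp [F, nullModel_Vcharge]
      have b4 : F 2 (z.1, -z.2) = F 2 z := by
        simp [F, nullModel_Qzero]
      rw [b1, b2, b3, b4] at h2
      linarith
    obtain ⟨hb, hlam, z, hz, hne⟩ := hcl lam (δ 0) bCV bCQ hodd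
    refine ⟨hlam, ⟨z.1, hz, fun hc => hne ?_⟩, δ 0, hb, fun q hq => ?_⟩
    · change (nullModel ρ W).Vcharge (fun _ => 1) ξ ξ z = 0
      rw [nullModel_Vcharge]
      linear_combination 2 * ρ z.1 * hc
    · have e0 : _ = δ 0 * Ccharge ξ (q, ![0, 1]) := (bVQ _).symm.trans (hodd (q, ![0, 1]) hq)
      have e1 : _ = δ 0 * Ccharge ξ (q, ![1, 0]) := (bVQ _).symm.trans (hodd (q, ![1, 0]) hq)
      simp only [Matrix.cons_val_one, Matrix.cons_val_zero, nullModel_Ccharge] at e0 e1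
      have hr := h0 q hq
      field_simp at e0 e1
      constructor <;> linarith
  · rintro ⟨hlam, ⟨q, hq, hne⟩, b, hb, hVb⟩
    set C := Ccharge ξ with hC
    set Vc := (nullModel ρ W).Vcharge (fun _ => 1) ξ ξ with hVc
    set Q := (nullModel ρ W).Qzero (fun _ => 1) U₀ with hQ
    have bVQ' : ∀ z ∈ phaseOver D, poisson Vc Q z = b * C z := by
      intro z hz
      have hr := h0 z.1 hz
      rw [bVQ, (hVb z.1 hz).1, (hVb z.1 hz).2, hC, nullModel_Ccharge]
      field_simp
      ring
    have p2 : ∀ (c d : ℝ) (A B : Phase → ℝ) (z : Phase), DifferentiableAt ℝ A z →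
        DifferentiableAt ℝ B z → poisson (c • A) (d • B) z = c * d * poisson A B z := by
      intro c d A B z hA hB
      have h1 := poisson_sum_left (s := {()}) (c := fun _ => c) (F := fun _ => A) (K := d • B)
        (z := z) (fun _ _ => hA) (hB.const_smul d)
      have h2 := poisson_sum_right (s := {()}) (c := fun _ => d) (F := fun _ => B) (K := A)
        (z := z) (fun _ _ => hB) hA
      simp only [Finset.sum_singleton] at h1 h2
      change poisson (fun y => c * A y) (d • B) z = _
      rw [h1]
      change c * poisson A (fun y => d * B y) z = _
      rw [h2]
      ring
    have hmem : ∀ i, (![C, Vc, Q] : Fin 3 → Phase → ℝ) i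
        ∈ Submodule.span ℝ (Set.range (![C, Vc, Q] : Fin 3 → Phase → ℝ)) :=
      fun i => Submodule.subset_span ⟨i, rfl⟩
    -- The triple is `e = Q₀`, `h = (2 / lam) C`, `f = -(2 / (lam b)) V`: the first factor makes `e`
    -- an eigenvector of `h` with eigenvalue `2`, the second normalises `{e, f} = h`.
    refine ⟨(1 : ℝ) • Q, (2 / lam) • C, (-2 / (lam * b)) • Vc, Submodule.smul_mem _ _ (hmem 2),
      Submodule.smul_mem _ _ (hmem 0), Submodule.smul_mem _ _ (hmem 1), ?_, ?_⟩
    · rw [Fintype.linearIndependent_iff]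
      intro c hc
      -- Over one point with `ξ⁰ ξ¹ ≠ 0` the charges are told apart by their degree in the momenta;
      -- four values of `p` suffice.
      have ev : ∀ p, c 0 * Q (q, p) + c 1 * (2 / lam * C (q, p))
          + c 2 * (-2 / (lam * b) * Vc (q, p)) = 0 := by
        intro p
        have := congrFun hc ⟨(q, p), hq⟩
        simpa [Fin.sum_univ_three] using this
      have e0 := ev ![0, 0]
      have e1 := ev ![1, 0]
      have e2 := ev ![1, 1]
      have e3 := ev ![0, 1]
      simp only [hQ, hC, hVc, nullModel_Qzero, nullModel_Ccharge, nullModel_Vcharge,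
        Matrix.cons_val_zero, Matrix.cons_val_one] at e0 e1 e2 e3
      have hr := h0 q hq
      have c1 : c 1 = 0 := by
        have : c 1 * (2 / lam * ξ q 0) = 0 := by linear_combination e1 - e0
        simpa [hlam, left_ne_zero_of_mul hne] using this
      have c0 : c 0 = 0 := by
        have : c 0 * (ρ q)⁻¹ = 0 := by
          linear_combination e2 - e3 - e1 + e0
        simpa [hr] using this
      have c2 : c 2 = 0 := by
        have : c 2 * (-4 / (lam * b) * (ρ q * (ξ q 0 * ξ q 1))) = 0 := by
          rw [c0, c1] at e0
          linear_combination e0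
        simpa [hlam, hb, hr, left_ne_zero_of_mul hne, right_ne_zero_of_mul hne] using this
      intro i
      fin_cases i
      exacts [c0, c1, c2]
    · intro z hz
      refine ⟨?_, ?_, ?_⟩
      · rw [p2 _ _ _ _ _ (dC z hz) (dQ z hz), bCQ z hz]
        simp
        field_simp
      · rw [p2 _ _ _ _ _ (dC z hz) (dV z hz), bCV z hz]
        simp
        field_simp
      · rw [p2 _ _ _ _ _ (dQ z hz) (dV z hz), poisson_antisymm, bVQ' z hz]
        simp
        field_simp

/-- Since `∂_u V = 2 ξ¹ ∂_u (ρ ξ⁰)`, the factor `ξ¹` cancels against `b ρ ξ¹`, and likewise for `v`.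
The divergence equation then identifies `b` with `lam`. -/
lemma nullModel_weights_of_chargesSpanSL2 (hD : IsOpen D) (hρ : ContDiffOn ℝ ∞ ρ D)
    (hW : ContDiffOn ℝ ∞ W D) (h0 : ∀ q ∈ D, ρ q ≠ 0) {U₀ lam : ℝ}
    {ξ : (Fin 2 → ℝ) → Fin 2 → ℝ}
    (hξ : (nullModel ρ W).IsAdmissible D (fun _ => 1) U₀ lam ξ)
    (h : (nullModel ρ W).ChargesSpanSL2 D (fun _ => 1) U₀ ξ) {q : Fin 2 → ℝ} (hq : q ∈ D)
    (hne : ξ q 0 * ξ q 1 ≠ 0) :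
    pd 0 (fun y => ρ y * ξ y 0) q = lam / 2 * ρ q ∧
    pd 1 (fun y => ρ y * ξ y 1) q = lam / 2 * ρ q := by
  obtain ⟨-, -, b, -, hb⟩ := (nullModel_chargesSpanSL2_iff hD hρ hW h0 hξ).1 h
  obtain ⟨e1, e2, e3⟩ := nullModel_lie_Vcharge hD hρ h0 hξ hq
  obtain ⟨f1, f2⟩ := hb q hq
  have g1 : 2 * pd 0 (fun y => ρ y * ξ y 0) q = b * ρ q :=
    mul_left_cancel₀ (right_ne_zero_of_mul hne) (by linear_combination f1 - e1)
  have g2 : 2 * pd 1 (fun y => ρ y * ξ y 1) q = b * ρ q :=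
    mul_left_cancel₀ (left_ne_zero_of_mul hne) (by linear_combination f2 - e2)
  constructor <;> linarith

end SL2

/-! ### Monomials on the quadrant and the two-monomial criterion -/

lemma isOpen_quadrant : IsOpen quadrant :=
  (isOpen_lt continuous_const (continuous_apply 0)).inter
    (isOpen_lt continuous_const (continuous_apply 1))

lemma convex_quadrant : Convex ℝ quadrant := by
  rintro x ⟨hx0, hx1⟩ y ⟨hy0, hy1⟩ a b ha hb hab
  have key : ∀ i, 0 < x i → 0 < y i → 0 < a * x i + b * y i := by
    intro i hx hy
    rcases ha.eq_or_lt with rfl | ha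
    · rw [zero_add] at hab
      simp [hab, hy]
    · positivity
  exact ⟨key 0 hx0 hy0, key 1 hx1 hy1⟩

/-- Convexity makes the line segment along the `i`-th coordinate stay in `D`, so a vanishing
derivative there means a constant function. -/
lemma eq_of_pd_eq_zero {n : ℕ} {f : (Fin n → ℝ) → ℝ} {D : Set (Fin n → ℝ)} (hD : IsOpen D)
    (hc : Convex ℝ D) (hf : ∀ q ∈ D, DifferentiableAt ℝ f q) {i : Fin n}
    (h : ∀ q ∈ D, pd i f q = 0) {q q' : Fin n → ℝ} (hq : q ∈ D) (hq' : q' ∈ D)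
    (e : ∀ j, j ≠ i → q j = q' j) : f q = f q' := by
  have hu : ∀ t, HasDerivAt (fun t => Function.update q i t) (Pi.single i 1) t :=
    hasDerivAt_update q i
  have hcont : Continuous fun t => Function.update q i t :=
    continuous_iff_continuousAt.2 fun t => (hu t).continuousAt
  have e' : q' = Function.update q i (q' i) := by
    ext j
    by_cases hj : j = i
    · subst hj
      simp
    · simp [hj, e j hj]
  set T : Set ℝ := {t | Function.update q i t ∈ D} with hT
  have hTo : IsOpen T := hD.preimage hcont
  have hTc : Convex ℝ T := by
    intro a ha b hb s t hs ht hst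
    have : Function.update q i (s • a + t • b)
        = s • Function.update q i a + t • Function.update q i b := by
      ext j
      by_cases hj : j = i
      · subst hj
        simp
      · simp [hj, ← add_mul, hst]
    change Function.update q i (s • a + t • b) ∈ D
    rw [this]
    exact hc ha hb hs ht hst
  have key := hTo.is_const_of_deriv_eq_zero (f := fun t => f (Function.update q i t))
    hTc.isPreconnected
    (fun t ht => ((hf _ ht).comp t (hu t).differentiableAt).differentiableWithinAt)
    (fun t ht => by
      have := h _ ht
      simpa [pd] using this)
    (x := q i) (y := q' i) (by simpa [hT] using hq) (by rw [hT, Set.mem_ofPred_eq, ← e']; exact hq')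
  simpa [← e'] using key

/-- The monomial `q⁰ ^ n * q¹ ^ m`. -/
def mono (n m : ℝ) (q : Fin 2 → ℝ) : ℝ := q 0 ^ n * q 1 ^ m

lemma mono_pos {q : Fin 2 → ℝ} (hq : q ∈ quadrant) (n m : ℝ) : 0 < mono n m q :=
  mul_pos (Real.rpow_pos_of_pos hq.1 _) (Real.rpow_pos_of_pos hq.2 _)

lemma mono_mul {q : Fin 2 → ℝ} (hq : q ∈ quadrant) (n m n' m' : ℝ) :
    mono n m q * mono n' m' q = mono (n + n') (m + m') q := by
  simp only [mono, Real.rpow_add hq.1, Real.rpow_add hq.2]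
  ring

lemma mono_div {q : Fin 2 → ℝ} (hq : q ∈ quadrant) (n m n' m' : ℝ) :
    mono n m q / mono n' m' q = mono (n - n') (m - m') q := by
  rw [div_eq_iff (mono_pos hq _ _).ne', mono_mul hq]
  simp

lemma contDiffOn_mono (n m : ℝ) : ContDiffOn ℝ ∞ (mono n m) quadrant := by
  intro q hq
  have h : ∀ i, ContDiffAt ℝ ∞ (fun y : Fin 2 → ℝ => y i) q := fun i =>
    (ContinuousLinearMap.proj (R := ℝ) (φ := fun _ : Fin 2 => ℝ) i).contDiff.contDiffAt
  exact (((h 0).rpow_const_of_ne hq.1.ne').mul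
    ((h 1).rpow_const_of_ne hq.2.ne')).contDiffWithinAt

lemma pd_zero_mono {q : Fin 2 → ℝ} (hq : q ∈ quadrant) (n m : ℝ) :
    pd 0 (mono n m) q = n / q 0 * mono n m q := by
  have h : HasDerivAt (fun s => mono n m (Function.update q 0 s))
      (n * q 0 ^ (n - 1) * q 1 ^ m) (q 0) := by
    simp only [mono, Function.update_self, Function.update_of_ne one_ne_zero]
    exact (Real.hasDerivAt_rpow_const (Or.inl hq.1.ne')).mul_const _
  rw [pd, h.deriv, Real.rpow_sub_one hq.1.ne', mono]
  ring

lemma pd_one_mono {q : Fin 2 → ℝ} (hq : q ∈ quadrant) (n m : ℝ) :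
    pd 1 (mono n m) q = m / q 1 * mono n m q := by
  have h : HasDerivAt (fun s => mono n m (Function.update q 1 s))
      (q 0 ^ n * (m * q 1 ^ (m - 1))) (q 1) := by
    simp only [mono, Function.update_self, Function.update_of_ne zero_ne_one]
    exact (Real.hasDerivAt_rpow_const (Or.inl hq.2.ne')).const_mul _
  rw [pd, h.deriv, Real.rpow_sub_one hq.2.ne', mono]
  ring

lemma differentiableAt_mono {q : Fin 2 → ℝ} (hq : q ∈ quadrant) (n m : ℝ) :
    DifferentiableAt ℝ (mono n m) q :=
  differentiableAt_of_contDiffOn isOpen_quadrant (contDiffOn_mono n m) hq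

/-- The linear vector field `α q⁰ ∂₀ + β q¹ ∂₁`. -/
def linField (α β : ℝ) (q : Fin 2 → ℝ) : Fin 2 → ℝ := ![α * q 0, β * q 1]

lemma contDiff_linField (α β : ℝ) : ContDiff ℝ ∞ (linField α β) := by
  rw [contDiff_pi]
  have h : ∀ i, ContDiff ℝ ∞ (fun y : Fin 2 → ℝ => y i) := fun i =>
    (ContinuousLinearMap.proj (R := ℝ) (φ := fun _ : Fin 2 => ℝ) i).contDiff
  intro i
  fin_cases i
  exacts [contDiff_const.mul (h 0), contDiff_const.mul (h 1)]

lemma pd_linField (α β : ℝ) (q : Fin 2 → ℝ) :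
    pd 0 (fun y => linField α β y 0) q = α ∧ pd 1 (fun y => linField α β y 0) q = 0 ∧
    pd 0 (fun y => linField α β y 1) q = 0 ∧ pd 1 (fun y => linField α β y 1) q = β := by
  simp [linField, pd_const_mul, pd_coord]

section Criterion

variable {r w U₀ n m p s : ℝ}

/-- Monomials are eigenfunctions of `α u ∂_u + β v ∂_v`. The metric acquires the weight `α (n + 1) +
β (m + 1)`, and the hypothesis says that the potential, of weight `α p + β s`, scales oppositely. -/
lemma linField_isAdmissible (hr : r ≠ 0) {α β : ℝ} (hαβ : α * (p + n + 1) + β * (s + m + 1) = 0) :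
    (nullModel (fun q => r * mono n m q) (fun q => w * mono p s q + U₀)).IsAdmissible quadrant
      (fun _ => 1) U₀ (α * (n + 1) + β * (m + 1)) (linField α β) := by
  have h0 : ∀ q ∈ quadrant, r * mono n m q ≠ 0 := fun q hq => mul_ne_zero hr (mono_pos hq _ _).ne'
  refine (nullModel_isAdmissible_iff h0).2 ⟨(contDiff_linField α β).contDiffOn, fun q hq => ?_⟩
  obtain ⟨e1, e2, e3, e4⟩ := pd_linField α β q
  have hW : ∀ i, pd i (fun q => w * mono p s q + U₀) q = w * pd i (mono p s) q := by
    intro i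
    rw [pd_add i ((differentiableAt_mono hq p s).const_mul _) (by fun_prop), pd_const_mul, pd_const,
      add_zero]
  have hu := hq.1.ne'
  have hv := hq.2.ne'
  refine ⟨e3, e2, ?_, ?_⟩
  · rw [e1, e4, pd_const_mul, pd_const_mul, pd_zero_mono hq, pd_one_mono hq]
    simp only [linField, Matrix.cons_val_zero, Matrix.cons_val_one]
    field_simp
    ring
  · rw [hW, hW, pd_zero_mono hq, pd_one_mono hq]
    simp only [linField, Matrix.cons_val_zero, Matrix.cons_val_one]
    field_simp
    linear_combination hαβ * w * mono p s q

/-- Divided by the monomial, the potential equation reads `p ξ⁰/u + s ξ¹/v = -lam`. Its first term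
depends on `u` only and its second on `v` only, so with `p, s ≠ 0` both are constant and the field
is linear. The divergence equation then leaves one linear relation between the two coefficients. -/
lemma powerModel_isUniqueAdmissible (hr : r ≠ 0) (hw : w ≠ 0) (hp : p ≠ 0) (hs : s ≠ 0)
    (hsm : s + m + 1 ≠ 0) :
    (nullModel (fun q => r * mono n m q) (fun q => w * mono p s q + U₀)).IsUniqueAdmissible
      quadrant (fun _ => 1) U₀ (linField (s + m + 1) (-(p + n + 1))) := by
  have h0 : ∀ q ∈ quadrant, r * mono n m q ≠ 0 := fun q hq => mul_ne_zero hr (mono_pos hq _ _).ne'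
  have one_mem : (![1, 1] : Fin 2 → ℝ) ∈ quadrant := by constructor <;> simp
  refine ⟨⟨![1, 1], one_mem, fun h => hsm (by simpa [linField] using congrFun h 0)⟩,
    fun η => ⟨?_, ?_⟩⟩
  · rintro ⟨lam, hη⟩
    obtain ⟨hsη, hη⟩ := (nullModel_isAdmissible_iff h0).1 hη
    have dη := fun q hq =>
      differentiableAt_pi.1 (differentiableAt_of_contDiffOn isOpen_quadrant hsη (q := q) hq)
    have hpot : ∀ q ∈ quadrant, p * (η q 0 / q 0) + s * (η q 1 / q 1) = -lam := by
      intro q hq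
      have h4 := (hη q hq).2.2.2
      have hW : ∀ i, pd i (fun q => w * mono p s q + U₀) q = w * pd i (mono p s) q := by
        intro i
        rw [pd_add i ((differentiableAt_mono hq p s).const_mul _) (by fun_prop), pd_const_mul,
          pd_const, add_zero]
      rw [hW, hW, pd_zero_mono hq, pd_one_mono hq] at h4
      refine mul_right_cancel₀ (mul_ne_zero hw (mono_pos hq p s).ne') ?_
      linear_combination h4
    have hP : ∀ q ∈ quadrant, ∀ q' ∈ quadrant, q 0 = q' 0 → η q 0 = η q' 0 := by
      intro q hq q' hq' e
      refine eq_of_pd_eq_zero (i := 1) (f := fun y => η y 0) isOpen_quadrant convex_quadrant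
        (fun q hq => dη q hq 0) (fun q hq => (hη q hq).2.1) hq hq' fun j hj => ?_
      fin_cases j
      · exact e
      · exact absurd rfl hj
    have hQ : ∀ q ∈ quadrant, ∀ q' ∈ quadrant, q 1 = q' 1 → η q 1 = η q' 1 := by
      intro q hq q' hq' e
      refine eq_of_pd_eq_zero (i := 0) (f := fun y => η y 1) isOpen_quadrant convex_quadrant
        (fun q hq => dη q hq 1) (fun q hq => (hη q hq).1) hq hq' fun j hj => ?_
      fin_cases j
      · exact absurd rfl hj
      · exact e
    set P := η ![1, 1] 0 with hPdef
    set Q := η ![1, 1] 1 with hQdef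
    have h11 : p * P + s * Q = -lam := by simpa using hpot _ one_mem
    -- The point `(q⁰, 1)` shares its first coordinate with `q` and its second with `(1, 1)`, which
    -- carries out the separation of variables.
    have hPq : ∀ q ∈ quadrant, η q 0 = P * q 0 := by
      intro q hq
      have hm : (![q 0, 1] : Fin 2 → ℝ) ∈ quadrant := ⟨by simpa using hq.1, by simp⟩
      have h1 := hpot _ hm
      rw [hQ _ hm _ one_mem (by simp), ← hP q hq _ hm (by simp)] at h1
      have h2 : p * (η q 0 / q 0) = p * P := by
        simp only [Matrix.cons_val_zero, Matrix.cons_val_one, div_one] at h1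
        linarith
      have h3 := mul_left_cancel₀ hp h2
      rwa [div_eq_iff hq.1.ne'] at h3
    have hQq : ∀ q ∈ quadrant, η q 1 = Q * q 1 := by
      intro q hq
      have h1 := hpot q hq
      rw [hPq q hq, mul_div_cancel_right₀ _ hq.1.ne'] at h1
      have h2 : s * (η q 1 / q 1) = s * Q := by linarith
      have h3 := mul_left_cancel₀ hs h2
      rwa [div_eq_iff hq.2.ne'] at h3
    have h3 := (hη _ one_mem).2.2.1
    rw [pd_const_mul, pd_const_mul, pd_zero_mono one_mem, pd_one_mono one_mem,
      pd_congr_on isOpen_quadrant hPq one_mem, pd_congr_on isOpen_quadrant hQq one_mem,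
      pd_const_mul, pd_const_mul, pd_coord, pd_coord] at h3
    have h4 : P * n + Q * m + P + Q = lam := by
      refine mul_right_cancel₀ (h0 _ one_mem) ?_
      simp at h3
      linear_combination h3
    refine ⟨P / (s + m + 1), fun q hq => ?_⟩
    ext i
    fin_cases i
    · simp [linField, hPq q hq]
      field_simp
    · have hQ' : Q = -(P * (p + n + 1)) / (s + m + 1) := by
        rw [eq_div_iff hsm]
        linarith
      simp [linField, hQq q hq, hQ']
      field_simp
      ring
  · rintro ⟨c, hc⟩
    have h1 := linField_isAdmissible (r := r) (w := w) (U₀ := U₀) (n := n) (m := m) (p := p) (s := s)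
      hr (α := c * (s + m + 1)) (β := c * -(p + n + 1)) (by ring)
    refine ⟨_, h1.congr isOpen_quadrant fun q hq => ?_⟩
    rw [hc q hq]
    ext i
    fin_cases i <;> simp [linField] <;> ring

/-- For `ξ = α u ∂_u + β v ∂_v` the half-weight equations are `α (n + 1) = lam / 2 = β (m + 1)`;
here `α = s + m + 1` and `β = -(p + n + 1)`. In the converse, `hn` keeps `lam = 2 α (n + 1)` from
vanishing. -/
lemma powerModel_chargesSpanSL2_iff (hr : r ≠ 0) (hsm : s + m + 1 ≠ 0)
    (hpn : p + n + 1 ≠ 0) (hn : n + 1 ≠ 0) :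
    (nullModel (fun q => r * mono n m q) (fun q => w * mono p s q + U₀)).ChargesSpanSL2
      quadrant (fun _ => 1) U₀ (linField (s + m + 1) (-(p + n + 1))) ↔
      (s + m + 1) * (n + 1) + (p + n + 1) * (m + 1) = 0 := by
  have h0 : ∀ q ∈ quadrant, r * mono n m q ≠ 0 := fun q hq => mul_ne_zero hr (mono_pos hq _ _).ne'
  have one_mem : (![1, 1] : Fin 2 → ℝ) ∈ quadrant := by constructor <;> simp
  have hρ : ContDiffOn ℝ ∞ (fun q => r * mono n m q) quadrant :=
    contDiffOn_const.mul (contDiffOn_mono n m)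
  have hW : ContDiffOn ℝ ∞ (fun q => w * mono p s q + U₀) quadrant :=
    (contDiffOn_const.mul (contDiffOn_mono p s)).add contDiffOn_const
  have hadm := linField_isAdmissible (r := r) (w := w) (U₀ := U₀) (n := n) (m := m) (p := p)
    (s := s) hr (α := s + m + 1) (β := -(p + n + 1)) (by ring)
  rw [nullModel_chargesSpanSL2_iff isOpen_quadrant hρ hW h0 hadm]
  have key : ∀ q ∈ quadrant,
      pd 0 (fun y => r * mono n m y * linField (s + m + 1) (-(p + n + 1)) y 0) q
        = (s + m + 1) * (n + 1) * (r * mono n m q) ∧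
      pd 1 (fun y => r * mono n m y * linField (s + m + 1) (-(p + n + 1)) y 1) q
        = -(p + n + 1) * (m + 1) * (r * mono n m q) := by
    intro q hq
    have hu := hq.1.ne'
    have hv := hq.2.ne'
    obtain ⟨e1, -, -, e4⟩ := pd_linField (s + m + 1) (-(p + n + 1)) q
    have d1 := (differentiableAt_mono hq n m).const_mul r
    have d2 := differentiableAt_pi.1
      ((contDiff_linField (s + m + 1) (-(p + n + 1))).contDiffAt.differentiableAt (x := q) (by simp))
    rw [pd_mul 0 d1 (d2 0), pd_mul 1 d1 (d2 1), e1, e4, pd_const_mul, pd_const_mul,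
      pd_zero_mono hq, pd_one_mono hq]
    simp only [linField, Matrix.cons_val_zero, Matrix.cons_val_one]
    constructor <;> field_simp
    all_goals ring
  constructor
  · rintro ⟨-, -, b, -, hb⟩
    obtain ⟨f1, f2⟩ := hb _ one_mem
    obtain ⟨e1, e2, -⟩ := nullModel_lie_Vcharge isOpen_quadrant hρ h0 hadm one_mem
    rw [e1, (key _ one_mem).1] at f1
    rw [e2, (key _ one_mem).2] at f2
    have hne := h0 _ one_mem
    simp only [linField, Matrix.cons_val_zero, Matrix.cons_val_one, mul_one] at f1 f2
    have g1 : 2 * (s + m + 1) * (n + 1) = b :=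
      mul_right_cancel₀ (mul_ne_zero hne hpn) (by linear_combination -f1)
    have g2 : -2 * (p + n + 1) * (m + 1) = b :=
      mul_right_cancel₀ (mul_ne_zero hne hsm) (by linear_combination f2)
    linarith
  · intro h
    have hne : (s + m + 1) * (n + 1) ≠ 0 := mul_ne_zero hsm hn
    refine ⟨?_, ⟨![1, 1], one_mem, by simpa [linField] using ⟨hsm, by contrapose! hpn; linarith⟩⟩,
      2 * ((s + m + 1) * (n + 1)), mul_ne_zero two_ne_zero hne, fun q hq => ?_⟩
    · intro h2
      exact hne (by linarith)
    · obtain ⟨e1, e2, -⟩ := nullModel_lie_Vcharge isOpen_quadrant hρ h0 hadm hq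
      rw [e1, e2, (key _ hq).1, (key _ hq).2]
      constructor
      · ring
      · linear_combination (2 * linField (s + m + 1) (-(p + n + 1)) q 0 * (r * mono n m q)) * (-h)

end Criterion

/-! ### The full algebra in flat null coordinates -/

/-- The polynomials on phase space to which all charges of a flat model belong. -/
def quadraticCharge (c : Fin 9 → ℝ) (z : Phase) : ℝ :=
  c 0 + c 1 * z.1 0 + c 2 * z.1 1 + c 3 * z.2 0 + c 4 * z.2 1 + c 5 * (z.1 0 * z.2 0)
    + c 6 * (z.1 1 * z.2 1) + c 7 * (z.1 0 * z.1 1) + c 8 * (z.2 0 * z.2 1)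

lemma quadraticCharge_vec (c₀ c₁ c₂ c₃ c₄ c₅ c₆ c₇ c₈ : ℝ) (z : Phase) :
    quadraticCharge ![c₀, c₁, c₂, c₃, c₄, c₅, c₆, c₇, c₈] z = c₀ + c₁ * z.1 0 + c₂ * z.1 1
      + c₃ * z.2 0 + c₄ * z.2 1 + c₅ * (z.1 0 * z.2 0) + c₆ * (z.1 1 * z.2 1)
      + c₇ * (z.1 0 * z.1 1) + c₈ * (z.2 0 * z.2 1) := rfl

lemma pd_bilinear (a b c d : ℝ) (x : Fin 2 → ℝ) :
    pd 0 (fun y => a + b * y 0 + c * y 1 + d * (y 0 * y 1)) x = b + d * x 1 ∧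
    pd 1 (fun y => a + b * y 0 + c * y 1 + d * (y 0 * y 1)) x = c + d * x 0 := by
  have h0 := differentiableAt_coord 0 x
  have h1 := differentiableAt_coord 1 x
  have d1 : DifferentiableAt ℝ (fun y : Fin 2 → ℝ => b * y 0) x := h0.const_mul b
  have d2 : DifferentiableAt ℝ (fun y : Fin 2 → ℝ => a + b * y 0) x := d1.const_add a
  have d3 : DifferentiableAt ℝ (fun y : Fin 2 → ℝ => a + b * y 0 + c * y 1) x :=
    d2.fun_add (h1.const_mul c)
  constructor <;> rw [pd_add _ d3 ((h0.fun_mul h1).const_mul d), pd_add _ d2 (h1.const_mul c),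
    pd_add _ (differentiableAt_const a) d1, pd_const, pd_const_mul, pd_const_mul, pd_const_mul,
    pd_mul _ h0 h1, pd_coord, pd_coord] <;> simp

/-- This nine-dimensional space is closed under the bracket and will turn out to be spanned by the
eight generators and `1`; every check for the flat model becomes a polynomial identity. -/
lemma poisson_quadraticCharge (c d : Fin 9 → ℝ) (z : Phase) :
    poisson (quadraticCharge c) (quadraticCharge d) z =
      (c 1 + c 5 * z.2 0 + c 7 * z.1 1) * (d 3 + d 5 * z.1 0 + d 8 * z.2 1)
      - (c 3 + c 5 * z.1 0 + c 8 * z.2 1) * (d 1 + d 5 * z.2 0 + d 7 * z.1 1)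
      + (c 2 + c 6 * z.2 1 + c 7 * z.1 0) * (d 4 + d 6 * z.1 1 + d 8 * z.2 0)
      - (c 4 + c 6 * z.1 1 + c 8 * z.2 0) * (d 2 + d 6 * z.2 1 + d 7 * z.1 0) := by
  have hq : ∀ c : Fin 9 → ℝ, (fun q => quadraticCharge c (q, z.2)) = fun y =>
      (c 0 + c 3 * z.2 0 + c 4 * z.2 1 + c 8 * (z.2 0 * z.2 1)) + (c 1 + c 5 * z.2 0) * y 0
        + (c 2 + c 6 * z.2 1) * y 1 + c 7 * (y 0 * y 1) := by
    intro c
    ext y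
    simp only [quadraticCharge]
    ring
  have hp : ∀ c : Fin 9 → ℝ, (fun p => quadraticCharge c (z.1, p)) = fun y =>
      (c 0 + c 1 * z.1 0 + c 2 * z.1 1 + c 7 * (z.1 0 * z.1 1)) + (c 3 + c 5 * z.1 0) * y 0
        + (c 4 + c 6 * z.1 1) * y 1 + c 8 * (y 0 * y 1) := by
    intro c
    ext y
    simp only [quadraticCharge]
    ring
  simp only [poisson, Fin.sum_univ_two, hq, hp, pd_bilinear]
  ring

/-- Nine evaluations determine the nine coefficients; the positions are chosen in the quadrant, so
that any region containing it is covered. -/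
lemma quadraticCharge_eq_zero {c : Fin 9 → ℝ}
    (h : ∀ z ∈ phaseOver quadrant, quadraticCharge c z = 0) : c = 0 := by
  have ev : ∀ x y u v : ℝ, 0 < x → 0 < y → c 0 + c 1 * x + c 2 * y + c 3 * u + c 4 * v
      + c 5 * (x * u) + c 6 * (y * v) + c 7 * (x * y) + c 8 * (u * v) = 0 := by
    intro x y u v hx hy
    have := h (![x, y], ![u, v]) ⟨by simpa using hx, by simpa using hy⟩
    simpa [quadraticCharge] using this
  have e1 := ev 1 1 0 0 (by norm_num) (by norm_num)
  have e2 := ev 2 1 0 0 (by norm_num) (by norm_num)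
  have e3 := ev 1 2 0 0 (by norm_num) (by norm_num)
  have e4 := ev 2 2 0 0 (by norm_num) (by norm_num)
  have e5 := ev 1 1 1 0 (by norm_num) (by norm_num)
  have e6 := ev 2 1 1 0 (by norm_num) (by norm_num)
  have e7 := ev 1 1 0 1 (by norm_num) (by norm_num)
  have e8 := ev 1 2 0 1 (by norm_num) (by norm_num)
  have e9 := ev 1 1 1 1 (by norm_num) (by norm_num)
  ext i
  fin_cases i <;> simp <;> linarith

variable {γ : ℝ} {D : Set (Fin 2 → ℝ)}

/-- The constant vector field `(a, b)`. -/
def constField (a b : ℝ) (_ : Fin 2 → ℝ) : Fin 2 → ℝ := ![a, b]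

lemma flat_genL_eq (κ : ℝ) (n : ℤ) (t : ℝ) :
    (nullModel (fun _ => γ) (fun _ => κ)).genL (fun _ => 1) κ (linField 1 (-1))
      (linField (1 / 2) (1 / 2)) n t
    = quadraticCharge ![0, 0, 0, 0, 0, (n + 1) * t ^ n.toNat / 2, (n + 1) * t ^ n.toNat / 2,
      -γ * ((n + 1) * n * t ^ (n - 1).toNat) / 2, -(t ^ (n + 1).toNat / γ)] := by
  ext z
  simp [genL, nullModel_Vcharge, nullModel_Ccharge, nullModel_Qzero, quadraticCharge, linField]
  ring

/-- The translations are chosen so that `ξt + ξx = ∂_u` and `ξt - ξx = -(4 / γ) ∂_v`: each sign `ε`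
selects one null direction, and their `g`-product `-4` is what normalises the Heisenberg brackets to
`±1`. -/
lemma flat_genS_eq (hγ : γ ≠ 0) (κ : ℝ) (ε k : ℤ) (t : ℝ) :
    (nullModel (fun _ => γ) (fun _ => κ)).genS (fun _ => 1) (constField (1 / 2) (-2 / γ))
      (constField (1 / 2) (2 / γ)) (linField 1 (-1)) ε k t
    = quadraticCharge ![0, k * (1 - ε), -(γ * k * (1 + ε) / 4), t ^ k.toNat * (1 + ε) / 4,
      -(t ^ k.toNat * (1 - ε) / γ), 0, 0, 0, 0] := by
  ext z
  simp [genS, nullModel_Vcharge, nullModel_Ccharge, quadraticCharge, linField, constField]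
  field_simp
  ring

lemma flat_Ccharge_eq :
    Ccharge (linField 1 (-1)) = quadraticCharge ![0, 0, 0, 0, 0, 1, -1, 0, 0] := by
  ext z
  simp [nullModel_Ccharge, quadraticCharge, linField]
  ring

lemma flat_hamiltonian_eq (κ : ℝ) :
    (nullModel (fun _ => γ) (fun _ => κ)).hamiltonian (fun _ => 1)
      = quadraticCharge ![κ, 0, 0, 0, 0, 0, 0, 0, 1 / γ] := by
  ext z
  simp [nullModel_hamiltonian, quadraticCharge]
  ring

lemma flat_isAdmissible (hγ : γ ≠ 0) (κ : ℝ) :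
    (∀ a b : ℝ, (nullModel (fun _ => γ) (fun _ => κ)).IsAdmissible D (fun _ => 1) κ 0
      (constField a b)) ∧
    ∀ a b : ℝ, (nullModel (fun _ => γ) (fun _ => κ)).IsAdmissible D (fun _ => 1) κ (a + b)
      (linField a b) := by
  constructor
  · refine fun a b => (nullModel_isAdmissible_iff fun _ _ => hγ).2 ⟨contDiffOn_const, fun q _ => ?_⟩
    simp [constField]
  · refine fun a b => (nullModel_isAdmissible_iff fun _ _ => hγ).2
      ⟨(contDiff_linField a b).contDiffOn, fun q _ => ?_⟩
    obtain ⟨e1, e2, e3, e4⟩ := pd_linField a b q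
    simp only [e1, e2, e3, e4, pd_const]
    refine ⟨trivial, trivial, by ring, by ring⟩

/-- Constant metric and potential make all translations, the boost and the dilation admissible with
`U₀ = κ`. The region is only asked to contain the quadrant because a logarithmic flat coordinate
fills a half plane. -/
lemma flat_hasFullAlgebra (hD : quadrant ⊆ D) (hγ : γ ≠ 0) (κ : ℝ) :
    (nullModel (fun _ => γ) (fun _ => κ)).HasFullAlgebra D (fun _ => 1) := by
  obtain ⟨hc, hl⟩ := flat_isAdmissible (D := D) hγ κ
  refine ⟨κ, constField (1 / 2) (-2 / γ), constField (1 / 2) (2 / γ), linField 1 (-1),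
    linField (1 / 2) (1 / 2), hc _ _, hc _ _, ?_, ?_, ?_, ?_, ?_, ?_, ?_, ?_⟩
  · simpa using hl 1 (-1)
  · have := hl (1 / 2) (1 / 2)
    rwa [add_halves] at this
  · intro n hn t z _
    simp only [flat_genL_eq, flat_hamiltonian_eq, poisson_quadraticCharge]
    simp only [quadraticCharge_vec]
    rcases hn with rfl | rfl | rfl
    · simp
    -- The explicit time derivative must be computed by hand; it is the opposite of the bracket with
    -- the Hamiltonian.
    · have : HasDerivAt (fun s : ℝ => 1 / 2 * (z.1 0 * z.2 0) + 1 / 2 * (z.1 1 * z.2 1)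
          + -(s / γ) * (z.2 0 * z.2 1)) (-(1 / γ) * (z.2 0 * z.2 1)) t :=
        ((((hasDerivAt_id t).div_const γ).neg.mul_const _).const_add _)
      refine (congrArg (· + _) (HasDerivAt.deriv (this.congr_of_eventuallyEq
        (Eventually.of_forall fun s => ?_)))).trans ?_
      · norm_num [-mul_eq_mul_left_iff, -mul_eq_mul_right_iff]
      · simp
        field_simp
        ring
    · have : HasDerivAt (fun s : ℝ => (1 + 1) * s / 2 * (z.1 0 * z.2 0)
          + (1 + 1) * s / 2 * (z.1 1 * z.2 1) + -(γ * (1 + 1)) / 2 * (z.1 0 * z.1 1)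
          + -(s ^ 2 / γ) * (z.2 0 * z.2 1))
          (z.1 0 * z.2 0 + z.1 1 * z.2 1 - 2 * t / γ * (z.2 0 * z.2 1)) t := by
        have h1 : ∀ c : ℝ, HasDerivAt (fun s : ℝ => (1 + 1) * s / 2 * c) c t := by
          intro c
          have := (hasDerivAt_id t).mul_const c
          simpa [one_add_one_eq_two] using this
        have h2 := (((hasDerivAt_pow 2 t).div_const γ).fun_neg.mul_const (z.2 0 * z.2 1))
        refine ((((h1 (z.1 0 * z.2 0)).fun_add (h1 (z.1 1 * z.2 1))).add_const
          (-(γ * (1 + 1)) / 2 * (z.1 0 * z.1 1))).fun_add h2).congr_deriv ?_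
        simp
        ring
      refine (congrArg (· + _) (HasDerivAt.deriv (this.congr_of_eventuallyEq
        (Eventually.of_forall fun s => ?_)))).trans ?_
      · norm_num [show Int.toNat 2 = 2 from rfl, -mul_eq_mul_left_iff, -mul_eq_mul_right_iff]
      · simp
        field_simp
        ring
  · intro t z _
    rw [flat_Ccharge_eq, flat_hamiltonian_eq, poisson_quadraticCharge]
    simp
    ring
  · intro ε _ k hk t z _
    simp only [flat_genS_eq hγ, flat_hamiltonian_eq, poisson_quadraticCharge]
    simp only [quadraticCharge_vec]
    rcases hk with rfl | rfl
    · simp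
    · have : HasDerivAt (fun s : ℝ => (1 - ε) * z.1 0 + -(γ * (1 + ε) / 4) * z.1 1
          + s * (1 + ε) / 4 * z.2 0 + -(s * (1 - ε) / γ) * z.2 1)
          ((1 + ε) / 4 * z.2 0 - (1 - ε) / γ * z.2 1) t := by
        have h1 := (((hasDerivAt_id t).mul_const ((1 : ℝ) + ε)).div_const 4).mul_const (z.2 0)
        have h2 := ((((hasDerivAt_id t).mul_const ((1 : ℝ) - ε)).div_const γ).fun_neg).mul_const
          (z.2 1)
        refine ((h1.const_add ((1 - ε) * z.1 0 + -(γ * (1 + ε) / 4) * z.1 1)).fun_add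
          h2).congr_deriv ?_
        ring
      refine (congrArg (· + _) (HasDerivAt.deriv (this.congr_of_eventuallyEq
        (Eventually.of_forall fun s => ?_)))).trans ?_
      · norm_num [-mul_eq_mul_left_iff, -mul_eq_mul_right_iff]
      · simp
        field_simp
        ring
  · intro t
    rw [Fintype.linearIndependent_iff]
    intro a ha
    -- These are the coefficients of the vanishing combination with respect to the nine monomials;
    -- the `a i` are then read off in triangular order.
    have h1 : (![a 0, 2 * a 8, -(γ * a 6 / 2), a 5 / 2 + t * a 6 / 2,
        -(2 / γ * a 7) - 2 * t / γ * a 8, a 2 / 2 + t * a 3 + a 4, a 2 / 2 + t * a 3 - a 4,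
        -γ * a 3, -(a 1 / γ) - t / γ * a 2 - t ^ 2 / γ * a 3] : Fin 9 → ℝ) = 0 := by
      refine quadraticCharge_eq_zero fun z hz => ?_
      have h2 := congrFun ha ⟨z, hD hz⟩
      simp only [flat_genL_eq, flat_genS_eq hγ, flat_Ccharge_eq] at h2
      simp only [Fin.sum_univ_succ] at h2
      simp [quadraticCharge] at h2 ⊢
      rw [← h2]
      ring
    have h0 : a 0 = 0 := congrFun h1 0
    have h8 : a 8 = 0 := by
      have : 2 * a 8 = 0 := congrFun h1 1
      linarith
    have h6 : a 6 = 0 := by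
      have : -(γ * a 6 / 2) = 0 := congrFun h1 2
      simpa [hγ] using this
    have h5 : a 5 = 0 := by
      have : a 5 / 2 + t * a 6 / 2 = 0 := congrFun h1 3
      rw [h6] at this
      linarith
    have h7 : a 7 = 0 := by
      have : -(2 / γ * a 7) - 2 * t / γ * a 8 = 0 := congrFun h1 4
      rw [h8] at this
      simpa [hγ] using this
    have h3 : a 3 = 0 := by
      have : -γ * a 3 = 0 := congrFun h1 7
      simpa [hγ] using this
    have e5 : a 2 / 2 + t * a 3 + a 4 = 0 := congrFun h1 5
    have e6 : a 2 / 2 + t * a 3 - a 4 = 0 := congrFun h1 6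
    rw [h3] at e5 e6
    have h2 : a 2 = 0 := by linarith
    have h4 : a 4 = 0 := by linarith
    have e8 : -(a 1 / γ) - t / γ * a 2 - t ^ 2 / γ * a 3 = 0 := congrFun h1 8
    rw [h2, h3] at e8
    have h1' : a 1 = 0 := by simpa [hγ] using e8
    intro i
    fin_cases i
    exacts [h0, h1', h2, h3, h4, h5, h6, h7, h8]
  · intro t z _ n hn
    refine ⟨fun m hm => ?_, ?_, fun ε hε k hk => ?_⟩
    · rw [flat_genL_eq, flat_genL_eq, flat_genL_eq, poisson_quadraticCharge]
      -- An index `n + m` outside `{-1, 0, 1}` occurs only for `n = m`, where the factor `n - m`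
      -- removes it.
      rcases hn with rfl | rfl | rfl <;> rcases hm with rfl | rfl | rfl <;>
        simp [quadraticCharge] <;> field_simp <;> ring
    · rw [flat_genL_eq, flat_Ccharge_eq, poisson_quadraticCharge]
      simp
      ring
    · rw [flat_genL_eq, flat_genS_eq hγ, flat_genS_eq hγ, poisson_quadraticCharge]
      -- An index `n + k` outside `{0, 1}` occurs only for `(n, k) = (1, 1)` and `(-1, 0)`, where
      -- the structure constant is zero.
      rcases hn with rfl | rfl | rfl <;> rcases hε with rfl | rfl <;> rcases hk with rfl | rfl <;>
        simp [quadraticCharge] <;> first | (field_simp; done) | (field_simp; ring; done) | (left; norm_num)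
  · intro t z _ ε hε k hk
    refine ⟨?_, fun ε' hε' k' hk' => ?_⟩
    · rw [flat_genS_eq hγ, flat_Ccharge_eq, poisson_quadraticCharge]
      rcases hε with rfl | rfl <;> rcases hk with rfl | rfl <;>
        simp [quadraticCharge] <;> field_simp <;> ring
    · rw [flat_genS_eq hγ, flat_genS_eq hγ, poisson_quadraticCharge]
      rcases hε with rfl | rfl <;> rcases hk with rfl | rfl <;> rcases hε' with rfl | rfl <;>
        rcases hk' with rfl | rfl <;> simp <;> field_simp <;> ring

/-! ### Obstructions -/

/-- Distinct real powers are independent on any interval of positive numbers: dividing by one power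
and differentiating removes that term and keeps the other exponents distinct, so induction applies.
-/
lemma coeff_eq_zero_of_rpow_sum {ι : Type*} (s : Finset ι) {a b : ℝ} (ha : 0 ≤ a) (hab : a < b) :
    ∀ c d : ι → ℝ, Set.InjOn d s → (∀ x ∈ Set.Ioo a b, ∑ i ∈ s, c i * x ^ d i = 0) →
      ∀ i ∈ s, c i = 0 := by
  classical
  induction s using Finset.induction_on with
  | empty => simp
  | insert i₀ s hi₀ ih =>
    intro c d hd h
    have hpos : ∀ x ∈ Set.Ioo a b, 0 < x := fun x hx => ha.trans_lt hx.1
    have h1 : ∀ x ∈ Set.Ioo a b, c i₀ + ∑ i ∈ s, c i * x ^ (d i - d i₀) = 0 := by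
      intro x hx
      have hx0 := hpos x hx
      have h2 := h x hx
      rw [Finset.sum_insert hi₀] at h2
      have h3 : x ^ d i₀ ≠ 0 := (Real.rpow_pos_of_pos hx0 _).ne'
      refine mul_right_cancel₀ h3 ?_
      rw [add_mul, Finset.sum_mul, zero_mul, ← h2]
      congr 1
      refine Finset.sum_congr rfl fun i _ => ?_
      rw [mul_assoc, ← Real.rpow_add hx0, sub_add_cancel]
    have h4 : ∀ x ∈ Set.Ioo a b, ∑ i ∈ s, c i * (d i - d i₀) * x ^ (d i - d i₀ - 1) = 0 := by
      intro x hx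
      have hder : HasDerivAt (fun x => c i₀ + ∑ i ∈ s, c i * x ^ (d i - d i₀))
          (∑ i ∈ s, c i * ((d i - d i₀) * x ^ (d i - d i₀ - 1))) x :=
        (HasDerivAt.fun_sum fun i _ =>
          (Real.hasDerivAt_rpow_const (Or.inl (hpos x hx).ne')).const_mul (c i)).const_add (c i₀)
      have hz : HasDerivAt (fun x => c i₀ + ∑ i ∈ s, c i * x ^ (d i - d i₀)) 0 x :=
        (hasDerivAt_const x (0 : ℝ)).congr_of_eventuallyEq
          (Filter.eventuallyEq_of_mem (isOpen_Ioo.mem_nhds hx) h1)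
      simpa [mul_assoc] using hder.unique hz
    have hinj : Set.InjOn d s := hd.mono (by simp)
    have h5 := ih (fun i => c i * (d i - d i₀)) (fun i => d i - d i₀ - 1)
      (fun i hi j hj e => hinj hi hj (by simpa using e)) h4
    have h6 : ∀ i ∈ s, c i = 0 := by
      intro i hi
      have hne : d i - d i₀ ≠ 0 := by
        rw [sub_ne_zero]
        intro e
        have := hd (by simp [hi]) (by simp) e
        exact hi₀ (this ▸ hi)
      simpa [hne] using h5 i hi
    have h7 : c i₀ = 0 := by
      have hm : (a + b) / 2 ∈ Set.Ioo a b := ⟨by linarith, by linarith⟩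
      have := h1 _ hm
      rwa [Finset.sum_eq_zero fun i hi => by rw [h6 i hi, zero_mul], add_zero] at this
    intro i hi
    rcases Finset.mem_insert.1 hi with rfl | hi
    exacts [h7, h6 i hi]

lemma mem_ball_fin_two {q₀ q : Fin 2 → ℝ} {ε : ℝ} (hε : 0 < ε) :
    q ∈ Metric.ball q₀ ε ↔ |q 0 - q₀ 0| < ε ∧ |q 1 - q₀ 1| < ε := by
  rw [Metric.mem_ball, dist_pi_lt_iff hε, Fin.forall_fin_two]
  rfl

/-- `ρ` is locally the product of a function of `q⁰` and a function of `q¹`. -/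
def IsProductOn (ρ : (Fin 2 → ℝ) → ℝ) (q₀ : Fin 2 → ℝ) (ε : ℝ) : Prop :=
  ∀ u₁ u₂ v₁ v₂ : ℝ, |u₁ - q₀ 0| < ε → |u₂ - q₀ 0| < ε → |v₁ - q₀ 1| < ε → |v₂ - q₀ 1| < ε →
    ρ ![u₁, v₁] * ρ ![u₂, v₂] = ρ ![u₁, v₂] * ρ ![u₂, v₁]

/-- With `A` a function of `u` alone, the equation says `∂_u log ρ = (c - A') / A`, which does not
involve `v`. Hence `ρ(u, v₁) / ρ(u, v₂)` is constant in `u`. -/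
lemma isProductOn_of_pd_eq {ρ A : (Fin 2 → ℝ) → ℝ} {q₀ : Fin 2 → ℝ} {ε c : ℝ} (hε : 0 < ε)
    (hρ : ContDiffOn ℝ ∞ ρ (Metric.ball q₀ ε)) (hA : ContDiffOn ℝ ∞ A (Metric.ball q₀ ε))
    (ρ0 : ∀ q ∈ Metric.ball q₀ ε, ρ q ≠ 0) (A0 : ∀ q ∈ Metric.ball q₀ ε, A q ≠ 0)
    (hA1 : ∀ q ∈ Metric.ball q₀ ε, pd 1 A q = 0)
    (h : ∀ q ∈ Metric.ball q₀ ε, pd 0 (fun y => ρ y * A y) q = c * ρ q) :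
    IsProductOn ρ q₀ ε := by
  intro u₁ u₂ v₁ v₂ hu₁ hu₂ hv₁ hv₂
  set B := Metric.ball q₀ ε
  have hB : IsOpen B := Metric.isOpen_ball
  have hm : ∀ u v : ℝ, |u - q₀ 0| < ε → |v - q₀ 1| < ε → (![u, v] : Fin 2 → ℝ) ∈ B :=
    fun u v hu hv => (mem_ball_fin_two hε).2 ⟨hu, hv⟩
  have dρ := fun q hq => differentiableAt_of_contDiffOn hB hρ (q := q) hq
  have dA := fun q hq => differentiableAt_of_contDiffOn hB hA (q := q) hq
  -- `∂_v ∂_u A = ∂_u ∂_v A = 0`, so the derivative of `A` is independent of `v` as well.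
  have hindep : ∀ u v v' : ℝ, |u - q₀ 0| < ε → |v - q₀ 1| < ε → |v' - q₀ 1| < ε →
      A ![u, v] = A ![u, v'] ∧ pd 0 A ![u, v] = pd 0 A ![u, v'] := by
    intro u v v' hu hv hv'
    have e : ∀ j : Fin 2, j ≠ 1 → (![u, v] : Fin 2 → ℝ) j = (![u, v'] : Fin 2 → ℝ) j := by
      intro j hj
      fin_cases j
      · rfl
      · exact absurd rfl hj
    refine ⟨eq_of_pd_eq_zero hB (convex_ball _ _) dA hA1 (hm u v hu hv) (hm u v' hu hv') e,
      eq_of_pd_eq_zero hB (convex_ball _ _) (fun q hq => (contDiffAt_pd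
        (hA.contDiffAt (hB.mem_nhds hq)) 0).differentiableAt (by simp)) (fun q hq => ?_)
        (hm u v hu hv) (hm u v' hu hv') e⟩
    rw [pd_pd_comm (hA.contDiffAt (hB.mem_nhds hq)), pd_congr_on hB hA1 hq, pd_const]
  have hder : ∀ u v : ℝ, |u - q₀ 0| < ε → |v - q₀ 1| < ε →
      HasDerivAt (fun s => ρ ![s, v]) (pd 0 ρ ![u, v]) u := by
    intro u v hu hv
    have h1 : ∀ s, Function.update ![u, v] 0 s = ![s, v] := by
      intro s
      ext j
      fin_cases j <;> simp
    have h2 : DifferentiableAt ℝ (fun s => ρ (Function.update ![u, v] 0 s)) u :=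
      DifferentiableAt.comp u (by rw [h1]; exact dρ _ (hm u v hu hv))
        (hasDerivAt_update _ 0 u).differentiableAt
    have h3 := h2.hasDerivAt
    simp only [h1] at h3
    simpa [pd, h1] using h3
  -- The Wronskian of the slices at `v₁` and `v₂` vanishes; it is the numerator of the derivative of
  -- their quotient.
  have hcross : ∀ u : ℝ, |u - q₀ 0| < ε →
      pd 0 ρ ![u, v₁] * ρ ![u, v₂] - ρ ![u, v₁] * pd 0 ρ ![u, v₂] = 0 := by
    intro u hu
    have e1 := h _ (hm u v₁ hu hv₁)
    have e2 := h _ (hm u v₂ hu hv₂)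
    rw [pd_mul 0 (dρ _ (hm u v₁ hu hv₁)) (dA _ (hm u v₁ hu hv₁))] at e1
    rw [pd_mul 0 (dρ _ (hm u v₂ hu hv₂)) (dA _ (hm u v₂ hu hv₂))] at e2
    obtain ⟨a1, a2⟩ := hindep u v₁ v₂ hu hv₁ hv₂
    rw [a1, a2] at e1
    refine mul_left_cancel₀ (A0 _ (hm u v₂ hu hv₂)) ?_
    linear_combination ρ ![u, v₂] * e1 - ρ ![u, v₁] * e2
  have hI : ∀ u, u ∈ Set.Ioo (q₀ 0 - ε) (q₀ 0 + ε) ↔ |u - q₀ 0| < ε := by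
    intro u
    rw [abs_lt, Set.mem_Ioo]
    constructor <;> rintro ⟨h1, h2⟩ <;> constructor <;> linarith
  have hg : ∀ u ∈ Set.Ioo (q₀ 0 - ε) (q₀ 0 + ε),
      HasDerivAt (fun s => ρ ![s, v₁] / ρ ![s, v₂]) 0 u := by
    intro u hu
    rw [hI] at hu
    have h1 := (hder u v₁ hu hv₁).fun_div (hder u v₂ hu hv₂) (ρ0 _ (hm u v₂ hu hv₂))
    rwa [hcross u hu, zero_div] at h1
  have key := isOpen_Ioo.is_const_of_deriv_eq_zero isPreconnected_Ioo
    (fun u hu => (hg u hu).differentiableAt.differentiableWithinAt) (fun u hu => (hg u hu).deriv)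
    ((hI u₁).2 hu₁) ((hI u₂).2 hu₂)
  have n1 := ρ0 _ (hm u₁ v₂ hu₁ hv₂)
  have n2 := ρ0 _ (hm u₂ v₂ hu₂ hv₂)
  rw [div_eq_div_iff n1 n2] at key
  linarith

/-! ### Sums of monomials of equal degree are not products -/

section MonomialSum

variable {E : Finset (ℝ × ℝ)} {c : ℝ × ℝ → ℝ} {f : (Fin 2 → ℝ) → ℝ} {σ : ℝ}

lemma injOn_fst_of_add_eq (hE : ∀ e ∈ E, e.1 + e.2 = σ) :
    Set.InjOn (fun e : ℝ × ℝ => e.1) E := by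
  intro e he e' he' h
  have h1 := hE e he
  have h2 := hE e' he'
  simp only at h
  exact Prod.ext h (by linarith)

lemma coeff_eq_zero_of_mono_sum {q₀ : Fin 2 → ℝ} {ε : ℝ} (hε : 0 < ε)
    (hB : Metric.ball q₀ ε ⊆ quadrant) {ι : Type*} {s : Finset ι} {c n m : ι → ℝ}
    (hn : Set.InjOn n s)
    (h : ∀ q ∈ Metric.ball q₀ ε, ∑ i ∈ s, c i * mono (n i) (m i) q = 0) : ∀ i ∈ s, c i = 0 := by
  have hq := hB (Metric.mem_ball_self hε)
  have h1 := coeff_eq_zero_of_rpow_sum s (a := q₀ 0) (b := q₀ 0 + ε) hq.1.le (by linarith)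
    (fun i => c i * q₀ 1 ^ m i) n hn (by
      intro x hx
      have hm : (![x, q₀ 1] : Fin 2 → ℝ) ∈ Metric.ball q₀ ε := by
        rw [mem_ball_fin_two hε]
        simp only [Matrix.cons_val_zero, Matrix.cons_val_one, sub_self, abs_zero, hε, and_true]
        rw [abs_lt]
        constructor <;> linarith [hx.1, hx.2]
      rw [← h _ hm]
      refine Finset.sum_congr rfl fun i _ => ?_
      simp [mono]
      ring)
  intro i hi
  simpa [(Real.rpow_pos_of_pos hq.2 _).ne'] using h1 i hi

/-- For a product, the slices at `v₁` and `v₂` are proportional in `u`. Independence of powers of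
`u` then forces `(v₁ / v₂)^m` to be the same number for every exponent pair, so all `m` agree; as `n
+ m` is fixed, only one pair is possible. -/
lemma not_isProductOn_mono_sum (hE : ∀ e ∈ E, e.1 + e.2 = σ) (hc : ∀ e ∈ E, c e ≠ 0)
    (hcard : E.Nontrivial) {q₀ : Fin 2 → ℝ} {ε : ℝ} (hε : 0 < ε)
    (hB : Metric.ball q₀ ε ⊆ quadrant)
    (hf : ∀ q ∈ Metric.ball q₀ ε, f q = ∑ e ∈ E, c e * mono e.1 e.2 q)
    (f0 : ∀ q ∈ Metric.ball q₀ ε, f q ≠ 0) : ¬ IsProductOn f q₀ ε := by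
  intro h
  have hq := hB (Metric.mem_ball_self hε)
  have hm : ∀ u v : ℝ, |u - q₀ 0| < ε → |v - q₀ 1| < ε →
      (![u, v] : Fin 2 → ℝ) ∈ Metric.ball q₀ ε := fun u v hu hv => (mem_ball_fin_two hε).2 ⟨hu, hv⟩
  have z0 : |q₀ 0 - q₀ 0| < ε := by simpa using hε
  have z1 : |q₀ 1 - q₀ 1| < ε := by simpa using hε
  have z2 : |(q₀ 1 + ε / 2) - q₀ 1| < ε := by
    rw [add_sub_cancel_left, abs_of_pos (by linarith)]
    linarith
  have v2pos : 0 < q₀ 1 + ε / 2 := by linarith [hq.2]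
  set v₁ := q₀ 1
  set v₂ := v₁ + ε / 2
  set R₁ := f ![q₀ 0, v₁]
  set R₂ := f ![q₀ 0, v₂]
  have hR₁ : R₁ ≠ 0 := f0 _ (hm _ _ z0 z1)
  have hR₂ : R₂ ≠ 0 := f0 _ (hm _ _ z0 z2)
  have h1 := coeff_eq_zero_of_rpow_sum E (a := q₀ 0) (b := q₀ 0 + ε) hq.1.le (by linarith)
    (fun e => c e * (R₂ * v₁ ^ e.2 - R₁ * v₂ ^ e.2)) (fun e => e.1) (injOn_fst_of_add_eq hE) (by
      intro x hx
      have hx' : |x - q₀ 0| < ε := by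
        rw [abs_lt]
        constructor <;> linarith [hx.1, hx.2]
      have h2 := h x (q₀ 0) v₁ v₂ hx' z0 z1 z2
      rw [hf _ (hm _ _ hx' z1), hf _ (hm _ _ hx' z2)] at h2
      change _ * R₂ = _ * R₁ at h2
      rw [← sub_eq_zero, Finset.sum_mul, Finset.sum_mul, ← Finset.sum_sub_distrib] at h2
      rw [← h2]
      refine Finset.sum_congr rfl fun e _ => ?_
      simp [mono]
      ring)
  have h3 : ∀ e ∈ E, (v₁ / v₂) ^ e.2 = R₁ / R₂ := by
    intro e he
    have h4 : R₂ * v₁ ^ e.2 - R₁ * v₂ ^ e.2 = 0 := by simpa [hc e he] using h1 e he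
    have h5 : v₂ ^ e.2 ≠ 0 := (Real.rpow_pos_of_pos v2pos _).ne'
    rw [Real.div_rpow hq.2.le v2pos.le, div_eq_div_iff h5 hR₂]
    linarith
  obtain ⟨e, he, e', he', hne⟩ := hcard
  have h6 := (h3 e he).trans (h3 e' he').symm
  have h7 : v₁ / v₂ ≠ 1 := by
    rw [Ne, div_eq_one_iff_eq v2pos.ne']
    simp only [v₂]
    linarith
  rw [Real.rpow_right_inj (div_pos hq.2 v2pos) h7] at h6
  exact hne (Prod.ext (by linarith [hE e he, hE e' he']) h6)

end MonomialSum

/-! ### Consequences of the full algebra -/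

section FullAlgebra

variable {D : Set (Fin 2 → ℝ)} {ρ W : (Fin 2 → ℝ) → ℝ}

lemma nullModel_isAdmissible_add_smul (hD : IsOpen D) (h0 : ∀ q ∈ D, ρ q ≠ 0) {U₀ : ℝ}
    {ξ η : (Fin 2 → ℝ) → Fin 2 → ℝ}
    (hξ : (nullModel ρ W).IsAdmissible D (fun _ => 1) U₀ 0 ξ)
    (hη : (nullModel ρ W).IsAdmissible D (fun _ => 1) U₀ 0 η) (c : ℝ) :
    (nullModel ρ W).IsAdmissible D (fun _ => 1) U₀ 0 (fun q => ξ q + c • η q) := by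
  rw [nullModel_isAdmissible_iff h0] at hξ hη ⊢
  refine ⟨contDiffOn_pi.2 fun i =>
    (contDiffOn_pi.1 hξ.1 i).add (contDiffOn_const.mul (contDiffOn_pi.1 hη.1 i)), fun q hq => ?_⟩
  obtain ⟨a1, a2, a3, a4⟩ := hξ.2 q hq
  obtain ⟨b1, b2, b3, b4⟩ := hη.2 q hq
  have dξ := differentiableAt_pi.1 (differentiableAt_of_contDiffOn hD hξ.1 hq)
  have dη := differentiableAt_pi.1 (differentiableAt_of_contDiffOn hD hη.1 hq)
  simp only [Pi.add_apply, Pi.smul_apply, smul_eq_mul, pd_add _ (dξ _) ((dη _).const_mul c),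
    pd_const_mul]
  refine ⟨?_, ?_, ?_, ?_⟩
  · rw [a1, b1]; ring
  · rw [a2, b2]; ring
  · linear_combination a3 + c * b3
  · linear_combination a4 + c * b4

lemma exists_ball_ne_zero {A : (Fin 2 → ℝ) → ℝ} (hD : IsOpen D) (hA : ContDiffOn ℝ ∞ A D)
    {q₀ : Fin 2 → ℝ} (hq₀ : q₀ ∈ D) (h : A q₀ ≠ 0) :
    ∃ ε > 0, Metric.ball q₀ ε ⊆ D ∧ ∀ q ∈ Metric.ball q₀ ε, A q ≠ 0 := by
  have h1 : ∀ᶠ q in 𝓝 q₀, A q ≠ 0 :=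
    (hA.contDiffAt (hD.mem_nhds hq₀)).continuousAt.eventually_ne h
  obtain ⟨ε, hε, hs⟩ := Metric.mem_nhds_iff.1 (h1.and (hD.mem_nhds hq₀))
  exact ⟨ε, hε, fun q hq => (hs hq).2, fun q hq => (hs hq).1⟩

/-- Only the `𝓢`-charges at `t = 0` and the weight of `ξd` are used. The Heisenberg brackets make
`η_± = ξt ± ξx` two independent null Killing fields that preserve `W`, so `W` is constant, and the
weight-one field then gives `W = U₀`. Conservation makes `η_±` gradients up to a factor, which
splits the Killing equation and makes `ρ` a product. -/
lemma nullModel_isProductOn_of_hasFullAlgebra (hD : IsOpen D) (hne : D.Nonempty)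
    (hρ : ContDiffOn ℝ ∞ ρ D) (h0 : ∀ q ∈ D, ρ q ≠ 0)
    (h : (nullModel ρ W).HasFullAlgebra D (fun _ => 1)) :
    ∃ U₀ : ℝ, (∀ q ∈ D, W q = U₀) ∧
      ∃ q₀ ∈ D, ∃ ε > 0, Metric.ball q₀ ε ⊆ D ∧ IsProductOn ρ q₀ ε := by
  obtain ⟨U₀, ξt, ξx, ξb, ξd, at', ax', ab', ad', -, -, cS, -, -, hS⟩ := h
  set η : ℤ → (Fin 2 → ℝ) → Fin 2 → ℝ := fun ε q => ξt q + (ε : ℝ) • ξx q with hη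
  set f : ℤ → (Fin 2 → ℝ) → ℝ := fun ε q =>
    1 / 2 * (ρ q * (ξb q 0 * ξx q 1 + ξb q 1 * ξx q 0)
      + ε * (ρ q * (ξb q 0 * ξt q 1 + ξb q 1 * ξt q 0))) with hf
  have aη : ∀ ε, (nullModel ρ W).IsAdmissible D (fun _ => 1) U₀ 0 (η ε) := fun ε =>
    nullModel_isAdmissible_add_smul hD h0 at' ax' ε
  have sb := contDiffOn_pi.1 ab'.1
  have st := contDiffOn_pi.1 at'.1
  have sx := contDiffOn_pi.1 ax'.1
  have hfs : ∀ ε, ContDiffOn ℝ ∞ (f ε) D := fun ε =>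
    contDiffOn_const.mul ((hρ.mul (((sb 0).mul (sx 1)).add ((sb 1).mul (sx 0)))).add
      (contDiffOn_const.mul (hρ.mul (((sb 0).mul (st 1)).add ((sb 1).mul (st 0))))))
  -- At `t = 0` the charge with `k = 1` is a function of position and the one with `k = 0` is a
  -- charge `C`.
  have g1 : ∀ ε : ℤ, (nullModel ρ W).genS (fun _ => 1) ξt ξx ξb ε 1 0 = fun z => f ε z.1 := by
    intro ε
    ext z
    simp [genS, nullModel_Vcharge, hf]
  have g0 : ∀ ε : ℤ, (nullModel ρ W).genS (fun _ => 1) ξt ξx ξb ε 0 0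
      = Ccharge (fun q => (1 / 2 : ℝ) • η ε q) := by
    intro ε
    ext z
    simp [genS, nullModel_Ccharge, hη]
    ring
  -- Conservation of `𝓢^ε_{1/2}` at `t = 0` says `{f ε, H} = -C_{η/2}` for all momenta, so the
  -- gradient of `f ε` is `-η / 2` with lowered index.
  have hgrad : ∀ ε ∈ ({1, -1} : Set ℤ), ∀ q ∈ D,
      pd 0 (f ε) q = -(1 / 2) * (ρ q * η ε q 1) ∧ pd 1 (f ε) q = -(1 / 2) * (ρ q * η ε q 0) := by
    intro ε hε q hq
    have key : ∀ p : Fin 2 → ℝ, 1 / 2 * (p 0 * η ε q 0 + p 1 * η ε q 1)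
        + (pd 0 (f ε) q * p 1 + pd 1 (f ε) q * p 0) / ρ q = 0 := by
      intro p
      have h1 := cS ε hε 1 (by simp) 0 (q, p) hq
      have hH : (nullModel ρ W).hamiltonian (fun _ => 1) = (nullModel ρ W).Qzero (fun _ => 1) 0 := by
        ext z
        simp [Qzero]
      rw [g1, hH, poisson_position_Qzero] at h1
      have hd : HasDerivAt (fun s => (nullModel ρ W).genS (fun _ => 1) ξt ξx ξb ε 1 s (q, p))
          (1 / 2 * (p 0 * η ε q 0 + p 1 * η ε q 1)) 0 := by
        have h2 : (fun s => (nullModel ρ W).genS (fun _ => 1) ξt ξx ξb ε 1 s (q, p))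
            = fun s => f ε q + s * (1 / 2 * (p 0 * η ε q 0 + p 1 * η ε q 1)) := by
          ext s
          simp [genS, nullModel_Vcharge, nullModel_Ccharge, hf, hη]
          ring
        rw [h2]
        simpa using ((hasDerivAt_id (0 : ℝ)).mul_const
          (1 / 2 * (p 0 * η ε q 0 + p 1 * η ε q 1))).const_add (f ε q)
      rw [hd.deriv] at h1
      exact h1
    have k0 := key ![1, 0]
    have k1 := key ![0, 1]
    have hr := h0 q hq
    simp at k0 k1
    field_simp at k0 k1
    constructor <;> linarith
  -- Inserting that gradient into the bracket of the two kinds of `𝓢` turns it into `-1/4` of the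
  -- scalar product of `η ε` and `η ε'`.
  have hbr : ∀ ε ∈ ({1, -1} : Set ℤ), ∀ ε' ∈ ({1, -1} : Set ℤ), ∀ q ∈ D,
      -(1 / 4) * (ρ q * (η ε q 1 * η ε' q 0 + η ε q 0 * η ε' q 1))
        = if ε + ε' = 0 then 1 else 0 := by
    intro ε hε ε' hε' q hq
    have h1 := (hS 0 (q, 0) hq ε hε 1 (by simp)).2 ε' hε' 0 (by simp)
    rw [g1, g0, poisson_antisymm, poisson_Ccharge_position] at h1
    obtain ⟨e1, e2⟩ := hgrad ε hε q hq
    simp only [e1, e2, Pi.smul_apply, smul_eq_mul] at h1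
    by_cases hz : ε + ε' = 0
    · simp [hz] at h1 ⊢
      linarith
    · rw [if_neg fun h => hz h.1] at h1
      rw [if_neg hz]
      linarith
  have p1 : (1 : ℤ) ∈ ({1, -1} : Set ℤ) := by simp
  have m1 : (-1 : ℤ) ∈ ({1, -1} : Set ℤ) := by simp
  have hnull : ∀ q ∈ D, η 1 q 0 * η 1 q 1 = 0 ∧ η (-1) q 0 * η (-1) q 1 = 0 ∧
      ρ q * (η 1 q 0 * η (-1) q 1 + η 1 q 1 * η (-1) q 0) = -4 := by
    intro q hq
    have e1 := hbr 1 p1 1 p1 q hq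
    have e2 := hbr (-1) m1 (-1) m1 q hq
    have e3 := hbr 1 p1 (-1) m1 q hq
    have hr := h0 q hq
    simp only [show ¬((1 : ℤ) + 1 = 0) by decide, if_false] at e1
    simp only [show ¬((-1 : ℤ) + -1 = 0) by decide, if_false] at e2
    simp only [show ((1 : ℤ) + -1 = 0) by decide, if_true] at e3
    refine ⟨mul_left_cancel₀ hr ?_, mul_left_cancel₀ hr ?_, ?_⟩ <;> linarith
  have hW : ∀ q ∈ D, W q = U₀ := by
    intro q hq
    obtain ⟨n1, n2, n3⟩ := hnull q hq
    have w1 := (((nullModel_isAdmissible_iff h0).1 (aη 1)).2 q hq).2.2.2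
    have w2 := (((nullModel_isAdmissible_iff h0).1 (aη (-1))).2 q hq).2.2.2
    have w3 := (((nullModel_isAdmissible_iff h0).1 ad').2 q hq).2.2.2
    have hdet : η 1 q 0 * η (-1) q 1 - η 1 q 1 * η (-1) q 0 ≠ 0 := by
      intro hd
      -- `(x + y)² = (x - y)² + 4xy`, and `xy` vanishes because `η 1` is null; so dependent fields
      -- would have zero scalar product instead of `-4`.
      have : (η 1 q 0 * η (-1) q 1 + η 1 q 1 * η (-1) q 0) ^ 2 = 0 := by
        linear_combination (η 1 q 0 * η (-1) q 1 - η 1 q 1 * η (-1) q 0) * hd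
          + 4 * η (-1) q 0 * η (-1) q 1 * n1
      rw [pow_eq_zero_iff two_ne_zero] at this
      rw [this] at n3
      norm_num at n3
    have d0 : pd 0 W q = 0 := by
      refine mul_left_cancel₀ hdet ?_
      linear_combination η (-1) q 1 * w1 - η 1 q 1 * w2
    have d1 : pd 1 W q = 0 := by
      refine mul_left_cancel₀ hdet ?_
      linear_combination -η (-1) q 0 * w1 + η 1 q 0 * w2
    rw [d0, d1] at w3
    linarith
  refine ⟨U₀, hW, ?_⟩
  obtain ⟨q₀, hq₀⟩ := hne
  have hex : ∃ ε ∈ ({1, -1} : Set ℤ), η ε q₀ 0 ≠ 0 := by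
    by_contra! hcon
    obtain ⟨-, -, n3⟩ := hnull q₀ hq₀
    rw [hcon 1 p1, hcon (-1) m1] at n3
    norm_num at n3
  obtain ⟨ε, hε, hne⟩ := hex
  have sη := contDiffOn_pi.1 (aη ε).1
  obtain ⟨r, hr, hsub, hball⟩ := exists_ball_ne_zero hD (sη 0) hq₀ hne
  refine ⟨q₀, hq₀, r, hr, hsub, isProductOn_of_pd_eq (A := fun q => η ε q 0) (c := 0) hr
    (hρ.mono hsub) ((sη 0).mono hsub) (fun q hq => h0 q (hsub hq)) hball
    (fun q hq => (((nullModel_isAdmissible_iff h0).1 (aη ε)).2 q (hsub hq)).2.1)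
    (fun q hq => ?_)⟩
  have hq' := hsub hq
  have k1 := (nullModel_lie_Vcharge hD hρ h0 (aη ε) hq').2.2
  -- Both `∂_u (ρ η⁰)` and `∂_v (ρ η¹)` equal `-2` times the mixed derivative of `f ε`, and their
  -- sum is zero by the Killing equation.
  have k2 : pd 0 (fun y => ρ y * η ε y 0) q = -2 * pd 0 (pd 1 (f ε)) q := by
    rw [← pd_const_mul]
    exact pd_congr_on hD (fun y hy => by rw [(hgrad ε hε y hy).2]; ring) hq' 0
  have k3 : pd 1 (fun y => ρ y * η ε y 1) q = -2 * pd 1 (pd 0 (f ε)) q := by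
    rw [← pd_const_mul]
    exact pd_congr_on hD (fun y hy => by rw [(hgrad ε hε y hy).1]; ring) hq' 1
  have k4 := pd_pd_comm ((hfs ε).contDiffAt (hD.mem_nhds hq')) 0 1
  rw [zero_mul]
  rw [k4] at k2
  linarith

end FullAlgebra

/-! ### Obstructions when `ρ W` is a sum of monomials -/

section MonomialPotential

variable {D : Set (Fin 2 → ℝ)} {ρ W : (Fin 2 → ℝ) → ℝ} {E : Finset (ℝ × ℝ)} {c : ℝ × ℝ → ℝ}
  {σ : ℝ}

lemma IsProductOn.mul_const {f g : (Fin 2 → ℝ) → ℝ} {q₀ : Fin 2 → ℝ} {ε k : ℝ} (hε : 0 < ε)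
    (h : IsProductOn f q₀ ε) (hg : ∀ q ∈ Metric.ball q₀ ε, g q = f q * k) :
    IsProductOn g q₀ ε := by
  intro u₁ u₂ v₁ v₂ hu₁ hu₂ hv₁ hv₂
  have hm : ∀ u v : ℝ, |u - q₀ 0| < ε → |v - q₀ 1| < ε →
      g ![u, v] = f ![u, v] * k := fun u v hu hv => hg _ ((mem_ball_fin_two hε).2 ⟨hu, hv⟩)
  rw [hm _ _ hu₁ hv₁, hm _ _ hu₂ hv₂, hm _ _ hu₁ hv₂, hm _ _ hu₂ hv₁]
  linear_combination k ^ 2 * h u₁ u₂ v₁ v₂ hu₁ hu₂ hv₁ hv₂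

/-- For `κ ≠ 0` the product form passes from `ρ` to `ρ κ`, the sum of monomials. For `κ = 0` that
sum would vanish on a ball, against the independence of the monomials. -/
lemma nullModel_not_isProductOn (hDq : D ⊆ quadrant) (h0 : ∀ q ∈ D, ρ q ≠ 0)
    (hE : ∀ e ∈ E, e.1 + e.2 = σ) (hc : ∀ e ∈ E, c e ≠ 0) (hcard : E.Nontrivial)
    (hf : ∀ q ∈ D, ρ q * W q = ∑ e ∈ E, c e * mono e.1 e.2 q) {κ : ℝ}
    {q₀ : Fin 2 → ℝ} {ε : ℝ} (hε : 0 < ε) (hB : Metric.ball q₀ ε ⊆ D)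
    (hW : ∀ q ∈ Metric.ball q₀ ε, W q = κ) : ¬ IsProductOn ρ q₀ ε := by
  intro h
  rcases eq_or_ne κ 0 with rfl | hκ
  · obtain ⟨e, he⟩ := hcard.nonempty
    refine hc e he (coeff_eq_zero_of_mono_sum (m := fun e => e.2) hε (hB.trans hDq) (injOn_fst_of_add_eq hE)
      (fun q hq => ?_) e he)
    rw [← hf q (hB hq), hW q hq, mul_zero]
  · refine not_isProductOn_mono_sum hE hc hcard hε (hB.trans hDq)
      (fun q hq => hf q (hB hq)) (fun q hq => ?_)
      (h.mul_const hε fun q hq => by rw [hW q hq])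
    rw [hW q hq]
    exact mul_ne_zero (h0 q (hB hq)) hκ

lemma nullModel_not_hasFullAlgebra (hD : IsOpen D) (hne : D.Nonempty) (hDq : D ⊆ quadrant)
    (hρ : ContDiffOn ℝ ∞ ρ D) (h0 : ∀ q ∈ D, ρ q ≠ 0)
    (hE : ∀ e ∈ E, e.1 + e.2 = σ) (hc : ∀ e ∈ E, c e ≠ 0) (hcard : E.Nontrivial)
    (hf : ∀ q ∈ D, ρ q * W q = ∑ e ∈ E, c e * mono e.1 e.2 q) :
    ¬ (nullModel ρ W).HasFullAlgebra D (fun _ => 1) := by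
  intro h
  obtain ⟨U₀, hU, q₀, -, ε, hε, hB, hp⟩ :=
    nullModel_isProductOn_of_hasFullAlgebra hD hne hρ h0 h
  exact nullModel_not_isProductOn hDq h0 hE hc hcard hf hε hB (fun q hq => hU q (hB hq)) hp

lemma exists_ball_of_chargesSpanSL2 (hD : IsOpen D) (hρ : ContDiffOn ℝ ∞ ρ D)
    (hW : ContDiffOn ℝ ∞ W D) (h0 : ∀ q ∈ D, ρ q ≠ 0) {U₀ lam : ℝ}
    {ξ : (Fin 2 → ℝ) → Fin 2 → ℝ}
    (hξ : (nullModel ρ W).IsAdmissible D (fun _ => 1) U₀ lam ξ)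
    (h : (nullModel ρ W).ChargesSpanSL2 D (fun _ => 1) U₀ ξ) :
    lam ≠ 0 ∧ ∃ q₀ ∈ D, ∃ ε > 0, Metric.ball q₀ ε ⊆ D ∧
      (∀ q ∈ Metric.ball q₀ ε, ξ q 0 ≠ 0 ∧ ξ q 1 ≠ 0) ∧
      ∀ q ∈ Metric.ball q₀ ε, pd 0 (fun y => ρ y * ξ y 0) q = lam / 2 * ρ q ∧
        pd 1 (fun y => ρ y * ξ y 1) q = lam / 2 * ρ q := by
  obtain ⟨hlam, ⟨q₀, hq₀, hne⟩, -⟩ := (nullModel_chargesSpanSL2_iff hD hρ hW h0 hξ).1 h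
  have hs := contDiffOn_pi.1 hξ.1
  obtain ⟨ε, hε, hB, hne⟩ := exists_ball_ne_zero (A := fun q => ξ q 0 * ξ q 1) hD
    ((hs 0).mul (hs 1)) hq₀ hne
  exact ⟨hlam, q₀, hq₀, ε, hε, hB, fun q hq => mul_ne_zero_iff.1 (hne q hq), fun q hq =>
    nullModel_weights_of_chargesSpanSL2 hD hρ hW h0 hξ h (hB hq) (hne q hq)⟩

/-- No full algebra is needed here: the half-weight equation for `ξ⁰`, a function of `u` alone,
already makes `ρ` a product. -/
lemma nullModel_not_chargesSpanSL2_of_const (hD : IsOpen D) (hDq : D ⊆ quadrant)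
    (hρ : ContDiffOn ℝ ∞ ρ D) (h0 : ∀ q ∈ D, ρ q ≠ 0)
    (hE : ∀ e ∈ E, e.1 + e.2 = σ) (hc : ∀ e ∈ E, c e ≠ 0) (hcard : E.Nontrivial)
    (hf : ∀ q ∈ D, ρ q * W q = ∑ e ∈ E, c e * mono e.1 e.2 q) {κ : ℝ} (hW : ∀ q ∈ D, W q = κ)
    {U₀ lam : ℝ} {ξ : (Fin 2 → ℝ) → Fin 2 → ℝ}
    (hξ : (nullModel ρ W).IsAdmissible D (fun _ => 1) U₀ lam ξ) :
    ¬ (nullModel ρ W).ChargesSpanSL2 D (fun _ => 1) U₀ ξ := by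
  intro h
  have hWs : ContDiffOn ℝ ∞ W D := contDiffOn_const.congr hW
  obtain ⟨-, q₀, -, ε, hε, hB, hne, hw⟩ := exists_ball_of_chargesSpanSL2 hD hρ hWs h0 hξ h
  exact nullModel_not_isProductOn hDq h0 hE hc hcard hf hε hB (fun q hq => hW q (hB hq))
    (isProductOn_of_pd_eq (A := fun q => ξ q 0) hε (hρ.mono hB) ((contDiffOn_pi.1 hξ.1 0).mono hB)
      (fun q hq => h0 q (hB hq)) (fun q hq => (hne q hq).1)
      (fun q hq => (((nullModel_isAdmissible_iff h0).1 hξ).2 q (hB hq)).2.1)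
      (fun q hq => (hw q hq).1))

lemma pd_sum_mono {ι : Type*} (s : Finset ι) (b d : ι → ℝ) {q : Fin 2 → ℝ} (hq : q ∈ quadrant) :
    pd 0 (fun y => ∑ e ∈ s, b e * mono (d e) (-d e) y) q
        = (∑ e ∈ s, b e * d e * mono (d e) (-d e) q) / q 0 ∧
    pd 1 (fun y => ∑ e ∈ s, b e * mono (d e) (-d e) y) q
        = -(∑ e ∈ s, b e * d e * mono (d e) (-d e) q) / q 1 := by
  have hd := fun e (_ : e ∈ s) => (differentiableAt_mono hq (d e) (-d e)).const_mul (b e)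
  rw [pd_sum 0 hd, pd_sum 1 hd, ← Finset.sum_neg_distrib, Finset.sum_div, Finset.sum_div]
  constructor <;> refine Finset.sum_congr rfl fun e _ => ?_
  · rw [pd_const_mul, pd_zero_mono hq]
    ring
  · rw [pd_const_mul, pd_one_mono hq]
    ring

lemma contDiffOn_sum_mono {ι : Type*} (s : Finset ι) (b d : ι → ℝ) :
    ContDiffOn ℝ ∞ (fun y => ∑ e ∈ s, b e * mono (d e) (-d e) y) quadrant :=
  ContDiffOn.sum fun _ _ => contDiffOn_const.mul (contDiffOn_mono _ _)

/-- The half-weight equations have solutions `A₀ = lam u / (2 (n + 1)) + k u^(-n)`, and similarly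
for `A₁`; the point is to exclude the extra term. Both `W` and `Θ = u ∂_u W` are homogeneous of
degree zero, so the potential equation makes `A₀ v - A₁ u` homogeneous of degree two. -/
lemma proportional_of_scaling {B : Set (Fin 2 → ℝ)} (hB : IsOpen B) (hBq : B ⊆ quadrant)
    {A₀ A₁ W Θ Θ' : (Fin 2 → ℝ) → ℝ} {n m lam U₀ : ℝ} (hn : n + 1 ≠ 0) (hm : m + 1 ≠ 0)
    (dA₀ : ∀ q ∈ B, DifferentiableAt ℝ A₀ q) (dA₁ : ∀ q ∈ B, DifferentiableAt ℝ A₁ q)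
    (dW : ∀ q ∈ B, DifferentiableAt ℝ W q) (dΘ : ∀ q ∈ B, DifferentiableAt ℝ Θ q)
    (hA₀ : ∀ q ∈ B, pd 1 A₀ q = 0) (hA₁ : ∀ q ∈ B, pd 0 A₁ q = 0)
    (w₀ : ∀ q ∈ B, n / q 0 * A₀ q + pd 0 A₀ q = lam / 2)
    (w₁ : ∀ q ∈ B, m / q 1 * A₁ q + pd 1 A₁ q = lam / 2)
    (hW : ∀ q ∈ B, pd 0 W q = Θ q / q 0 ∧ pd 1 W q = -Θ q / q 1)
    (hΘ : ∀ q ∈ B, pd 0 Θ q = Θ' q / q 0 ∧ pd 1 Θ q = -Θ' q / q 1)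
    (Θ0 : ∀ q ∈ B, Θ q ≠ 0)
    (hpot : ∀ q ∈ B, A₀ q * pd 0 W q + A₁ q * pd 1 W q = -lam * (W q - U₀)) :
    ∀ q ∈ B, (n + 1) * A₀ q = lam / 2 * q 0 ∧ (m + 1) * A₁ q = lam / 2 * q 1 := by
  have e1 : ∀ q ∈ B, (A₀ q * q 1 - A₁ q * q 0) * Θ q = -lam * ((W q - U₀) * (q 0 * q 1)) := by
    intro q hq
    have h := hpot q hq
    have q0 := (hBq hq).1.ne'
    have q1 := (hBq hq).2.ne'
    rw [(hW q hq).1, (hW q hq).2] at h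
    field_simp at h
    linear_combination h
  have c0 := fun q : Fin 2 → ℝ => differentiableAt_coord 0 q
  have c1 := fun q : Fin 2 → ℝ => differentiableAt_coord 1 q
  have e2 : ∀ q ∈ B, (n + 1) * (A₀ q * q 1) = (m + 1) * (A₁ q * q 0) := by
    intro q hq
    have q0 := (hBq hq).1.ne'
    have q1 := (hBq hq).2.ne'
    -- Adding `u` times the `u`-derivative and `v` times the `v`-derivative of `e1` applies the
    -- Euler operator, which kills `W` and `Θ`; the half-weight equations replace the derivatives of
    -- `A₀` and `A₁`.
    have p := fun i => pd_congr_on hB e1 hq i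
    have dF := ((dA₀ q hq).fun_mul (c1 q)).fun_sub ((dA₁ q hq).fun_mul (c0 q))
    have dG := (dW q hq).sub_const U₀
    simp only [pd_mul _ dF (dΘ q hq), pd_sub _ ((dA₀ q hq).fun_mul (c1 q))
      ((dA₁ q hq).fun_mul (c0 q)), pd_mul _ (dA₀ q hq) (c1 q), pd_mul _ (dA₁ q hq) (c0 q),
      pd_const_mul, pd_mul _ dG ((c0 q).fun_mul (c1 q)), pd_sub_const, pd_mul _ (c0 q) (c1 q),
      pd_coord] at p
    have p0 := p 0
    have p1 := p 1
    have v0 := w₀ q hq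
    have v1 := w₁ q hq
    have s := e1 q hq
    simp only [hA₀ q hq, hA₁ q hq, (hW q hq).1, (hW q hq).2, (hΘ q hq).1, (hΘ q hq).2] at p0 p1
    simp at p0 p1
    field_simp at p0 p1 v0 v1
    refine mul_left_cancel₀ (Θ0 q hq) ?_
    linear_combination (-1 : ℝ) * p0 - p1 + 2 * s + Θ q * q 1 * v0 / 2 - Θ q * q 0 * v1 / 2
  intro q hq
  have q0 := (hBq hq).1.ne'
  have q1 := (hBq hq).2.ne'
  -- Differentiating the proportionality once more gives `u A₀' = A₀` and `v A₁' = A₁`, so both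
  -- components are linear and the half-weight equations fix their slopes.
  have p := fun i => pd_congr_on hB e2 hq i
  simp only [pd_const_mul, pd_mul _ (dA₀ q hq) (c1 q), pd_mul _ (dA₁ q hq) (c0 q), pd_coord] at p
  have p0 := p 0
  have p1 := p 1
  have v0 := w₀ q hq
  have v1 := w₁ q hq
  have s := e2 q hq
  simp [hA₀ q hq, hA₁ q hq] at p0 p1
  field_simp at v0 v1
  constructor
  · refine mul_left_cancel₀ (mul_ne_zero hn q1) ?_
    linear_combination (n + 1) * q 1 * v0 / 2 - q 0 * p0 + s
  · refine mul_left_cancel₀ (mul_ne_zero hm q0) ?_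
    linear_combination (m + 1) * q 0 * v1 / 2 + q 1 * p1 - s

/-- Dividing by the monomial `e₀` gives `W = Σ b_e (u / v)^(d_e)`, since all exponent pairs have the
same sum. With `ξ` linear by `proportional_of_scaling`, the potential equation is a linear relation
between these powers, and its coefficient at `e₁` is `PowerCondition` up to a nonzero factor. -/
lemma nullModel_not_chargesSpanSL2_of_mono (hD : IsOpen D) (hDq : D ⊆ quadrant)
    (hE : ∀ e ∈ E, e.1 + e.2 = σ) (hc : ∀ e ∈ E, c e ≠ 0) {r : ℝ} (hr : r ≠ 0) {e₀ e₁ : ℝ × ℝ}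
    (he₀ : e₀ ∈ E) (he₁ : e₁ ∈ E) (hpow : ¬ PowerCondition e₀ e₁) (hne : e₁ ≠ e₀)
    (hn : e₀.1 + 1 ≠ 0) (hm : e₀.2 + 1 ≠ 0) (hρ : ∀ q ∈ D, ρ q = r * mono e₀.1 e₀.2 q)
    (hf : ∀ q ∈ D, ρ q * W q = ∑ e ∈ E, c e * mono e.1 e.2 q)
    {U₀ lam : ℝ} {ξ : (Fin 2 → ℝ) → Fin 2 → ℝ}
    (hξ : (nullModel ρ W).IsAdmissible D (fun _ => 1) U₀ lam ξ) :
    ¬ (nullModel ρ W).ChargesSpanSL2 D (fun _ => 1) U₀ ξ := by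
  intro h
  set d : ℝ × ℝ → ℝ := fun e => e.1 - e₀.1 with hd
  set b : ℝ × ℝ → ℝ := fun e => c e / r with hb
  set Θ : (Fin 2 → ℝ) → ℝ := fun q => ∑ e ∈ E, b e * d e * mono (d e) (-d e) q with hΘ
  have hb0 : ∀ e ∈ E, b e ≠ 0 := fun e he => div_ne_zero (hc e he) hr
  have hinj : Set.InjOn d E := fun e he e' he' h =>
    injOn_fst_of_add_eq hE he he' (by simpa [hd] using h)
  have hd1 : d e₁ ≠ 0 := fun h => hne (hinj he₁ he₀ (h.trans (by simp [hd])))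
  have hWe : ∀ q ∈ D, W q = ∑ e ∈ E, b e * mono (d e) (-d e) q := by
    intro q hq
    have h1 := hf q hq
    have h2 : r * mono e₀.1 e₀.2 q ≠ 0 := mul_ne_zero hr (mono_pos (hDq hq) _ _).ne'
    rw [hρ q hq] at h1
    refine mul_left_cancel₀ h2 ?_
    rw [h1, Finset.mul_sum]
    refine Finset.sum_congr rfl fun e he => ?_
    have h3 := mono_mul (hDq hq) e₀.1 e₀.2 (d e) (-d e)
    rw [show e₀.1 + d e = e.1 by simp [hd],
      show e₀.2 + -d e = e.2 by simp only [hd]; linarith [hE e he, hE e₀ he₀]] at h3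
    rw [← h3, hb]
    field_simp
  have hWs : ContDiffOn ℝ ∞ W D := ((contDiffOn_sum_mono E b d).mono hDq).congr hWe
  have hΘs : ContDiffOn ℝ ∞ Θ quadrant := contDiffOn_sum_mono E (fun e => b e * d e) d
  have hρs : ContDiffOn ℝ ∞ ρ D :=
    (contDiffOn_const.mul ((contDiffOn_mono _ _).mono hDq)).congr hρ
  have h0 : ∀ q ∈ D, ρ q ≠ 0 := fun q hq => by
    rw [hρ q hq]
    exact mul_ne_zero hr (mono_pos (hDq hq) _ _).ne'
  have hgrad : ∀ q ∈ D, pd 0 W q = Θ q / q 0 ∧ pd 1 W q = -Θ q / q 1 := fun q hq => by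
    rw [pd_congr_on hD hWe hq, pd_congr_on hD hWe hq]
    exact pd_sum_mono E b d (hDq hq)
  obtain ⟨hlam, q₁, -, ε₁, hε₁, hB₁, -, hw⟩ := exists_ball_of_chargesSpanSL2 hD hρs hWs h0 hξ h
  -- The coefficient of `Θ` at `e₁` is `b e₁ * d e₁ ≠ 0`, so `Θ` cannot vanish on a whole ball; one
  -- shrinks to a ball on which it has no zero.
  have hex : ∃ q₂ ∈ Metric.ball q₁ ε₁, Θ q₂ ≠ 0 := by
    by_contra! hcon
    exact mul_ne_zero (hb0 e₁ he₁) hd1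
      (coeff_eq_zero_of_mono_sum hε₁ (hB₁.trans hDq) hinj hcon e₁ he₁)
  obtain ⟨q₂, hq₂, hΘ2⟩ := hex
  obtain ⟨ε₂, hε₂, hB₂, hΘne⟩ := exists_ball_ne_zero Metric.isOpen_ball
    (hΘs.mono (hB₁.trans hDq)) hq₂ hΘ2
  have hBD := hB₂.trans hB₁
  have hsξ := contDiffOn_pi.1 hξ.1
  have hadm := ((nullModel_isAdmissible_iff h0).1 hξ).2
  have hwt : ∀ q ∈ D, pd 0 ρ q = e₀.1 / q 0 * ρ q ∧ pd 1 ρ q = e₀.2 / q 1 * ρ q := by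
    intro q hq
    rw [pd_congr_on hD hρ hq, pd_congr_on hD hρ hq, pd_const_mul, pd_const_mul,
      pd_zero_mono (hDq hq), pd_one_mono (hDq hq), hρ q hq]
    constructor <;> ring
  have key := proportional_of_scaling (A₀ := fun q => ξ q 0) (A₁ := fun q => ξ q 1)
    (Θ' := fun q => ∑ e ∈ E, b e * d e * d e * mono (d e) (-d e) q)
    Metric.isOpen_ball (hBD.trans hDq) hn hm
    (fun q hq => differentiableAt_of_contDiffOn hD (hsξ 0) (hBD hq))
    (fun q hq => differentiableAt_of_contDiffOn hD (hsξ 1) (hBD hq))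
    (fun q hq => differentiableAt_of_contDiffOn hD hWs (hBD hq))
    (fun q hq => differentiableAt_of_contDiffOn isOpen_quadrant hΘs (hDq (hBD hq)))
    (fun q hq => (hadm q (hBD hq)).2.1) (fun q hq => (hadm q (hBD hq)).1)
    (fun q hq => by
      have h1 := (hw q (hB₂ hq)).1
      rw [pd_mul 0 (differentiableAt_of_contDiffOn hD hρs (hBD hq))
        (differentiableAt_of_contDiffOn hD (hsξ 0) (hBD hq)), (hwt q (hBD hq)).1] at h1
      exact mul_left_cancel₀ (h0 q (hBD hq)) (by linear_combination h1))
    (fun q hq => by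
      have h1 := (hw q (hB₂ hq)).2
      rw [pd_mul 1 (differentiableAt_of_contDiffOn hD hρs (hBD hq))
        (differentiableAt_of_contDiffOn hD (hsξ 1) (hBD hq)), (hwt q (hBD hq)).2] at h1
      exact mul_left_cancel₀ (h0 q (hBD hq)) (by linear_combination h1))
    (fun q hq => hgrad q (hBD hq))
    (fun q hq => pd_sum_mono E (fun e => b e * d e) d (hDq (hBD hq)))
    hΘne (fun q hq => (hadm q (hBD hq)).2.2.2)
  -- With the slopes of `ξ` inserted, `ξ(W) = lam τ Θ`.
  set τ : ℝ := (1 / (e₀.1 + 1) - 1 / (e₀.2 + 1)) / 2 with hτ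
  have hrel : ∀ q ∈ Metric.ball q₂ ε₂, τ * Θ q + W q - U₀ = 0 := by
    intro q hq
    obtain ⟨k0, k1⟩ := key q hq
    have q0 := (hDq (hBD hq)).1.ne'
    have q1 := (hDq (hBD hq)).2.ne'
    have h1 := (hadm q (hBD hq)).2.2.2
    rw [(hgrad q (hBD hq)).1, (hgrad q (hBD hq)).2,
      show ξ q 0 = lam / 2 * q 0 / (e₀.1 + 1) by field_simp; linear_combination 2 * k0,
      show ξ q 1 = lam / 2 * q 1 / (e₀.2 + 1) by field_simp; linear_combination 2 * k1] at h1
    refine mul_left_cancel₀ hlam ?_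
    rw [hτ]
    field_simp at h1 ⊢
    linear_combination h1
  -- The constant `U₀` belongs to the exponent `d e₀ = 0`, so it affects only the coefficient at
  -- `e₀`.
  have hcoef := coeff_eq_zero_of_mono_sum hε₂ (hBD.trans hDq) (s := E)
    (c := fun e => b e * (1 + τ * d e) - if e = e₀ then U₀ else 0) (n := d) (m := fun e => -d e)
    hinj (fun q hq => by
      refine Eq.trans ?_ (hrel q hq)
      rw [hWe q (hBD hq)]
      simp only [sub_mul, ite_mul, zero_mul, Finset.sum_sub_distrib, Finset.sum_ite_eq', he₀,
        if_true, hΘ, Finset.mul_sum, ← Finset.sum_add_distrib]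
      congr 1
      · exact Finset.sum_congr rfl fun e _ => by ring
      · simp [hd, mono])
  have h1 := hcoef e₁ he₁
  rw [if_neg hne, sub_zero, mul_eq_zero, or_iff_right (hb0 e₁ he₁), hτ] at h1
  apply hpow
  have h2 : e₁.2 = e₀.2 - d e₁ := by simp only [hd]; linarith [hE e₁ he₁, hE e₀ he₀]
  have h3 : e₁.1 = e₀.1 + d e₁ := by simp [hd]
  rw [PowerCondition, h2, h3]
  field_simp at h1
  linear_combination h1

end MonomialPotential

/-! ### Scalar curvature of metrics depending on a single coordinate -/

section OneCoordinate

lemma pd_comp_coord {n : ℕ} (i j : Fin n) {f : ℝ → ℝ} {f' : ℝ} {x : Fin n → ℝ}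
    (hf : HasDerivAt f f' (x j)) : pd i (fun y => f (y j)) x = if i = j then f' else 0 := by
  rw [pd]
  split_ifs with h
  · subst h
    simpa using hf.deriv
  · simp [Function.update_of_ne (Ne.symm h)]

/-- Christoffel symbols of a metric that depends on the coordinate `j` only, in terms of the
inverse `K` of the metric and the derivative `F'` of the metric. -/
def oneCoordChristoffel (j : Fin 3) (K F' : Matrix (Fin 3) (Fin 3) ℝ) (k a b : Fin 3) : ℝ :=
  (1 / 2) * ∑ l, K k l * ((if a = j then F' b l else 0) + (if b = j then F' a l else 0)
    - (if l = j then F' a b else 0))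

variable {j : Fin 3} {F F₁ F₂ K K₁ : ℝ → Matrix (Fin 3) (Fin 3) ℝ} {U : Set ℝ}

lemma christoffel_oneCoord (hF : ∀ t a b, HasDerivAt (fun t => F t a b) (F₁ t a b) t)
    (hK : ∀ t ∈ U, (F t)⁻¹ = K t) {x : Fin 3 → ℝ} (hx : x j ∈ U) (k a b : Fin 3) :
    christoffel (fun y => F (y j)) k a b x
      = oneCoordChristoffel j (K (x j)) (F₁ (x j)) k a b := by
  simp only [christoffel, oneCoordChristoffel, hK _ hx, pd_comp_coord _ j (hF _ _ _)]

/-- `oneCoordChristoffel` is linear in the inverse metric and in the derivative separately, so its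
own derivative is a sum of two terms of the same shape, and only the coordinate `j` contributes. -/
lemma scalarCurvature_oneCoord (hU : IsOpen U)
    (hF : ∀ t a b, HasDerivAt (fun t => F t a b) (F₁ t a b) t)
    (hF₁ : ∀ t a b, HasDerivAt (fun t => F₁ t a b) (F₂ t a b) t)
    (hK : ∀ t ∈ U, (F t)⁻¹ = K t)
    (hK₁ : ∀ t ∈ U, ∀ a b, HasDerivAt (fun t => K t a b) (K₁ t a b) t)
    {x : Fin 3 → ℝ} (hx : x j ∈ U) :
    scalarCurvature (fun y => F (y j)) x
      = ∑ l, ∑ m, K (x j) l m * ∑ k,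
        ((if k = j then oneCoordChristoffel j (K₁ (x j)) (F₁ (x j)) k m l
            + oneCoordChristoffel j (K (x j)) (F₂ (x j)) k m l else 0)
          - (if m = j then oneCoordChristoffel j (K₁ (x j)) (F₁ (x j)) k k l
            + oneCoordChristoffel j (K (x j)) (F₂ (x j)) k k l else 0)
          + ∑ n, (oneCoordChristoffel j (K (x j)) (F₁ (x j)) k k n
              * oneCoordChristoffel j (K (x j)) (F₁ (x j)) n m l
            - oneCoordChristoffel j (K (x j)) (F₁ (x j)) k m n
              * oneCoordChristoffel j (K (x j)) (F₁ (x j)) n k l)) := by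
  have hd : ∀ k a b, HasDerivAt (fun t => oneCoordChristoffel j (K t) (F₁ t) k a b)
      (oneCoordChristoffel j (K₁ (x j)) (F₁ (x j)) k a b
        + oneCoordChristoffel j (K (x j)) (F₂ (x j)) k a b) (x j) := by
    intro k a b
    have hite : ∀ (p : Prop) [Decidable p] (c d : Fin 3),
        HasDerivAt (fun t => if p then F₁ t c d else 0) (if p then F₂ (x j) c d else 0) (x j) := by
      intro p _ c d
      split_ifs
      exacts [hF₁ _ c d, hasDerivAt_const _ _]
    simp only [oneCoordChristoffel]
    rw [← mul_add, ← Finset.sum_add_distrib]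
    exact (HasDerivAt.fun_sum fun l _ => (hK₁ _ hx k l).fun_mul
      (((hite _ b l).fun_add (hite _ a l)).fun_sub (hite _ a b))).const_mul _
  have hUo : IsOpen {y : Fin 3 → ℝ | y j ∈ U} := hU.preimage (continuous_apply j)
  have hpd : ∀ i k a b, pd i (christoffel (fun y => F (y j)) k a b) x
      = if i = j then oneCoordChristoffel j (K₁ (x j)) (F₁ (x j)) k a b
        + oneCoordChristoffel j (K (x j)) (F₂ (x j)) k a b else 0 := by
    intro i k a b
    rw [pd_congr_on hUo (fun y hy => christoffel_oneCoord hF hK hy k a b) hx i]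
    exact pd_comp_coord i j (hd k a b)
  simp only [scalarCurvature, riemann, hK _ hx, hpd, christoffel_oneCoord hF hK hx]

variable {A : ℝ} {P P₁ P₂ Q Q₁ Q₂ S S₁ S₂ : ℝ → ℝ}

lemma hasDerivAt_div_det {f P Q S : ℝ → ℝ} {f₁ p₁ q₁ s₁ t : ℝ} (hf : HasDerivAt f f₁ t)
    (hP : HasDerivAt P p₁ t) (hQ : HasDerivAt Q q₁ t) (hS : HasDerivAt S s₁ t)
    (hd : P t * S t - Q t ^ 2 ≠ 0) :
    HasDerivAt (fun t => f t / (P t * S t - Q t ^ 2))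
      ((f₁ * (P t * S t - Q t ^ 2) - f t * (p₁ * S t + P t * s₁ - 2 * Q t * q₁))
        / (P t * S t - Q t ^ 2) ^ 2) t := by
  have h := hf.fun_div ((hP.fun_mul hS).fun_sub (hQ.fun_pow 2)) hd
  simpa using h

/-- The scalar curvature of `A dr² + h(r)` in terms of the entries of the block `h` and their
derivatives. -/
def blockCurvature (A p p₁ p₂ q q₁ q₂ s s₁ s₂ : ℝ) : ℝ :=
  -(1 / A) * ((p₂ * s + 2 * p₁ * s₁ + p * s₂ - 2 * q₁ ^ 2 - 2 * q * q₂) / (p * s - q ^ 2)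
    - (p₁ * s + p * s₁ - 2 * q * q₁) ^ 2 / (2 * (p * s - q ^ 2) ^ 2)
    - (p₁ * s₁ - q₁ ^ 2) / (2 * (p * s - q ^ 2)))

lemma scalarCurvature_block_zero (hU : IsOpen U) (hA : A ≠ 0)
    (hP : ∀ t, HasDerivAt P (P₁ t) t) (hP₁ : ∀ t, HasDerivAt P₁ (P₂ t) t)
    (hQ : ∀ t, HasDerivAt Q (Q₁ t) t) (hQ₁ : ∀ t, HasDerivAt Q₁ (Q₂ t) t)
    (hS : ∀ t, HasDerivAt S (S₁ t) t) (hS₁ : ∀ t, HasDerivAt S₁ (S₂ t) t)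
    (hd : ∀ t ∈ U, P t * S t - Q t ^ 2 ≠ 0) {x : Fin 3 → ℝ} (hx : x 0 ∈ U) :
    scalarCurvature (fun y => !![A, 0, 0; 0, P (y 0), Q (y 0); 0, Q (y 0), S (y 0)]) x
      = blockCurvature A (P (x 0)) (P₁ (x 0)) (P₂ (x 0)) (Q (x 0)) (Q₁ (x 0)) (Q₂ (x 0))
        (S (x 0)) (S₁ (x 0)) (S₂ (x 0)) := by
  have hdx := hd _ hx
  have key := scalarCurvature_oneCoord (j := 0) (U := U)
    (F := fun t => !![A, 0, 0; 0, P t, Q t; 0, Q t, S t])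
    (F₁ := fun t => !![0, 0, 0; 0, P₁ t, Q₁ t; 0, Q₁ t, S₁ t])
    (F₂ := fun t => !![0, 0, 0; 0, P₂ t, Q₂ t; 0, Q₂ t, S₂ t])
    (K := fun t => !![1 / A, 0, 0;
      0, S t / (P t * S t - Q t ^ 2), -Q t / (P t * S t - Q t ^ 2);
      0, -Q t / (P t * S t - Q t ^ 2), P t / (P t * S t - Q t ^ 2)])
    (K₁ := fun t =>
      let d := P t * S t - Q t ^ 2
      let d₁ := P₁ t * S t + P t * S₁ t - 2 * Q t * Q₁ t
      !![0, 0, 0; 0, (S₁ t * d - S t * d₁) / d ^ 2, (-Q₁ t * d - -Q t * d₁) / d ^ 2;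
        0, (-Q₁ t * d - -Q t * d₁) / d ^ 2, (P₁ t * d - P t * d₁) / d ^ 2])
    hU ?_ ?_ ?_ ?_ hx
  · rw [key, blockCurvature]
    generalize hδ : P (x 0) * S (x 0) - Q (x 0) ^ 2 = δ at hdx ⊢
    simp only [oneCoordChristoffel, Fin.sum_univ_three]
    simp
    field_simp
    rw [← hδ]
    ring
  · intro t a b
    fin_cases a <;> fin_cases b <;>
      simp only [Fin.mk_one, Fin.zero_eta, Fin.reduceFinMk, Matrix.of_apply, Matrix.cons_val] <;>
      first | exact hasDerivAt_const _ _ | exact hP t | exact hQ t | exact hS t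
  · intro t a b
    fin_cases a <;> fin_cases b <;>
      simp only [Fin.mk_one, Fin.zero_eta, Fin.reduceFinMk, Matrix.of_apply, Matrix.cons_val] <;>
      first | exact hasDerivAt_const _ _ | exact hP₁ t | exact hQ₁ t | exact hS₁ t
  · intro t ht
    have := hd t ht
    refine Matrix.inv_eq_right_inv ?_
    ext a b
    fin_cases a <;> fin_cases b <;> simp [Matrix.mul_apply, Fin.sum_univ_three] <;>
      field_simp <;> ring
  · intro t ht a b
    fin_cases a <;> fin_cases b <;>
      simp only [Fin.mk_one, Fin.zero_eta, Fin.reduceFinMk, Matrix.of_apply, Matrix.cons_val] <;>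
      first
      | exact hasDerivAt_const _ _
      | exact hasDerivAt_div_det (hS t) (hP t) (hQ t) (hS t) (hd t ht)
      | exact hasDerivAt_div_det (hQ t).fun_neg (hP t) (hQ t) (hS t) (hd t ht)
      | exact hasDerivAt_div_det (hP t) (hP t) (hQ t) (hS t) (hd t ht)

/-- The same computation with the distinguished coordinate in second place, as needed for III, VIII,
IX and KS. -/
lemma scalarCurvature_block_one (hU : IsOpen U) (hA : A ≠ 0)
    (hP : ∀ t, HasDerivAt P (P₁ t) t) (hP₁ : ∀ t, HasDerivAt P₁ (P₂ t) t)
    (hQ : ∀ t, HasDerivAt Q (Q₁ t) t) (hQ₁ : ∀ t, HasDerivAt Q₁ (Q₂ t) t)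
    (hS : ∀ t, HasDerivAt S (S₁ t) t) (hS₁ : ∀ t, HasDerivAt S₁ (S₂ t) t)
    (hd : ∀ t ∈ U, P t * S t - Q t ^ 2 ≠ 0) {x : Fin 3 → ℝ} (hx : x 1 ∈ U) :
    scalarCurvature (fun y => !![P (y 1), 0, Q (y 1); 0, A, 0; Q (y 1), 0, S (y 1)]) x
      = blockCurvature A (P (x 1)) (P₁ (x 1)) (P₂ (x 1)) (Q (x 1)) (Q₁ (x 1)) (Q₂ (x 1))
        (S (x 1)) (S₁ (x 1)) (S₂ (x 1)) := by
  have hdx := hd _ hx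
  have key := scalarCurvature_oneCoord (j := 1) (U := U)
    (F := fun t => !![P t, 0, Q t; 0, A, 0; Q t, 0, S t])
    (F₁ := fun t => !![P₁ t, 0, Q₁ t; 0, 0, 0; Q₁ t, 0, S₁ t])
    (F₂ := fun t => !![P₂ t, 0, Q₂ t; 0, 0, 0; Q₂ t, 0, S₂ t])
    (K := fun t => !![S t / (P t * S t - Q t ^ 2), 0, -Q t / (P t * S t - Q t ^ 2);
      0, 1 / A, 0;
      -Q t / (P t * S t - Q t ^ 2), 0, P t / (P t * S t - Q t ^ 2)])
    (K₁ := fun t =>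
      let d := P t * S t - Q t ^ 2
      let d₁ := P₁ t * S t + P t * S₁ t - 2 * Q t * Q₁ t
      !![(S₁ t * d - S t * d₁) / d ^ 2, 0, (-Q₁ t * d - -Q t * d₁) / d ^ 2; 0, 0, 0;
        (-Q₁ t * d - -Q t * d₁) / d ^ 2, 0, (P₁ t * d - P t * d₁) / d ^ 2])
    hU ?_ ?_ ?_ ?_ hx
  · rw [key, blockCurvature]
    generalize hδ : P (x 1) * S (x 1) - Q (x 1) ^ 2 = δ at hdx ⊢
    simp only [oneCoordChristoffel, Fin.sum_univ_three]
    simp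
    field_simp
    rw [← hδ]
    ring
  · intro t a b
    fin_cases a <;> fin_cases b <;>
      simp only [Fin.mk_one, Fin.zero_eta, Fin.reduceFinMk, Matrix.of_apply, Matrix.cons_val] <;>
      first | exact hasDerivAt_const _ _ | exact hP t | exact hQ t | exact hS t
  · intro t a b
    fin_cases a <;> fin_cases b <;>
      simp only [Fin.mk_one, Fin.zero_eta, Fin.reduceFinMk, Matrix.of_apply, Matrix.cons_val] <;>
      first | exact hasDerivAt_const _ _ | exact hP₁ t | exact hQ₁ t | exact hS₁ t
  · intro t ht
    have := hd t ht
    refine Matrix.inv_eq_right_inv ?_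
    ext a b
    fin_cases a <;> fin_cases b <;> simp [Matrix.mul_apply, Fin.sum_univ_three] <;>
      field_simp <;> ring
  · intro t ht a b
    fin_cases a <;> fin_cases b <;>
      simp only [Fin.mk_one, Fin.zero_eta, Fin.reduceFinMk, Matrix.of_apply, Matrix.cons_val] <;>
      first
      | exact hasDerivAt_const _ _
      | exact hasDerivAt_div_det (hS t) (hP t) (hQ t) (hS t) (hd t ht)
      | exact hasDerivAt_div_det (hQ t).fun_neg (hP t) (hQ t) (hS t) (hd t ht)
      | exact hasDerivAt_div_det (hP t) (hP t) (hQ t) (hS t) (hd t ht)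

end OneCoordinate

/-! ### Scalar curvature of the homogeneous models -/

section ExpBlock

variable {A h Δ : ℝ} {m m₁ m₂ n n₁ n₂ r r₁ r₂ : ℝ → ℝ}

lemma hasDerivAt_exp_sq_mul (h : ℝ) {f : ℝ → ℝ} {f₁ t : ℝ} (hf : HasDerivAt f f₁ t) :
    HasDerivAt (fun t => Real.exp (-(h * t)) ^ 2 * f t)
      (Real.exp (-(h * t)) ^ 2 * (-2 * h * f t + f₁)) t := by
  have h1 : HasDerivAt (fun t => -(h * t)) (-h) t := by
    simpa using ((hasDerivAt_id t).const_mul h).fun_neg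
  refine ((h1.exp.fun_pow 2).fun_mul hf).congr_deriv ?_
  push_cast
  ring

/-- The block is `e^(-2hx)` times a matrix of constant determinant `Δ`. The hypotheses `hd₁` and
`hd₂` are the first two derivatives of `hd`; they remove all terms except the exponential rate and
the determinant of the derivative. -/
lemma scalarCurvature_expBlock (hA : A ≠ 0) (hΔ : Δ ≠ 0)
    (hm : ∀ t, HasDerivAt m (m₁ t) t) (hm₁ : ∀ t, HasDerivAt m₁ (m₂ t) t)
    (hn : ∀ t, HasDerivAt n (n₁ t) t) (hn₁ : ∀ t, HasDerivAt n₁ (n₂ t) t)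
    (hr : ∀ t, HasDerivAt r (r₁ t) t) (hr₁ : ∀ t, HasDerivAt r₁ (r₂ t) t)
    (hd : ∀ t, m t * r t - n t ^ 2 = Δ) (hd₁ : ∀ t, m₁ t * r t + m t * r₁ t = 2 * n t * n₁ t)
    (hd₂ : ∀ t, m₂ t * r t + 2 * m₁ t * r₁ t + m t * r₂ t = 2 * n₁ t ^ 2 + 2 * n t * n₂ t)
    (x : Fin 3 → ℝ) :
    scalarCurvature (fun y => !![A, 0, 0;
      0, Real.exp (-(h * y 0)) ^ 2 * m (y 0), Real.exp (-(h * y 0)) ^ 2 * n (y 0);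
      0, Real.exp (-(h * y 0)) ^ 2 * n (y 0), Real.exp (-(h * y 0)) ^ 2 * r (y 0)]) x
      = -(1 / A) * (6 * h ^ 2 - (m₁ (x 0) * r₁ (x 0) - n₁ (x 0) ^ 2) / (2 * Δ)) := by
  have second : ∀ {f f₁ f₂ : ℝ → ℝ}, (∀ t, HasDerivAt f (f₁ t) t) →
      (∀ t, HasDerivAt f₁ (f₂ t) t) → ∀ t, HasDerivAt
        (fun t => Real.exp (-(h * t)) ^ 2 * (-2 * h * f t + f₁ t))
        (Real.exp (-(h * t)) ^ 2 * (4 * h ^ 2 * f t - 4 * h * f₁ t + f₂ t)) t := by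
    intro f f₁ f₂ hf hf₁ t
    refine (hasDerivAt_exp_sq_mul h (((hf t).const_mul (-2 * h)).fun_add (hf₁ t))).congr_deriv ?_
    ring
  have hdet : ∀ t, Real.exp (-(h * t)) ^ 2 * m t * (Real.exp (-(h * t)) ^ 2 * r t)
      - (Real.exp (-(h * t)) ^ 2 * n t) ^ 2 = Real.exp (-(h * t)) ^ 4 * Δ := by
    intro t
    rw [← hd t]
    ring
  rw [scalarCurvature_block_zero (U := Set.univ) isOpen_univ hA
    (fun t => hasDerivAt_exp_sq_mul h (hm t)) (second hm hm₁)
    (fun t => hasDerivAt_exp_sq_mul h (hn t)) (second hn hn₁)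
    (fun t => hasDerivAt_exp_sq_mul h (hr t)) (second hr hr₁)
    (fun t _ => by
      rw [hdet]
      exact mul_ne_zero (pow_ne_zero _ (Real.exp_ne_zero _)) hΔ) (Set.mem_univ _)]
  have e1 := hd (x 0)
  have e2 := hd₁ (x 0)
  have e3 := hd₂ (x 0)
  rw [blockCurvature, hdet]
  have hE : Real.exp (-(h * x 0)) ≠ 0 := Real.exp_ne_zero _
  generalize Real.exp (-(h * x 0)) = E at hE ⊢
  generalize m (x 0) = m at *
  generalize m₁ (x 0) = m₁ at *
  generalize m₂ (x 0) = m₂ at *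
  generalize n (x 0) = n at *
  generalize n₁ (x 0) = n₁ at *
  generalize n₂ (x 0) = n₂ at *
  generalize r (x 0) = r at *
  generalize r₁ (x 0) = r₁ at *
  generalize r₂ (x 0) = r₂ at *
  have i1 : E ^ 2 * (4 * h ^ 2 * m - 4 * h * m₁ + m₂) * (E ^ 2 * r)
      + 2 * (E ^ 2 * (-2 * h * m + m₁)) * (E ^ 2 * (-2 * h * r + r₁))
      + E ^ 2 * m * (E ^ 2 * (4 * h ^ 2 * r - 4 * h * r₁ + r₂))
      - 2 * (E ^ 2 * (-2 * h * n + n₁)) ^ 2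
      - 2 * (E ^ 2 * n) * (E ^ 2 * (4 * h ^ 2 * n - 4 * h * n₁ + n₂))
      = E ^ 4 * (16 * h ^ 2 * Δ) := by
    linear_combination E ^ 4 * (16 * h ^ 2 * e1 - 8 * h * e2 + e3)
  have i2 : E ^ 2 * (-2 * h * m + m₁) * (E ^ 2 * r) + E ^ 2 * m * (E ^ 2 * (-2 * h * r + r₁))
      - 2 * (E ^ 2 * n) * (E ^ 2 * (-2 * h * n + n₁)) = E ^ 4 * (-4 * h * Δ) := by
    linear_combination E ^ 4 * (-4 * h * e1 + e2)
  have i3 : E ^ 2 * (-2 * h * m + m₁) * (E ^ 2 * (-2 * h * r + r₁))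
      - (E ^ 2 * (-2 * h * n + n₁)) ^ 2 = E ^ 4 * (4 * h ^ 2 * Δ + (m₁ * r₁ - n₁ ^ 2)) := by
    linear_combination E ^ 4 * (4 * h ^ 2 * e1 - 2 * h * e2)
  rw [i1, i2, i3]
  field_simp
  ring

end ExpBlock

namespace Model

variable {L : ℝ} {q : Fin 2 → ℝ}

lemma scalarCurvature_V (hL : 0 < L) (hq : q ∈ quadrant) (x : Fin 3 → ℝ) :
    scalarCurvature (V.spatialMetric L q) x = -(6 / (L ^ 2 * q 0 ^ 2)) := by
  have ha := hq.1
  have hb := hq.2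
  have e : V.spatialMetric L q = fun y => !![L ^ 2 * q 0 ^ 2, 0, 0;
      0, Real.exp (-(1 * y 0)) ^ 2 * (q 0 ^ 4 / q 1 ^ 2), Real.exp (-(1 * y 0)) ^ 2 * 0;
      0, Real.exp (-(1 * y 0)) ^ 2 * 0, Real.exp (-(1 * y 0)) ^ 2 * q 1 ^ 2] := by
    ext y i j
    fin_cases i <;> fin_cases j <;>
      simp [spatialMetric, triad, internalMetric, Matrix.mul_apply, Fin.sum_univ_three,
        Matrix.diagonal] <;> ring
  rw [e, scalarCurvature_expBlock (Δ := q 0 ^ 4) (by positivity) (by positivity)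
    (fun t => hasDerivAt_const t _) (fun t => hasDerivAt_const t _)
    (fun t => hasDerivAt_const t _) (fun t => hasDerivAt_const t _)
    (fun t => hasDerivAt_const t _) (fun t => hasDerivAt_const t _)
    (fun t => by field_simp; ring) (fun t => by ring) (fun t => by ring)]
  field_simp
  ring

lemma scalarCurvature_IV (hL : 0 < L) (hq : q ∈ quadrant) (x : Fin 3 → ℝ) :
    scalarCurvature (IV.spatialMetric L q) x
      = -(6 / (L ^ 2 * q 0 ^ 2)) - q 1 ^ 4 / (2 * L ^ 2 * q 0 ^ 6) := by
  have ha := hq.1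
  have hb := hq.2
  have e : IV.spatialMetric L q = fun y => !![L ^ 2 * q 0 ^ 2, 0, 0;
      0, Real.exp (-(1 * y 0)) ^ 2 * (q 0 ^ 4 / q 1 ^ 2 + q 1 ^ 2 * y 0 ^ 2),
        Real.exp (-(1 * y 0)) ^ 2 * (-q 1 ^ 2 * y 0);
      0, Real.exp (-(1 * y 0)) ^ 2 * (-q 1 ^ 2 * y 0), Real.exp (-(1 * y 0)) ^ 2 * q 1 ^ 2] := by
    ext y i j
    fin_cases i <;> fin_cases j <;>
      simp [spatialMetric, triad, internalMetric, Matrix.mul_apply, Fin.sum_univ_three,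
        Matrix.diagonal] <;> ring
  have hm : ∀ t : ℝ, HasDerivAt (fun t => q 0 ^ 4 / q 1 ^ 2 + q 1 ^ 2 * t ^ 2)
      (2 * q 1 ^ 2 * t) t := by
    intro t
    refine (((hasDerivAt_pow 2 t).const_mul (q 1 ^ 2)).const_add (q 0 ^ 4 / q 1 ^ 2)).congr_deriv ?_
    push_cast
    ring
  have hlin : ∀ c t : ℝ, HasDerivAt (fun t => c * t) c t := fun c t => by
    simpa using (hasDerivAt_id t).const_mul c
  rw [e, scalarCurvature_expBlock (Δ := q 0 ^ 4) (by positivity) (by positivity)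
    hm (hlin (2 * q 1 ^ 2)) (hlin (-q 1 ^ 2)) (fun t => hasDerivAt_const t _)
    (fun t => hasDerivAt_const t _) (fun t => hasDerivAt_const t _)
    (fun t => by field_simp; ring) (fun t => by ring) (fun t => by ring)]
  field_simp
  ring

lemma scalarCurvature_VI0 (hL : 0 < L) (hq : q ∈ quadrant) (x : Fin 3 → ℝ) :
    scalarCurvature (VI0.spatialMetric L q) x = -(2 / (L ^ 2 * q 0 ^ 2)) := by
  have ha := hq.1
  have hb := hq.2
  have hexp : ∀ c k t : ℝ, HasDerivAt (fun t => c * Real.exp (k * t)) (c * k * Real.exp (k * t)) t := by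
    intro c k t
    have h1 : HasDerivAt (fun t => k * t) k t := by simpa using (hasDerivAt_id t).const_mul k
    refine (h1.exp.const_mul c).congr_deriv ?_
    ring
  have hexp2 : ∀ t : ℝ, Real.exp (2 * t) = Real.exp t ^ 2 := fun t => by
    rw [← Real.exp_nat_mul]
    norm_num
  have hmul : ∀ t : ℝ, Real.exp (-2 * t) * Real.exp (2 * t) = 1 := fun t => by
    rw [← Real.exp_add]
    simp
  have e : VI0.spatialMetric L q = fun y => !![L ^ 2 * q 0 ^ 2, 0, 0;
      0, Real.exp (-(0 * y 0)) ^ 2 * (q 1 ^ 2 * Real.exp (-2 * y 0)),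
        Real.exp (-(0 * y 0)) ^ 2 * 0;
      0, Real.exp (-(0 * y 0)) ^ 2 * 0,
        Real.exp (-(0 * y 0)) ^ 2 * (q 1 ^ 2 * Real.exp (2 * y 0))] := by
    ext y i j
    have h1 := hexp2 (-y 0)
    rw [mul_neg] at h1
    fin_cases i <;> fin_cases j <;>
      simp [spatialMetric, triad, internalMetric, Matrix.mul_apply, Fin.sum_univ_three,
        Matrix.diagonal, h1, hexp2] <;> ring
  rw [e, scalarCurvature_expBlock (Δ := q 1 ^ 4) (by positivity) (by positivity)
    (hexp (q 1 ^ 2) (-2)) (hexp (q 1 ^ 2 * -2) (-2))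
    (fun t => hasDerivAt_const t _) (fun t => hasDerivAt_const t _)
    (hexp (q 1 ^ 2) 2) (hexp (q 1 ^ 2 * 2) 2)
    (fun t => by linear_combination q 1 ^ 4 * hmul t) (fun t => by ring) (fun t => by ring)]
  have h2 := hmul (x 0)
  simp only [neg_mul] at h2 ⊢
  field_simp
  linear_combination (-4 * q 1 ^ 4) * h2

/-- Conjugation by the rotation of angle `x` keeps the determinant, and the derivative of the block
has the constant determinant `-(β - b²)²`, so the dependence on `x` disappears. -/
lemma scalarCurvature_VII (hL : 0 < L) (hq : q ∈ quadrant) (h : ℝ) (x : Fin 3 → ℝ) :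
    scalarCurvature ((VII h).spatialMetric L q) x
      = (1 - 6 * h ^ 2) / (L ^ 2 * q 0 ^ 2) - q 1 ^ 4 / (2 * L ^ 2 * q 0 ^ 6)
        - q 0 ^ 2 / (2 * L ^ 2 * q 1 ^ 4) := by
  have ha := hq.1
  have hb := hq.2
  set β : ℝ := q 0 ^ 4 / q 1 ^ 2 with hβ
  have e : (VII h).spatialMetric L q = fun y => !![L ^ 2 * q 0 ^ 2, 0, 0;
      0, Real.exp (-(h * y 0)) ^ 2 * (β * Real.cos (y 0) ^ 2 + q 1 ^ 2 * Real.sin (y 0) ^ 2),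
        Real.exp (-(h * y 0)) ^ 2 * ((β - q 1 ^ 2) * (Real.sin (y 0) * Real.cos (y 0)));
      0, Real.exp (-(h * y 0)) ^ 2 * ((β - q 1 ^ 2) * (Real.sin (y 0) * Real.cos (y 0))),
        Real.exp (-(h * y 0)) ^ 2 *
          (β * Real.sin (y 0) ^ 2 + q 1 ^ 2 * Real.cos (y 0) ^ 2)] := by
    ext y i j
    fin_cases i <;> fin_cases j <;>
      simp [spatialMetric, triad, internalMetric, Matrix.mul_apply, Fin.sum_univ_three,
        Matrix.diagonal] <;> ring
  have hs := Real.hasDerivAt_sin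
  have hc := Real.hasDerivAt_cos
  have hsc : ∀ k t : ℝ, HasDerivAt (fun t => k * (Real.sin t * Real.cos t))
      (k * (Real.cos t ^ 2 - Real.sin t ^ 2)) t := by
    intro k t
    refine (((hs t).fun_mul (hc t)).const_mul k).congr_deriv ?_
    ring
  have hcs : ∀ k t : ℝ, HasDerivAt (fun t => k * (Real.cos t ^ 2 - Real.sin t ^ 2))
      (-4 * k * (Real.sin t * Real.cos t)) t := by
    intro k t
    refine ((((hc t).fun_pow 2).fun_sub ((hs t).fun_pow 2)).const_mul k).congr_deriv ?_
    push_cast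
    ring
  have hsq : ∀ k l t : ℝ, HasDerivAt (fun t => k * Real.cos t ^ 2 + l * Real.sin t ^ 2)
      (2 * (l - k) * (Real.sin t * Real.cos t)) t := by
    intro k l t
    refine ((((hc t).fun_pow 2).const_mul k).fun_add (((hs t).fun_pow 2).const_mul l)).congr_deriv ?_
    push_cast
    ring
  have hsq' : ∀ k l t : ℝ, HasDerivAt (fun t => k * Real.sin t ^ 2 + l * Real.cos t ^ 2)
      (2 * (k - l) * (Real.sin t * Real.cos t)) t := by
    intro k l t
    refine ((((hs t).fun_pow 2).const_mul k).fun_add (((hc t).fun_pow 2).const_mul l)).congr_deriv ?_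
    push_cast
    ring
  have hβ' : β * q 1 ^ 2 = q 0 ^ 4 := by
    rw [hβ]
    field_simp
  have hsum := Real.sin_sq_add_cos_sq
  rw [e, scalarCurvature_expBlock (Δ := q 0 ^ 4) (by positivity) (by positivity)
    (hsq β (q 1 ^ 2)) (hsc (2 * (q 1 ^ 2 - β))) (hsc (β - q 1 ^ 2)) (hcs (β - q 1 ^ 2))
    (hsq' β (q 1 ^ 2)) (hsc (2 * (β - q 1 ^ 2)))
    (fun t => by
      linear_combination hβ' + β * q 1 ^ 2 * (Real.sin t ^ 2 + Real.cos t ^ 2 + 1) * hsum t)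
    (fun t => by ring) (fun t => by ring)]
  have h3 : 2 * (q 1 ^ 2 - β) * (Real.sin (x 0) * Real.cos (x 0))
      * (2 * (β - q 1 ^ 2) * (Real.sin (x 0) * Real.cos (x 0)))
      - ((β - q 1 ^ 2) * (Real.cos (x 0) ^ 2 - Real.sin (x 0) ^ 2)) ^ 2
      = -(β - q 1 ^ 2) ^ 2 := by
    linear_combination -(β - q 1 ^ 2) ^ 2 * (Real.sin (x 0) ^ 2 + Real.cos (x 0) ^ 2 + 1)
      * hsum (x 0)
  rw [h3, hβ]
  field_simp
  ring

lemma scalarCurvature_III (hL : 0 < L) (hq : q ∈ quadrant) {x : Fin 3 → ℝ} (hx : x ∈ III.chart) :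
    scalarCurvature (III.spatialMetric L q) x = -(2 / (L ^ 2 * q 1 ^ 2)) := by
  have ha := hq.1
  have hb := hq.2
  have e : III.spatialMetric L q = fun y => !![q 0 ^ 2, 0, 0; 0, L ^ 2 * q 1 ^ 2, 0;
      0, 0, L ^ 2 * q 1 ^ 2 * Real.sinh (y 1) ^ 2] := by
    ext y i j
    fin_cases i <;> fin_cases j <;>
      simp [spatialMetric, triad, internalMetric, Matrix.mul_apply, Fin.sum_univ_three,
        Matrix.diagonal] <;> ring
  have hs := Real.hasDerivAt_sinh
  have hc := Real.hasDerivAt_cosh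
  have hpos : ∀ t ∈ Set.Ioi (0 : ℝ), 0 < Real.sinh t := fun t ht => Real.sinh_pos_iff.2 ht
  have hx0 := hpos (x 1) hx
  have h1 : ∀ t, HasDerivAt (fun t => L ^ 2 * q 1 ^ 2 * Real.sinh t ^ 2)
      (2 * L ^ 2 * q 1 ^ 2 * (Real.sinh t * Real.cosh t)) t := by
    intro t
    refine (((hs t).fun_pow 2).const_mul (L ^ 2 * q 1 ^ 2)).congr_deriv ?_
    push_cast
    ring
  have h2 : ∀ t, HasDerivAt (fun t => 2 * L ^ 2 * q 1 ^ 2 * (Real.sinh t * Real.cosh t))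
      (2 * L ^ 2 * q 1 ^ 2 * (Real.cosh t ^ 2 + Real.sinh t ^ 2)) t := by
    intro t
    refine (((hs t).fun_mul (hc t)).const_mul (2 * L ^ 2 * q 1 ^ 2)).congr_deriv ?_
    ring
  rw [e, scalarCurvature_block_one (U := Set.Ioi 0) isOpen_Ioi (by positivity)
    (fun t => hasDerivAt_const t _) (fun t => hasDerivAt_const t _)
    (fun t => hasDerivAt_const t _) (fun t => hasDerivAt_const t _) h1 h2
    (fun t ht => by have := hpos t ht; rw [zero_pow two_ne_zero, sub_zero]; positivity) hx]
  rw [blockCurvature, zero_pow two_ne_zero, sub_zero]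
  field_simp
  ring

lemma scalarCurvature_KS (hL : 0 < L) (hq : q ∈ quadrant) {x : Fin 3 → ℝ} (hx : x ∈ KS.chart) :
    scalarCurvature (KS.spatialMetric L q) x = 2 / (L ^ 2 * q 1 ^ 2) := by
  have ha := hq.1
  have hb := hq.2
  have e : KS.spatialMetric L q = fun y => !![q 0 ^ 2, 0, 0; 0, L ^ 2 * q 1 ^ 2, 0;
      0, 0, L ^ 2 * q 1 ^ 2 * Real.sin (y 1) ^ 2] := by
    ext y i j
    fin_cases i <;> fin_cases j <;>
      simp [spatialMetric, triad, internalMetric, Matrix.mul_apply, Fin.sum_univ_three,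
        Matrix.diagonal] <;> ring
  have hs := Real.hasDerivAt_sin
  have hc := Real.hasDerivAt_cos
  have hpos : ∀ t ∈ Set.Ioo 0 Real.pi, 0 < Real.sin t := fun t ht => Real.sin_pos_of_mem_Ioo ht
  have hx0 := hpos (x 1) hx
  have h1 : ∀ t, HasDerivAt (fun t => L ^ 2 * q 1 ^ 2 * Real.sin t ^ 2)
      (2 * L ^ 2 * q 1 ^ 2 * (Real.sin t * Real.cos t)) t := by
    intro t
    refine (((hs t).fun_pow 2).const_mul (L ^ 2 * q 1 ^ 2)).congr_deriv ?_
    push_cast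
    ring
  have h2 : ∀ t, HasDerivAt (fun t => 2 * L ^ 2 * q 1 ^ 2 * (Real.sin t * Real.cos t))
      (2 * L ^ 2 * q 1 ^ 2 * (Real.cos t ^ 2 - Real.sin t ^ 2)) t := by
    intro t
    refine (((hs t).fun_mul (hc t)).const_mul (2 * L ^ 2 * q 1 ^ 2)).congr_deriv ?_
    ring
  rw [e, scalarCurvature_block_one (U := Set.Ioo 0 Real.pi) isOpen_Ioo (by positivity)
    (fun t => hasDerivAt_const t _) (fun t => hasDerivAt_const t _)
    (fun t => hasDerivAt_const t _) (fun t => hasDerivAt_const t _) h1 h2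
    (fun t ht => by have := hpos t ht; rw [zero_pow two_ne_zero, sub_zero]; positivity) hx]
  rw [blockCurvature, zero_pow two_ne_zero, sub_zero]
  field_simp
  ring

lemma scalarCurvature_VIII (hL : 0 < L) (hq : q ∈ quadrant) {x : Fin 3 → ℝ}
    (hx : x ∈ VIII.chart) :
    scalarCurvature (VIII.spatialMetric L q) x
      = -(2 / (L ^ 2 * q 1 ^ 2)) - q 0 ^ 2 / (2 * L ^ 2 * q 1 ^ 4) := by
  have ha := hq.1
  have hb := hq.2
  have e : VIII.spatialMetric L q = fun y => !![q 0 ^ 2, 0, L * q 0 ^ 2 * Real.cosh (y 1);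
      0, L ^ 2 * q 1 ^ 2, 0;
      L * q 0 ^ 2 * Real.cosh (y 1), 0,
        L ^ 2 * (q 0 ^ 2 * Real.cosh (y 1) ^ 2 + q 1 ^ 2 * Real.sinh (y 1) ^ 2)] := by
    ext y i j
    fin_cases i <;> fin_cases j <;>
      simp [spatialMetric, triad, internalMetric, Matrix.mul_apply, Fin.sum_univ_three,
        Matrix.diagonal] <;> ring
  have hs := Real.hasDerivAt_sinh
  have hc := Real.hasDerivAt_cosh
  have hpos : ∀ t ∈ Set.Ioi (0 : ℝ), 0 < Real.sinh t := fun t ht => Real.sinh_pos_iff.2 ht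
  have hx0 := hpos (x 1) hx
  have hdet : ∀ t, q 0 ^ 2 * (L ^ 2 * (q 0 ^ 2 * Real.cosh t ^ 2 + q 1 ^ 2 * Real.sinh t ^ 2))
      - (L * q 0 ^ 2 * Real.cosh t) ^ 2 = L ^ 2 * q 0 ^ 2 * q 1 ^ 2 * Real.sinh t ^ 2 :=
    fun t => by ring
  have h1 : ∀ t, HasDerivAt
      (fun t => L ^ 2 * (q 0 ^ 2 * Real.cosh t ^ 2 + q 1 ^ 2 * Real.sinh t ^ 2))
      (2 * L ^ 2 * (q 0 ^ 2 + q 1 ^ 2) * (Real.sinh t * Real.cosh t)) t := by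
    intro t
    refine (((((hc t).fun_pow 2).const_mul (q 0 ^ 2)).fun_add
      (((hs t).fun_pow 2).const_mul (q 1 ^ 2))).const_mul (L ^ 2)).congr_deriv ?_
    push_cast
    ring
  have h2 : ∀ t, HasDerivAt
      (fun t => 2 * L ^ 2 * (q 0 ^ 2 + q 1 ^ 2) * (Real.sinh t * Real.cosh t))
      (2 * L ^ 2 * (q 0 ^ 2 + q 1 ^ 2) * (Real.cosh t ^ 2 + Real.sinh t ^ 2)) t := by
    intro t
    refine (((hs t).fun_mul (hc t)).const_mul (2 * L ^ 2 * (q 0 ^ 2 + q 1 ^ 2))).congr_deriv ?_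
    ring
  rw [e, scalarCurvature_block_one (U := Set.Ioi 0) isOpen_Ioi (by positivity)
    (fun t => hasDerivAt_const t _) (fun t => hasDerivAt_const t _)
    (fun t => (hc t).const_mul _) (fun t => (hs t).const_mul _) h1 h2
    (fun t ht => by have := hpos t ht; rw [hdet]; positivity) hx]
  rw [blockCurvature, hdet]
  field_simp
  ring

lemma scalarCurvature_IX (hL : 0 < L) (hq : q ∈ quadrant) {x : Fin 3 → ℝ} (hx : x ∈ IX.chart) :
    scalarCurvature (IX.spatialMetric L q) x
      = 2 / (L ^ 2 * q 1 ^ 2) - q 0 ^ 2 / (2 * L ^ 2 * q 1 ^ 4) := by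
  have ha := hq.1
  have hb := hq.2
  have e : IX.spatialMetric L q = fun y => !![q 0 ^ 2, 0, L * q 0 ^ 2 * Real.cos (y 1);
      0, L ^ 2 * q 1 ^ 2, 0;
      L * q 0 ^ 2 * Real.cos (y 1), 0,
        L ^ 2 * (q 0 ^ 2 * Real.cos (y 1) ^ 2 + q 1 ^ 2 * Real.sin (y 1) ^ 2)] := by
    ext y i j
    fin_cases i <;> fin_cases j <;>
      simp [spatialMetric, triad, internalMetric, Matrix.mul_apply, Fin.sum_univ_three,
        Matrix.diagonal] <;> ring
  have hs := Real.hasDerivAt_sin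
  have hc := Real.hasDerivAt_cos
  have hpos : ∀ t ∈ Set.Ioo 0 Real.pi, 0 < Real.sin t := fun t ht => Real.sin_pos_of_mem_Ioo ht
  have hx0 := hpos (x 1) hx
  have hdet : ∀ t, q 0 ^ 2 * (L ^ 2 * (q 0 ^ 2 * Real.cos t ^ 2 + q 1 ^ 2 * Real.sin t ^ 2))
      - (L * q 0 ^ 2 * Real.cos t) ^ 2 = L ^ 2 * q 0 ^ 2 * q 1 ^ 2 * Real.sin t ^ 2 :=
    fun t => by ring
  have h1 : ∀ t, HasDerivAt
      (fun t => L ^ 2 * (q 0 ^ 2 * Real.cos t ^ 2 + q 1 ^ 2 * Real.sin t ^ 2))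
      (2 * L ^ 2 * (q 1 ^ 2 - q 0 ^ 2) * (Real.sin t * Real.cos t)) t := by
    intro t
    refine (((((hc t).fun_pow 2).const_mul (q 0 ^ 2)).fun_add
      (((hs t).fun_pow 2).const_mul (q 1 ^ 2))).const_mul (L ^ 2)).congr_deriv ?_
    push_cast
    ring
  have h2 : ∀ t, HasDerivAt
      (fun t => 2 * L ^ 2 * (q 1 ^ 2 - q 0 ^ 2) * (Real.sin t * Real.cos t))
      (2 * L ^ 2 * (q 1 ^ 2 - q 0 ^ 2) * (Real.cos t ^ 2 - Real.sin t ^ 2)) t := by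
    intro t
    refine (((hs t).fun_mul (hc t)).const_mul (2 * L ^ 2 * (q 1 ^ 2 - q 0 ^ 2))).congr_deriv ?_
    ring
  rw [e, scalarCurvature_block_one (U := Set.Ioo 0 Real.pi) isOpen_Ioo (by positivity)
    (fun t => hasDerivAt_const t _) (fun t => hasDerivAt_const t _)
    (fun t => (hc t).const_mul _) (fun t => (hs t).fun_neg.const_mul _) h1 h2
    (fun t ht => by have := hpos t ht; rw [hdet]; positivity) hx]
  rw [blockCurvature, hdet]
  field_simp
  ring

end Model

/-! ### The reduced action in null coordinates -/

namespace Model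

variable {M : Model} {L G σ : ℝ} {cell : Set (Fin 3 → ℝ)} {q : Fin 2 → ℝ}

/-- With `l ρ i` the logarithmic derivative of the `i`-th entry, `γ⁻¹ ∂_ρ γ` is the diagonal matrix
of the `l ρ i` and the traces become sums. -/
lemma supermetric_of_diagonal {g : (Fin 2 → ℝ) → Fin 3 → ℝ}
    (hg : ∀ y, M.internalMetric y = Matrix.diagonal (g y)) (h0 : ∀ i, g q i ≠ 0)
    {l : Fin 2 → Fin 3 → ℝ} (hl : ∀ ρ i, pd ρ (fun y => g y i) q = g q i * l ρ i) (μ ν : Fin 2) :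
    M.supermetric L G cell q μ ν = -(M.fiducialVolume L cell / (2 * G)) * √(∏ i, g q i)
      * ((∑ i, l μ i) * (∑ i, l ν i) - ∑ i, l μ i * l ν i) := by
  have hinv : (Matrix.diagonal (g q))⁻¹ = Matrix.diagonal fun i => (g q i)⁻¹ := by
    refine Matrix.inv_eq_right_inv ?_
    rw [Matrix.diagonal_mul_diagonal, ← Matrix.diagonal_one]
    congr 1
    ext i
    exact mul_inv_cancel₀ (h0 i)
  have hd : ∀ ρ, (Matrix.of fun i j => pd ρ (fun y => Matrix.diagonal (g y) i j) q)
      = Matrix.diagonal fun i => g q i * l ρ i := by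
    intro ρ
    ext i j
    by_cases hij : i = j
    · subst hij
      simp [hl]
    · simp [Matrix.diagonal_apply_ne _ hij]
  simp only [supermetric, hg, hinv, hd, Matrix.diagonal_mul_diagonal, Matrix.trace_diagonal,
    Matrix.det_diagonal, Matrix.of_apply, inv_mul_cancel_left₀ (h0 _)]

lemma pd_pow_coord (μ i : Fin 2) (n : ℕ) (q : Fin 2 → ℝ) :
    pd μ (fun y => y i ^ n) q = if μ = i then n * q i ^ (n - 1) else 0 :=
  pd_comp_coord μ i (hasDerivAt_pow n (q i))

lemma supermetric_axisymmetric
    (hM : ∀ y, M.internalMetric y = Matrix.diagonal ![y 0 ^ 2, y 1 ^ 2, y 1 ^ 2])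
    (hq : q ∈ quadrant) :
    M.supermetric L G cell q = -(M.fiducialVolume L cell / G) • !![0, 4 * q 1; 4 * q 1, 4 * q 0] := by
  have ha := hq.1
  have hb := hq.2
  have hs : √(q 0 ^ 2 * (q 1 ^ 2 * q 1 ^ 2)) = q 0 * q 1 ^ 2 := by
    rw [show q 0 ^ 2 * (q 1 ^ 2 * q 1 ^ 2) = (q 0 * q 1 ^ 2) ^ 2 by ring]
    exact Real.sqrt_sq (by positivity)
  ext μ ν
  rw [supermetric_of_diagonal hM (l := ![![2 / q 0, 0, 0], ![0, 2 / q 1, 2 / q 1]])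
    (fun i => by fin_cases i <;> simp <;> positivity)
    (fun ρ i => by
      fin_cases ρ <;> fin_cases i <;> simp [pd_pow_coord] <;> field_simp)]
  simp only [Fin.prod_univ_succ, Fin.sum_univ_succ]
  fin_cases μ <;> fin_cases ν <;> simp [hs] <;> field_simp <;> ring

lemma supermetric_tilted
    (hM : ∀ y, M.internalMetric y = Matrix.diagonal ![y 0 ^ 2, y 0 ^ 4 / y 1 ^ 2, y 1 ^ 2])
    (hq : q ∈ quadrant) :
    M.supermetric L G cell q = -(M.fiducialVolume L cell / G) •
      !![8 * q 0, 4 * q 0 ^ 2 / q 1; 4 * q 0 ^ 2 / q 1, -(4 * q 0 ^ 3 / q 1 ^ 2)] := by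
  have ha := hq.1
  have hb := hq.2
  have hs : √(q 0 ^ 2 * (q 0 ^ 4 / q 1 ^ 2 * q 1 ^ 2)) = q 0 ^ 3 := by
    rw [show q 0 ^ 2 * (q 0 ^ 4 / q 1 ^ 2 * q 1 ^ 2) = (q 0 ^ 3) ^ 2 by field_simp]
    exact Real.sqrt_sq (by positivity)
  have p0 : pd 0 (fun y => y 0 ^ 4 / y 1 ^ 2) q = q 0 ^ 4 / q 1 ^ 2 * (4 / q 0) := by
    have h1 : HasDerivAt (fun s : ℝ => s ^ 4 / q 1 ^ 2) (4 * q 0 ^ 3 / q 1 ^ 2) (q 0) := by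
      simpa using (hasDerivAt_pow 4 (q 0)).div_const (q 1 ^ 2)
    rw [pd]
    simp only [Function.update_self, Function.update_of_ne one_ne_zero]
    rw [h1.deriv]
    field_simp
  have p1 : pd 1 (fun y => y 0 ^ 4 / y 1 ^ 2) q = q 0 ^ 4 / q 1 ^ 2 * (-2 / q 1) := by
    have h1 : HasDerivAt (fun s : ℝ => q 0 ^ 4 / s ^ 2)
        ((0 * q 1 ^ 2 - q 0 ^ 4 * (2 * q 1)) / (q 1 ^ 2) ^ 2) (q 1) := by
      simpa using (hasDerivAt_const (q 1) (q 0 ^ 4)).fun_div (hasDerivAt_pow 2 (q 1))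
        (by positivity)
    rw [pd]
    simp only [Function.update_self, Function.update_of_ne zero_ne_one]
    rw [h1.deriv]
    field_simp
    ring
  ext μ ν
  rw [supermetric_of_diagonal hM (l := ![![2 / q 0, 4 / q 0, 0], ![0, -2 / q 1, 2 / q 1]])
    (fun i => by fin_cases i <;> simp <;> first | positivity | exact ⟨ha.ne', hb.ne'⟩)
    (fun ρ i => by
      fin_cases ρ <;> fin_cases i <;> simp [pd_pow_coord, p0, p1] <;> field_simp)]
  simp only [Fin.prod_univ_succ, Fin.sum_univ_succ]
  fin_cases μ <;> fin_cases ν <;> simp [hs] <;> field_simp <;> ring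

lemma pd_mono_symm {K K' α β γ δ : ℝ} (hq : q ∈ quadrant) :
    let B : Fin 2 → Fin 2 → ℝ := fun μ ν =>
      pd μ (fun y => K * mono α β y) q * pd ν (fun y => K' * mono γ δ y) q
        + pd ν (fun y => K * mono α β y) q * pd μ (fun y => K' * mono γ δ y) q
    let k := K * K' * mono (α + γ) (β + δ) q
    B 0 0 = k * (2 * α * γ) / q 0 ^ 2 ∧ B 0 1 = k * (α * δ + β * γ) / (q 0 * q 1) ∧
      B 1 0 = k * (α * δ + β * γ) / (q 0 * q 1) ∧ B 1 1 = k * (2 * β * δ) / q 1 ^ 2 := by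
  have ha := hq.1.ne'
  have hb := hq.2.ne'
  simp only [pd_const_mul, pd_zero_mono hq, pd_one_mono hq, ← mono_mul hq]
  refine ⟨?_, ?_, ?_, ?_⟩ <;> field_simp <;> ring

lemma nullU_of_axisymmetric {q : Fin 2 → ℝ} :
    2 * σ * √2 / √3 * (q 0 * √(q 1)) = 2 * σ * √2 / √3 * mono 1 (1 / 2) q := by
  rw [mono, Real.rpow_one, Real.sqrt_eq_rpow (q 1)]

lemma nullV_of_axisymmetric {q : Fin 2 → ℝ} :
    2 * √2 / (σ * √3) * q 1 ^ (3 / 2 : ℝ) = 2 * √2 / (σ * √3) * mono 0 (3 / 2) q := by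
  rw [mono, Real.rpow_zero, one_mul]

lemma null_const_mul (hσ : 0 < σ) :
    2 * σ * √2 / √3 * (2 * √2 / (σ * √3)) = 8 / 3 := by
  have h2 : √2 ^ 2 = 2 := Real.sq_sqrt (by norm_num)
  have h3 : √3 ^ 2 = 3 := Real.sq_sqrt (by norm_num)
  have : √3 ≠ 0 := by positivity
  field_simp
  rw [h2, h3]
  norm_num

/-- In the null coordinates, the field space metric is that of two free null directions. -/
def HasNullMetric (M : Model) (L G σ : ℝ) (cell : Set (Fin 3 → ℝ)) (q : Fin 2 → ℝ) : Prop :=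
  ∀ μ ν, M.supermetric L G cell q μ ν = -(M.fiducialVolume L cell / G) *
    (pd μ (M.nullU σ) q * pd ν (M.nullV σ) q + pd ν (M.nullU σ) q * pd μ (M.nullV σ) q)

lemma hasNullMetric_axisymmetric (hσ : 0 < σ)
    (hM : ∀ y, M.internalMetric y = Matrix.diagonal ![y 0 ^ 2, y 1 ^ 2, y 1 ^ 2])
    (hU : M.nullU σ = fun q => 2 * σ * √2 / √3 * mono 1 (1 / 2) q)
    (hV : M.nullV σ = fun q => 2 * √2 / (σ * √3) * mono 0 (3 / 2) q)
    (hq : q ∈ quadrant) : M.HasNullMetric L G σ cell q := by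
  have ha := hq.1.ne'
  have hb := hq.2.ne'
  obtain ⟨b00, b01, b10, b11⟩ := pd_mono_symm (K := 2 * σ * √2 / √3) (K' := 2 * √2 / (σ * √3))
    (α := 1) (β := 1 / 2) (γ := 0) (δ := 3 / 2) hq
  have hm : mono (1 + 0) (1 / 2 + 3 / 2) q = q 0 * q 1 ^ 2 := by
    norm_num [mono]
  rw [null_const_mul hσ, hm] at b00 b01 b10 b11
  intro μ ν
  rw [supermetric_axisymmetric hM hq, hU, hV, Matrix.smul_apply, smul_eq_mul]
  congr 1
  symm
  fin_cases μ <;> fin_cases ν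
  exacts [b00.trans (by simp), b01.trans (by field_simp; norm_num : _ = 4 * q 1),
    b10.trans (by field_simp; norm_num : _ = 4 * q 1),
    b11.trans (by field_simp; norm_num : _ = 4 * q 0)]

/-- In logarithmic coordinates the kinetic form is proportional to `2x² + 2xy - y²`; its two real
linear factors are the source of the `√3` in the exponents. -/
lemma hasNullMetric_tilted (hσ : 0 < σ)
    (hM : ∀ y, M.internalMetric y = Matrix.diagonal ![y 0 ^ 2, y 0 ^ 4 / y 1 ^ 2, y 1 ^ 2])
    (hU : M.nullU σ = fun q => 2 * σ * √2 / √3 * mono ((3 + √3) / 2) (-(√3 / 2)) q)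
    (hV : M.nullV σ = fun q => 2 * √2 / (σ * √3) * mono ((3 - √3) / 2) (√3 / 2) q)
    (hq : q ∈ quadrant) : M.HasNullMetric L G σ cell q := by
  have ha := hq.1.ne'
  have hb := hq.2.ne'
  have h3 : √3 ^ 2 = 3 := Real.sq_sqrt (by norm_num)
  obtain ⟨b00, b01, b10, b11⟩ := pd_mono_symm (K := 2 * σ * √2 / √3) (K' := 2 * √2 / (σ * √3))
    (α := (3 + √3) / 2) (β := -(√3 / 2)) (γ := (3 - √3) / 2) (δ := √3 / 2) hq
  have hm : mono ((3 + √3) / 2 + (3 - √3) / 2) (-(√3 / 2) + √3 / 2) q = q 0 ^ 3 := by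
    rw [mono, show (3 + √3) / 2 + (3 - √3) / 2 = (3 : ℕ) by push_cast; ring, neg_add_cancel,
      Real.rpow_zero, mul_one, Real.rpow_natCast]
  have e1 : 2 * ((3 + √3) / 2) * ((3 - √3) / 2) = 3 := by linear_combination (-1 / 2) * h3
  have e2 : (3 + √3) / 2 * (√3 / 2) + -(√3 / 2) * ((3 - √3) / 2) = 3 / 2 := by
    linear_combination (1 / 2) * h3
  have e3 : 2 * -(√3 / 2) * (√3 / 2) = -(3 / 2) := by linear_combination (-1 / 2) * h3
  rw [null_const_mul hσ, hm] at b00 b01 b10 b11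
  rw [e1] at b00
  rw [e2] at b01 b10
  rw [e3] at b11
  intro μ ν
  rw [supermetric_tilted hM hq, hU, hV, Matrix.smul_apply, smul_eq_mul]
  congr 1
  symm
  fin_cases μ <;> fin_cases ν
  exacts [b00.trans (by field_simp : _ = 8 * q 0),
    b01.trans (by field_simp; norm_num : _ = 4 * q 0 ^ 2 / q 1),
    b10.trans (by field_simp; norm_num : _ = 4 * q 0 ^ 2 / q 1),
    b11.trans (by field_simp; norm_num : _ = -(4 * q 0 ^ 3 / q 1 ^ 2))]

lemma hasNullMetric (M : Model) (hσ : 0 < σ) (hq : q ∈ quadrant) :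
    M.HasNullMetric L G σ cell q := by
  cases M with
  | III | VI0 | VIII | IX | KS =>
    exact hasNullMetric_axisymmetric hσ (fun _ => rfl) (funext fun _ => nullU_of_axisymmetric)
      (funext fun _ => nullV_of_axisymmetric) hq
  | IV | V | VII _ => exact hasNullMetric_tilted hσ (fun _ => rfl) rfl rfl hq

end Model

/-! ### Monomial changes of coordinates -/

namespace ChartMap

variable {D D' D'' : Set (Fin 2 → ℝ)} {Φ Ψ Φ' Ψ' : (Fin 2 → ℝ) → Fin 2 → ℝ}

lemma trans (h : ChartMap D D' Φ Ψ) (h' : ChartMap D' D'' Φ' Ψ') :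
    ChartMap D D'' (fun q => Φ' (Φ q)) (fun q => Ψ (Ψ' q)) where
  isOpen := h.isOpen
  isOpen' := h'.isOpen'
  mapsTo q hq := h'.mapsTo _ (h.mapsTo q hq)
  mapsTo' q hq := h.mapsTo' _ (h'.mapsTo' q hq)
  leftInv q hq := by rw [h'.leftInv _ (h.mapsTo q hq), h.leftInv q hq]
  rightInv q hq := by rw [h.rightInv _ (h'.mapsTo' q hq), h'.rightInv q hq]
  smooth := h'.smooth.comp h.smooth h.mapsTo
  smooth' := h.smooth'.comp h'.smooth' h'.mapsTo'

lemma restrict (h : ChartMap D D' Φ Ψ) {B : Set (Fin 2 → ℝ)} (hB : IsOpen B) (hBD : B ⊆ D) :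
    ChartMap B (D' ∩ Ψ ⁻¹' B) Φ Ψ where
  isOpen := hB
  isOpen' := h.smooth'.continuousOn.isOpen_inter_preimage h.isOpen' hB
  mapsTo q hq := ⟨h.mapsTo q (hBD hq), by rwa [Set.mem_preimage, h.leftInv q (hBD hq)]⟩
  mapsTo' _ hq := hq.2
  leftInv q hq := h.leftInv q (hBD hq)
  rightInv q hq := h.rightInv q hq.1
  smooth := h.smooth.mono hBD
  smooth' := h.smooth'.mono Set.inter_subset_left

lemma congr (h : ChartMap D D' Φ Ψ) (e : ∀ q ∈ D, Φ' q = Φ q) : ChartMap D D' Φ' Ψ where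
  isOpen := h.isOpen
  isOpen' := h.isOpen'
  mapsTo q hq := e q hq ▸ h.mapsTo q hq
  mapsTo' := h.mapsTo'
  leftInv q hq := by rw [e q hq, h.leftInv q hq]
  rightInv q hq := by rw [e _ (h.mapsTo' q hq), h.rightInv q hq]
  smooth := h.smooth.congr e
  smooth' := h.smooth'

end ChartMap

lemma mono_mono (a b α β γ δ : ℝ) {q : Fin 2 → ℝ} (hq : q ∈ quadrant) :
    mono a b ![mono α β q, mono γ δ q] = mono (α * a + γ * b) (β * a + δ * b) q := by
  have h : ∀ s t c : ℝ, mono s t q ^ c = mono (s * c) (t * c) q := fun s t c => by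
    rw [mono, Real.mul_rpow (Real.rpow_nonneg hq.1.le _) (Real.rpow_nonneg hq.2.le _),
      ← Real.rpow_mul hq.1.le, ← Real.rpow_mul hq.2.le, mono]
  rw [← mono_mul hq, ← h, ← h]
  rfl

lemma contDiffOn_vec₂ {f g : (Fin 2 → ℝ) → ℝ} {D : Set (Fin 2 → ℝ)} (hf : ContDiffOn ℝ ∞ f D)
    (hg : ContDiffOn ℝ ∞ g D) : ContDiffOn ℝ ∞ (fun q => ![f q, g q]) D :=
  contDiffOn_pi.2 fun i => by fin_cases i; exacts [hf, hg]

lemma contDiff_coord (i : Fin 2) : ContDiff ℝ ∞ (fun y : Fin 2 → ℝ => y i) :=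
  (ContinuousLinearMap.proj (R := ℝ) (φ := fun _ : Fin 2 => ℝ) i).contDiff

/-- The map with the components `q⁰ ^ α * q¹ ^ β` and `q⁰ ^ γ * q¹ ^ δ`. -/
def powerMap (α β γ δ : ℝ) (q : Fin 2 → ℝ) : Fin 2 → ℝ := ![mono α β q, mono γ δ q]

lemma powerMap_powerMap {α β γ δ a b c d : ℝ} (h₁ : α * a + γ * b = 1) (h₂ : β * a + δ * b = 0)
    (h₃ : α * c + γ * d = 0) (h₄ : β * c + δ * d = 1) {q : Fin 2 → ℝ} (hq : q ∈ quadrant) :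
    powerMap a b c d (powerMap α β γ δ q) = q := by
  rw [powerMap, powerMap, mono_mono a b α β γ δ hq, mono_mono c d α β γ δ hq, h₁, h₂, h₃, h₄]
  ext i
  fin_cases i <;> simp [mono]

lemma powerMap_mem_quadrant (α β γ δ : ℝ) {q : Fin 2 → ℝ} (hq : q ∈ quadrant) :
    powerMap α β γ δ q ∈ quadrant := ⟨mono_pos hq _ _, mono_pos hq _ _⟩

/-- In logarithmic coordinates this map is linear, so its inverse is given by the inverse matrix of
exponents. -/
lemma powerMap_chartMap {α β γ δ : ℝ} (h : α * δ - β * γ ≠ 0) :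
    ChartMap quadrant quadrant (powerMap α β γ δ)
      (powerMap (δ / (α * δ - β * γ)) (-β / (α * δ - β * γ)) (-γ / (α * δ - β * γ))
        (α / (α * δ - β * γ))) where
  isOpen := isOpen_quadrant
  isOpen' := isOpen_quadrant
  mapsTo _ hq := powerMap_mem_quadrant _ _ _ _ hq
  mapsTo' _ hq := powerMap_mem_quadrant _ _ _ _ hq
  leftInv _ hq := powerMap_powerMap (by field_simp; ring) (by field_simp; ring)
    (by field_simp; ring) (by field_simp; ring) hq
  rightInv _ hq := powerMap_powerMap ((by ring : _ = (α * δ - β * γ) / (α * δ - β * γ)).trans (div_self h))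
    (by field_simp; ring)
    (by field_simp; ring) (by field_simp; ring) hq
  smooth := contDiffOn_vec₂ (contDiffOn_mono _ _) (contDiffOn_mono _ _)
  smooth' := contDiffOn_vec₂ (contDiffOn_mono _ _) (contDiffOn_mono _ _)

lemma scaling_chartMap {K K' : ℝ} (hK : 0 < K) (hK' : 0 < K') :
    ChartMap quadrant quadrant (fun q => ![K * q 0, K' * q 1]) (fun q => ![K⁻¹ * q 0, K'⁻¹ * q 1])
    where
  isOpen := isOpen_quadrant
  isOpen' := isOpen_quadrant
  mapsTo _ hq := ⟨mul_pos hK hq.1, mul_pos hK' hq.2⟩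
  mapsTo' _ hq := ⟨mul_pos (inv_pos.2 hK) hq.1, mul_pos (inv_pos.2 hK') hq.2⟩
  leftInv q _ := by
    ext i
    fin_cases i <;> simp [hK.ne', hK'.ne']
  rightInv q _ := by
    ext i
    fin_cases i <;> simp [hK.ne', hK'.ne']
  smooth := contDiffOn_vec₂ (contDiff_const.mul (contDiff_coord 0)).contDiffOn
    (contDiff_const.mul (contDiff_coord 1)).contDiffOn
  smooth' := contDiffOn_vec₂ (contDiff_const.mul (contDiff_coord 0)).contDiffOn
    (contDiff_const.mul (contDiff_coord 1)).contDiffOn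

lemma logPower_chartMap {s : ℝ} (hs : s ≠ 0) :
    ChartMap quadrant {q | 0 < q 1} (fun q => ![Real.log (q 0), q 1 ^ s])
      (fun q => ![Real.exp (q 0), q 1 ^ s⁻¹]) where
  isOpen := isOpen_quadrant
  isOpen' := isOpen_lt continuous_const (continuous_apply 1)
  mapsTo _ hq := Real.rpow_pos_of_pos hq.2 _
  mapsTo' q hq := ⟨Real.exp_pos _, Real.rpow_pos_of_pos hq _⟩
  leftInv q hq := by
    ext i
    fin_cases i
    · exact Real.exp_log hq.1
    · exact Real.rpow_rpow_inv hq.2.le hs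
  rightInv q hq := by
    ext i
    fin_cases i
    · exact Real.log_exp _
    · exact Real.rpow_inv_rpow (le_of_lt hq) hs
  smooth := contDiffOn_vec₂ ((contDiff_coord 0).contDiffOn.log fun q hq => hq.1.ne')
    ((contDiff_coord 1).contDiffOn.rpow_const_of_ne fun q hq => hq.2.ne')
  smooth' := contDiffOn_vec₂ (Real.contDiff_exp.comp (contDiff_coord 0)).contDiffOn
    ((contDiff_coord 1).contDiffOn.rpow_const_of_ne fun q hq => ne_of_gt hq)

/-! ### Reduction to null coordinates -/

/-- Regularity of the original model is deduced from that of `ρ` and `W` through the two identities,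
so nothing is required of `N` itself. -/
lemma transport_nullModel {D D' : Set (Fin 2 → ℝ)} {Φ Ψ : (Fin 2 → ℝ) → Fin 2 → ℝ}
    {S : Mechanics} {N ρ W : (Fin 2 → ℝ) → ℝ} (h : ChartMap D D' Φ Ψ)
    (hρ : ContDiffOn ℝ ∞ ρ D') (h0 : ∀ q ∈ D', ρ q ≠ 0) (hW : ContDiffOn ℝ ∞ W D')
    (hmet : ∀ q ∈ D, ∀ μ ν, S.lapseMetric N q μ ν = ρ (Φ q) *
      (pd μ (fun y => Φ y 0) q * pd ν (fun y => Φ y 1) q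
        + pd ν (fun y => Φ y 0) q * pd μ (fun y => Φ y 1) q))
    (hpot : ∀ q ∈ D, N q * S.potential q = W (Φ q)) :
    Transport D D' Φ Ψ S N (nullModel ρ W) (fun _ => 1) := by
  have hmat : ∀ q ∈ D, S.lapseMetric N q
      = (jac Φ q)ᵀ * (nullModel ρ W).lapseMetric (fun _ => 1) (Φ q) * jac Φ q := by
    intro q hq
    ext μ ν
    rw [hmet q hq, nullModel_lapseMetric]
    simp [Matrix.mul_apply, Fin.sum_univ_two, jac]
    ring
  refine ⟨h, ⟨h.isOpen, fun i j => ?_, fun q hq => ?_, ?_⟩,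
    nullModel_isRegular h.isOpen' hρ hW h0, hmat, fun q hq => by
      rw [hpot q hq, one_mul]
      rfl⟩
  · refine ContDiffOn.congr ?_ fun q hq => hmet q hq i j
    have hj : ∀ α μ, ContDiffOn ℝ ∞ (fun q => pd μ (fun y => Φ y α) q) D := fun α μ q hq =>
      (contDiffAt_pd (h.contDiffAt_apply hq α) μ).contDiffWithinAt
    exact (hρ.comp h.smooth h.mapsTo).mul
      (((hj 0 i).mul (hj 1 j)).add ((hj 0 j).mul (hj 1 i)))
  · have hd : (jac Φ q).det ≠ 0 := fun hd => by
      have h1 := congrArg Matrix.det (h.jac_mul_jac hq)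
      rw [Matrix.det_mul, hd, mul_zero, Matrix.det_one] at h1
      exact zero_ne_one h1
    rw [hmat q hq, Matrix.det_mul, Matrix.det_mul, Matrix.det_transpose]
    exact mul_ne_zero (mul_ne_zero hd
      ((nullModel_isRegular h.isOpen' hρ hW h0).det _ (h.mapsTo q hq))) hd
  · exact (hW.comp h.smooth h.mapsTo).congr fun q hq => hpot q hq

/-- `u^n v^m du dv` is a constant multiple of `d(u^(n+1)) d(v^(m+1))`. -/
lemma powerModel_hasFullAlgebra {r n m : ℝ} (hr : r ≠ 0) (hn : n + 1 ≠ 0) (hm : m + 1 ≠ 0)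
    (κ : ℝ) :
    (nullModel (fun q => r * mono n m q) (fun _ => κ)).HasFullAlgebra quadrant (fun _ => 1) := by
  have hγ : r / ((n + 1) * (m + 1)) ≠ 0 := div_ne_zero hr (mul_ne_zero hn hm)
  refine (transport_nullModel (powerMap_chartMap (α := n + 1) (β := 0) (γ := 0) (δ := m + 1)
    (by simpa using ⟨hn, hm⟩)) contDiffOn_const (fun _ _ => hγ) contDiffOn_const
    (fun q hq μ ν => ?_) (fun q _ => one_mul _)).hasFullAlgebra
    (flat_hasFullAlgebra subset_rfl hγ κ)
  have ha := hq.1.ne'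
  have hb := hq.2.ne'
  have e0 : mono (n + 1) 0 q = q 0 * q 0 ^ n := by
    rw [mono, Real.rpow_zero, mul_one, Real.rpow_add_one ha, mul_comm]
  have e1 : mono 0 (m + 1) q = q 1 * q 1 ^ m := by
    rw [mono, Real.rpow_zero, one_mul, Real.rpow_add_one hb, mul_comm]
  rw [nullModel_lapseMetric]
  have p : ∀ μ : Fin 2, pd μ (mono (n + 1) 0) q = ![(n + 1) * q 0 ^ n, 0] μ ∧
      pd μ (mono 0 (m + 1)) q = ![0, (m + 1) * q 1 ^ m] μ := by
    intro μ
    fin_cases μ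
    · refine ⟨(pd_zero_mono hq _ _).trans ?_, (pd_zero_mono hq _ _).trans ?_⟩
      · rw [e0]
        simp
        field_simp
      · simp
    · refine ⟨(pd_one_mono hq _ _).trans ?_, (pd_one_mono hq _ _).trans ?_⟩
      · simp
      · rw [e1]
        simp
        field_simp
  change _ = _ * (pd μ (mono (n + 1) 0) q * pd ν (mono 0 (m + 1)) q
    + pd ν (mono (n + 1) 0) q * pd μ (mono 0 (m + 1)) q)
  simp only [p]
  fin_cases μ <;> fin_cases ν <;> simp [mono] <;> field_simp

/-- For `n = -1` the flat coordinate is `log u`, because `du / u = d(log u)`. -/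
lemma logModel_hasFullAlgebra {r m : ℝ} (hr : r ≠ 0) (hm : m + 1 ≠ 0) (κ : ℝ) :
    (nullModel (fun q => r * mono (-1) m q) (fun _ => κ)).HasFullAlgebra quadrant
      (fun _ => 1) := by
  have hγ : r / (m + 1) ≠ 0 := div_ne_zero hr hm
  refine (transport_nullModel (logPower_chartMap hm) contDiffOn_const (fun _ _ => hγ)
    contDiffOn_const (fun q hq μ ν => ?_) (fun q _ => one_mul _)).hasFullAlgebra
    (flat_hasFullAlgebra (fun q hq => hq.2) hγ κ)
  have ha := hq.1.ne'
  have hb := hq.2.ne'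
  rw [nullModel_lapseMetric]
  have p : ∀ μ : Fin 2, pd μ (fun y => Real.log (y 0)) q = ![(q 0)⁻¹, 0] μ ∧
      pd μ (fun y => y 1 ^ (m + 1)) q = ![0, (m + 1) * q 1 ^ m] μ := by
    intro μ
    have h2 : HasDerivAt (fun t : ℝ => t ^ (m + 1)) ((m + 1) * q 1 ^ m) (q 1) := by
      simpa using Real.hasDerivAt_rpow_const (p := m + 1) (Or.inl hb)
    rw [pd_comp_coord μ 0 (Real.hasDerivAt_log ha), pd_comp_coord μ 1 h2]
    fin_cases μ <;> simp
  change _ = _ * (pd μ (fun y => Real.log (y 0)) q * pd ν (fun y => y 1 ^ (m + 1)) q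
    + pd ν (fun y => Real.log (y 0)) q * pd μ (fun y => y 1 ^ (m + 1)) q)
  simp only [p]
  fin_cases μ <;> fin_cases ν <;> simp [mono, Real.rpow_neg_one] <;> field_simp

namespace Model

variable {M : Model} {L G σ : ℝ} {cell : Set (Fin 3 → ℝ)} {q : Fin 2 → ℝ}

/-! ### The potential in null coordinates -/

lemma exists_null_eq_mono (M : Model) (hσ : 0 < σ) :
    ∃ K K' α β γ δ : ℝ, 0 < K ∧ 0 < K' ∧ α * δ - β * γ ≠ 0 ∧
      (M.nullU σ = fun q => K * mono α β q) ∧ M.nullV σ = fun q => K' * mono γ δ q := by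
  cases M with
  | III | VI0 | VIII | IX | KS =>
    exact ⟨_, _, _, _, _, _, by positivity, by positivity, by norm_num,
      funext fun _ => nullU_of_axisymmetric, funext fun _ => nullV_of_axisymmetric⟩
  | IV | V | VII _ =>
    refine ⟨_, _, _, _, _, _, by positivity, by positivity, ?_, rfl, rfl⟩
    have : 0 < √3 := by positivity
    rw [show (3 + √3) / 2 * (√3 / 2) - -(√3 / 2) * ((3 - √3) / 2) = 3 / 2 * √3 by ring]
    positivity

lemma monomial_eq_mono {K K' α β γ δ : ℝ} (hK : 0 < K) (hK' : 0 < K')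
    (hU : M.nullU σ = fun q => K * mono α β q) (hV : M.nullV σ = fun q => K' * mono γ δ q)
    (e : ℝ × ℝ) (hq : q ∈ quadrant) :
    M.monomial σ e q
      = K ^ e.1 * K' ^ e.2 * mono (α * e.1 + γ * e.2) (β * e.1 + δ * e.2) q := by
  rw [monomial, hU, hV, Real.mul_rpow hK.le (mono_pos hq _ _).le,
    Real.mul_rpow hK'.le (mono_pos hq _ _).le, ← mono_mono _ _ _ _ _ _ hq]
  simp only [mono, Matrix.cons_val_zero, Matrix.cons_val_one]
  ring

lemma exists_monomial_axisymmetric (hσ : 0 < σ)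
    (hU : M.nullU σ = fun q => 2 * σ * √2 / √3 * mono 1 (1 / 2) q)
    (hV : M.nullV σ = fun q => 2 * √2 / (σ * √3) * mono 0 (3 / 2) q) (e : ℝ × ℝ) :
    ∃ k : ℝ, k ≠ 0 ∧ ∀ q ∈ quadrant,
      mono e.1 (e.1 / 2 + 3 / 2 * e.2) q = k * M.monomial σ e q := by
  have hK : 0 < 2 * σ * √2 / √3 := by positivity
  have hK' : 0 < 2 * √2 / (σ * √3) := by positivity
  have h1 := Real.rpow_pos_of_pos hK e.1
  have h2 := Real.rpow_pos_of_pos hK' e.2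
  refine ⟨((2 * σ * √2 / √3) ^ e.1 * (2 * √2 / (σ * √3)) ^ e.2)⁻¹, by positivity,
    fun q hq => ?_⟩
  rw [monomial_eq_mono hK hK' hU hV e hq, inv_mul_cancel_left₀ (by positivity)]
  congr 1 <;> ring

/-- The family `a^(1+d) b^(-d)` contains all terms of the tilted potentials: `d = 0` gives `a`, `d =
4` gives `a⁵ / b⁴`, and `d = -4` gives `b⁴ / a³`. -/
lemma exists_monomial_tilted (hσ : 0 < σ)
    (hU : M.nullU σ = fun q => 2 * σ * √2 / √3 * mono ((3 + √3) / 2) (-(√3 / 2)) q)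
    (hV : M.nullV σ = fun q => 2 * √2 / (σ * √3) * mono ((3 - √3) / 2) (√3 / 2) q)
    (d : ℝ) :
    ∃ k : ℝ, k ≠ 0 ∧ ∀ q ∈ quadrant,
      mono (1 + d) (-d) q = k * M.monomial σ (1 / 3 + d / √3, 1 / 3 - d / √3) q := by
  have hK : 0 < 2 * σ * √2 / √3 := by positivity
  have hK' : 0 < 2 * √2 / (σ * √3) := by positivity
  have h1 := Real.rpow_pos_of_pos hK (1 / 3 + d / √3)
  have h2 := Real.rpow_pos_of_pos hK' (1 / 3 - d / √3)
  have h3 : √3 ≠ 0 := by positivity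
  refine ⟨((2 * σ * √2 / √3) ^ (1 / 3 + d / √3) * (2 * √2 / (σ * √3)) ^ (1 / 3 - d / √3))⁻¹,
    by positivity, fun q hq => ?_⟩
  rw [monomial_eq_mono hK hK' hU hV _ hq, inv_mul_cancel_left₀ (by positivity)]
  congr 1 <;> field_simp <;> ring

/-- Homogeneity makes the curvature constant over the cell, so the integral factors into the
fiducial volume. -/
lemma reducedPotential_of_curvature {R : ℝ} (hcell : M.IsCell L cell)
    (h : ∀ x ∈ M.chart, scalarCurvature (M.spatialMetric L q) x = R) :
    M.reducedPotential L G cell q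
      = -(M.fiducialVolume L cell / G) * (√(M.internalMetric q).det * R) := by
  have h1 : ∫ x in cell, |(M.triad L x).det| * √(M.internalMetric q).det
        * scalarCurvature (M.spatialMetric L q) x
      = (∫ x in cell, |(M.triad L x).det|) * (√(M.internalMetric q).det * R) := by
    rw [← integral_mul_const]
    refine setIntegral_congr_fun hcell.1 fun x hx => ?_
    simp only [h x (hcell.2.1 hx), mul_assoc]
  rw [reducedPotential, h1, fiducialVolume]
  by_cases hG : G = 0
  · simp [hG]
  · have := Real.pi_ne_zero
    field_simp

lemma sqrt_det_axisymmetric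
    (hM : M.internalMetric q = Matrix.diagonal ![q 0 ^ 2, q 1 ^ 2, q 1 ^ 2])
    (hq : q ∈ quadrant) : √(M.internalMetric q).det = q 0 * q 1 ^ 2 := by
  have ha := hq.1
  have hb := hq.2
  rw [hM, Matrix.det_diagonal]
  simp only [Fin.prod_univ_succ]
  simp
  rw [show q 0 ^ 2 * (q 1 ^ 2 * q 1 ^ 2) = (q 0 * q 1 ^ 2) ^ 2 by ring]
  exact Real.sqrt_sq (by positivity)

lemma sqrt_det_tilted
    (hM : M.internalMetric q = Matrix.diagonal ![q 0 ^ 2, q 0 ^ 4 / q 1 ^ 2, q 1 ^ 2])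
    (hq : q ∈ quadrant) : √(M.internalMetric q).det = q 0 ^ 3 := by
  have ha := hq.1
  have hb := hq.2
  rw [hM, Matrix.det_diagonal]
  simp only [Fin.prod_univ_succ]
  simp
  rw [show q 0 ^ 2 * (q 0 ^ 4 / q 1 ^ 2 * q 1 ^ 2) = (q 0 ^ 3) ^ 2 by field_simp]
  exact Real.sqrt_sq (by positivity)

lemma mono_intCast (n m : ℤ) (q : Fin 2 → ℝ) : mono n m q = q 0 ^ n * q 1 ^ m := by
  simp [mono, Real.rpow_intCast]

/-- The potential is a combination of the monomials of the model with nonzero coefficients. -/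
def HasMonomialPotential (M : Model) (L G σ : ℝ) (cell : Set (Fin 3 → ℝ)) : Prop :=
  ∃ c : ℝ × ℝ → ℝ, (∀ e ∈ M.exponents, c e ≠ 0) ∧ ∀ q ∈ quadrant,
    M.reducedPotential L G cell q = (M.exponents.map fun e => c e * M.monomial σ e q).sum

lemma fiducialVolume_pos (hcell : M.IsCell L cell) : 0 < M.fiducialVolume L cell :=
  mul_pos (by have := Real.pi_pos; positivity) hcell.2.2.2

lemma hasMonomialPotential_III (hL : 0 < L) (hG : 0 < G) (hσ : 0 < σ)
    (hcell : III.IsCell L cell) :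
    III.HasMonomialPotential L G σ cell := by
  obtain ⟨k, hk, hm⟩ := exists_monomial_axisymmetric (M := III) hσ
    (funext fun _ => nullU_of_axisymmetric) (funext fun _ => nullV_of_axisymmetric) (1, -1 / 3)
  have hv := fiducialVolume_pos hcell
  refine ⟨fun _ => 2 * III.fiducialVolume L cell / (G * L ^ 2) * k, fun e _ => by positivity,
    fun q hq => ?_⟩
  have ha := hq.1
  have hb := hq.2
  have h1 : q 0 = k * III.monomial σ (1, -1 / 3) q := by
    rw [← hm q hq]
    norm_num [mono]
  rw [reducedPotential_of_curvature hcell fun x hx => scalarCurvature_III hL hq hx,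
    sqrt_det_axisymmetric rfl hq]
  simp only [exponents, List.map_cons, List.map_nil, List.sum_cons, List.sum_nil, add_zero]
  trans 2 * III.fiducialVolume L cell / (G * L ^ 2) * q 0
  · field_simp
  · linear_combination 2 * III.fiducialVolume L cell / (G * L ^ 2) * h1

lemma hasMonomialPotential_KS (hL : 0 < L) (hG : 0 < G) (hσ : 0 < σ)
    (hcell : KS.IsCell L cell) :
    KS.HasMonomialPotential L G σ cell := by
  obtain ⟨k, hk, hm⟩ := exists_monomial_axisymmetric (M := KS) hσ
    (funext fun _ => nullU_of_axisymmetric) (funext fun _ => nullV_of_axisymmetric) (1, -1 / 3)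
  have hv := fiducialVolume_pos hcell
  refine ⟨fun _ => -(2 * KS.fiducialVolume L cell / (G * L ^ 2)) * k,
    fun e _ => mul_ne_zero (neg_ne_zero.2 (by positivity)) hk, fun q hq => ?_⟩
  have ha := hq.1
  have hb := hq.2
  have h1 : q 0 = k * KS.monomial σ (1, -1 / 3) q := by
    rw [← hm q hq]
    norm_num [mono]
  rw [reducedPotential_of_curvature hcell fun x hx => scalarCurvature_KS hL hq hx,
    sqrt_det_axisymmetric rfl hq]
  simp only [exponents, List.map_cons, List.map_nil, List.sum_cons, List.sum_nil, add_zero]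
  trans -(2 * KS.fiducialVolume L cell / (G * L ^ 2)) * q 0
  · field_simp
  · linear_combination -(2 * KS.fiducialVolume L cell / (G * L ^ 2)) * h1

lemma hasMonomialPotential_VI0 (hL : 0 < L) (hG : 0 < G) (hσ : 0 < σ)
    (hcell : VI0.IsCell L cell) :
    VI0.HasMonomialPotential L G σ cell := by
  obtain ⟨k, hk, hm⟩ := exists_monomial_axisymmetric (M := VI0) hσ
    (funext fun _ => nullU_of_axisymmetric) (funext fun _ => nullV_of_axisymmetric) (-1, 5 / 3)
  have hv := fiducialVolume_pos hcell
  refine ⟨fun _ => 2 * VI0.fiducialVolume L cell / (G * L ^ 2) * k, fun e _ => by positivity,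
    fun q hq => ?_⟩
  have ha := hq.1
  have hb := hq.2
  have h1 : q 1 ^ 2 / q 0 = k * VI0.monomial σ (-1, 5 / 3) q := by
    have h2 := mono_intCast (-1) 2 q
    rw [← hm q hq]
    norm_num at h2 ⊢
    rw [h2]
    ring
  rw [reducedPotential_of_curvature hcell fun x hx => scalarCurvature_VI0 hL hq x,
    sqrt_det_axisymmetric rfl hq]
  simp only [exponents, List.map_cons, List.map_nil, List.sum_cons, List.sum_nil, add_zero]
  trans 2 * VI0.fiducialVolume L cell / (G * L ^ 2) * (q 1 ^ 2 / q 0)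
  · field_simp
  · linear_combination 2 * VI0.fiducialVolume L cell / (G * L ^ 2) * h1

/-- VIII and IX differ only by the sign `s = ∓2` of the curvature term in `1 / b²`. -/
lemma hasMonomialPotential_of_two_axisymmetric (hL : 0 < L) (hG : 0 < G) (hσ : 0 < σ) (s : ℝ) (hs : s ≠ 0)
    (hcell : M.IsCell L cell) (hE : M.exponents = [(1, -1 / 3), (3, -7 / 3)])
    (hU : M.nullU σ = fun q => 2 * σ * √2 / √3 * mono 1 (1 / 2) q)
    (hV : M.nullV σ = fun q => 2 * √2 / (σ * √3) * mono 0 (3 / 2) q)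
    (hM : ∀ q, M.internalMetric q = Matrix.diagonal ![q 0 ^ 2, q 1 ^ 2, q 1 ^ 2])
    (hR : ∀ q ∈ quadrant, ∀ x ∈ M.chart, scalarCurvature (M.spatialMetric L q) x
      = s / (L ^ 2 * q 1 ^ 2) - q 0 ^ 2 / (2 * L ^ 2 * q 1 ^ 4)) :
    M.HasMonomialPotential L G σ cell := by
  obtain ⟨k, hk, hm⟩ := exists_monomial_axisymmetric hσ hU hV (1, -1 / 3)
  obtain ⟨k', hk', hm'⟩ := exists_monomial_axisymmetric hσ hU hV (3, -7 / 3)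
  have hv := fiducialVolume_pos hcell
  refine ⟨fun e => M.fiducialVolume L cell / (G * L ^ 2) * if e.1 = 1 then -s * k else k' / 2,
    fun e _ => mul_ne_zero (by positivity) ?_, fun q hq => ?_⟩
  · split_ifs
    exacts [mul_ne_zero (neg_ne_zero.2 hs) hk, by positivity]
  have ha := hq.1
  have hb := hq.2
  have h1 : q 0 = k * M.monomial σ (1, -1 / 3) q := by
    rw [← hm q hq]
    norm_num [mono]
  have h2 : q 0 ^ 3 / q 1 ^ 2 = k' * M.monomial σ (3, -7 / 3) q := by
    have h2 := mono_intCast 3 (-2) q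
    rw [← hm' q hq]
    norm_num at h2 ⊢
    rw [h2]
    ring
  rw [reducedPotential_of_curvature hcell (hR q hq), sqrt_det_axisymmetric (hM q) hq, hE]
  simp only [List.map_cons, List.map_nil, List.sum_cons, List.sum_nil, add_zero, if_true,
    if_neg (show (3 : ℝ) ≠ 1 by norm_num)]
  trans M.fiducialVolume L cell / (G * L ^ 2) * (-s * q 0 + q 0 ^ 3 / q 1 ^ 2 / 2)
  · field_simp
    ring
  · linear_combination M.fiducialVolume L cell / (G * L ^ 2) * (-s * h1 + h2 / 2)

lemma hasMonomialPotential_V (hL : 0 < L) (hG : 0 < G) (hσ : 0 < σ)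
    (hcell : V.IsCell L cell) :
    V.HasMonomialPotential L G σ cell := by
  obtain ⟨k, hk, hm⟩ := exists_monomial_tilted (M := V) hσ rfl rfl 0
  have hv := fiducialVolume_pos hcell
  refine ⟨fun _ => 6 * V.fiducialVolume L cell / (G * L ^ 2) * k, fun e _ => by positivity,
    fun q hq => ?_⟩
  have ha := hq.1
  have hb := hq.2
  have h1 : q 0 = k * V.monomial σ (1 / 3, 1 / 3) q := by
    have := hm q hq
    rw [zero_div, add_zero, sub_zero, add_zero] at this
    rw [← this]
    norm_num [mono]
  rw [reducedPotential_of_curvature hcell fun x hx => scalarCurvature_V hL hq x,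
    sqrt_det_tilted rfl hq]
  simp only [exponents, List.map_cons, List.map_nil, List.sum_cons, List.sum_nil, add_zero]
  trans 6 * V.fiducialVolume L cell / (G * L ^ 2) * q 0
  · field_simp
  · linear_combination 6 * V.fiducialVolume L cell / (G * L ^ 2) * h1

/-- The monomials occurring in the tilted models. -/
lemma exists_monomials_tilted (hσ : 0 < σ)
    (hU : M.nullU σ = fun q => 2 * σ * √2 / √3 * mono ((3 + √3) / 2) (-(√3 / 2)) q)
    (hV : M.nullV σ = fun q => 2 * √2 / (σ * √3) * mono ((3 - √3) / 2) (√3 / 2) q) :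
    ∃ k k₁ k₂ : ℝ, k ≠ 0 ∧ k₁ ≠ 0 ∧ k₂ ≠ 0 ∧ ∀ q ∈ quadrant,
      q 0 = k * M.monomial σ (1 / 3, 1 / 3) q ∧
      q 0 ^ 5 / q 1 ^ 4 = k₁ * M.monomial σ (1 / 3 + 4 / √3, 1 / 3 - 4 / √3) q ∧
      q 1 ^ 4 / q 0 ^ 3 = k₂ * M.monomial σ (1 / 3 - 4 / √3, 1 / 3 + 4 / √3) q := by
  obtain ⟨k, hk, hm⟩ := exists_monomial_tilted hσ hU hV 0
  obtain ⟨k₁, hk₁, hm₁⟩ := exists_monomial_tilted hσ hU hV 4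
  obtain ⟨k₂, hk₂, hm₂⟩ := exists_monomial_tilted hσ hU hV (-4)
  refine ⟨k, k₁, k₂, hk, hk₁, hk₂, fun q hq => ⟨?_, ?_, ?_⟩⟩
  · have := hm q hq
    rw [zero_div, add_zero, sub_zero, add_zero] at this
    rw [← this]
    norm_num [mono]
  · have h2 := mono_intCast 5 (-4) q
    rw [← hm₁ q hq]
    norm_num at h2 ⊢
    rw [h2]
    ring
  · have h2 := mono_intCast (-3) 4 q
    have h3 := hm₂ q hq
    rw [show (1 / 3 + -4 / √3 : ℝ) = 1 / 3 - 4 / √3 by ring,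
      show (1 / 3 - -4 / √3 : ℝ) = 1 / 3 + 4 / √3 by ring] at h3
    rw [← h3]
    norm_num at h2 ⊢
    rw [h2]
    ring

lemma hasMonomialPotential_IV (hL : 0 < L) (hG : 0 < G) (hσ : 0 < σ)
    (hcell : IV.IsCell L cell) :
    IV.HasMonomialPotential L G σ cell := by
  obtain ⟨k, k₁, k₂, hk, -, hk₂, hm⟩ :=
    exists_monomials_tilted (M := IV) hσ rfl rfl
  have hv := fiducialVolume_pos hcell
  refine ⟨fun e => IV.fiducialVolume L cell / (G * L ^ 2) * if e.1 = 1 / 3 then 6 * k else k₂ / 2,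
    fun e _ => mul_ne_zero (by positivity) ?_, fun q hq => ?_⟩
  · split_ifs <;> positivity
  have ha := hq.1
  have hb := hq.2
  obtain ⟨h1, -, h2⟩ := hm q hq
  have hne : (1 / 3 - 4 / √3 : ℝ) ≠ 1 / 3 := by
    have : 0 < 4 / √3 := by positivity
    linarith
  rw [reducedPotential_of_curvature hcell fun x hx => scalarCurvature_IV hL hq x,
    sqrt_det_tilted rfl hq]
  simp only [exponents, List.map_cons, List.map_nil, List.sum_cons, List.sum_nil, add_zero,
    if_true, if_neg hne]
  trans IV.fiducialVolume L cell / (G * L ^ 2) * (6 * q 0 + q 1 ^ 4 / q 0 ^ 3 / 2)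
  · field_simp
    ring
  · linear_combination IV.fiducialVolume L cell / (G * L ^ 2) * (6 * h1 + h2 / 2)

lemma hasMonomialPotential_VII (hL : 0 < L) (hG : 0 < G) (hσ : 0 < σ) (h : ℝ)
    (hcell : (VII h).IsCell L cell) :
    (VII h).HasMonomialPotential L G σ cell := by
  obtain ⟨k, k₁, k₂, hk, hk₁, hk₂, hm⟩ :=
    exists_monomials_tilted (M := VII h) hσ rfl rfl
  have hv := fiducialVolume_pos hcell
  have hlt : 0 < 4 / √3 := by positivity
  refine ⟨fun e => (VII h).fiducialVolume L cell / (G * L ^ 2) *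
    if e.1 = 1 / 3 then (if 6 * h ^ 2 = 1 then 1 else -(1 - 6 * h ^ 2) * k)
    else if 1 / 3 < e.1 then k₁ / 2 else k₂ / 2,
    fun e _ => mul_ne_zero (by positivity) ?_, fun q hq => ?_⟩
  · split_ifs with _ h6
    · exact one_ne_zero
    · exact mul_ne_zero (neg_ne_zero.2 (sub_ne_zero.2 (Ne.symm h6))) hk
    · positivity
    · positivity
  have ha := hq.1
  have hb := hq.2
  obtain ⟨h1, h2, h3⟩ := hm q hq
  rw [reducedPotential_of_curvature hcell fun x hx => scalarCurvature_VII hL hq h x,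
    sqrt_det_tilted rfl hq]
  trans (VII h).fiducialVolume L cell / (G * L ^ 2) * (-(1 - 6 * h ^ 2) * q 0
    + q 0 ^ 5 / q 1 ^ 4 / 2 + q 1 ^ 4 / q 0 ^ 3 / 2)
  · field_simp
    ring
  have n1 : (1 / 3 - 4 / √3 : ℝ) ≠ 1 / 3 := by linarith
  have n2 : (1 / 3 + 4 / √3 : ℝ) ≠ 1 / 3 := by linarith
  have l1 : ¬ (1 / 3 : ℝ) < 1 / 3 - 4 / √3 := by linarith
  have l2 : (1 / 3 : ℝ) < 1 / 3 + 4 / √3 := by linarith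
  by_cases h6 : 6 * h ^ 2 = 1
  · simp only [exponents, h6, if_true, List.map_cons, List.map_nil, List.sum_cons, List.sum_nil,
      add_zero, if_neg n1, if_neg n2, if_neg l1, if_pos l2]
    linear_combination (VII h).fiducialVolume L cell / (G * L ^ 2) * (h2 / 2 + h3 / 2)
  · simp only [exponents, h6, if_false, if_true, List.map_cons, List.map_nil, List.sum_cons,
      List.sum_nil, add_zero, if_neg n1, if_neg n2, if_neg l1, if_pos l2]
    linear_combination (VII h).fiducialVolume L cell / (G * L ^ 2)
      * (-(1 - 6 * h ^ 2) * h1 + h2 / 2 + h3 / 2)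

lemma hasMonomialPotential (hL : 0 < L) (hG : 0 < G) (hσ : 0 < σ) (M : Model)
    (hcell : M.IsCell L cell) :
    M.HasMonomialPotential L G σ cell := by
  cases M with
  | III => exact hasMonomialPotential_III hL hG hσ hcell
  | IV => exact hasMonomialPotential_IV hL hG hσ hcell
  | V => exact hasMonomialPotential_V hL hG hσ hcell
  | VI0 => exact hasMonomialPotential_VI0 hL hG hσ hcell
  | VII h => exact hasMonomialPotential_VII hL hG hσ h hcell
  | VIII =>
    exact hasMonomialPotential_of_two_axisymmetric hL hG hσ (-2) (by norm_num) hcell rfl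
      (funext fun _ => nullU_of_axisymmetric) (funext fun _ => nullV_of_axisymmetric)
      (fun _ => rfl) fun q hq x hx => by rw [scalarCurvature_VIII hL hq hx]; ring
  | IX =>
    exact hasMonomialPotential_of_two_axisymmetric hL hG hσ 2 (by norm_num) hcell rfl
      (funext fun _ => nullU_of_axisymmetric) (funext fun _ => nullV_of_axisymmetric)
      (fun _ => rfl) fun q hq x hx => scalarCurvature_IX hL hq hx
  | KS => exact hasMonomialPotential_KS hL hG hσ hcell

end Model

/-! ### Flatness of monomial metrics -/

/-- The coefficients of the Christoffel symbols of a monomial metric. -/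
def monoChristoffel (w : Fin 2 → ℝ) (K C : Matrix (Fin 2) (Fin 2) ℝ) (k i j : Fin 2) : ℝ :=
  (1 / 2) * ∑ l, K k l *
    ((w i - (if i = j then 1 else 0) - (if i = l then 1 else 0)) * C j l
      + (w j - (if j = i then 1 else 0) - (if j = l then 1 else 0)) * C i l
      - (w l - (if l = i then 1 else 0) - (if l = j then 1 else 0)) * C i j)

lemma pd_mono (i : Fin 2) {q : Fin 2 → ℝ} (hq : q ∈ quadrant) (n m : ℝ) :
    pd i (mono n m) q = ![n, m] i / q i * mono n m q := by
  fin_cases i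
  exacts [pd_zero_mono hq n m, pd_one_mono hq n m]

lemma pd_mono_div (i j l : Fin 2) {q : Fin 2 → ℝ} (hq : q ∈ quadrant) (c s t : ℝ) :
    pd i (fun y => c * mono s t y / (y j * y l)) q
      = (![s, t] i - (if i = j then 1 else 0) - (if i = l then 1 else 0)) / q i
        * (c * mono s t q / (q j * q l)) := by
  have ha := hq.1.ne'
  have hb := hq.2.ne'
  have e : ∀ n m : ℝ, (∀ y ∈ quadrant, c * mono s t y / (y j * y l) = c * mono n m y) →
      ![n, m] i = ![s, t] i - (if i = j then 1 else 0) - (if i = l then 1 else 0) →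
      pd i (fun y => c * mono s t y / (y j * y l)) q
      = (![s, t] i - (if i = j then 1 else 0) - (if i = l then 1 else 0)) / q i
        * (c * mono s t q / (q j * q l)) := by
    intro n m h h'
    rw [pd_congr_on isOpen_quadrant h hq i, pd_const_mul, pd_mono i hq, h q hq, h']
    ring
  have hm : ∀ y ∈ quadrant, ∀ n m : ℝ, mono s t y = mono n m y * mono (s - n) (t - m) y :=
    fun y hy n m => by rw [mono_mul hy]; simp
  fin_cases j <;> fin_cases l
  · refine e (s - 2) t (fun y hy => ?_) (by fin_cases i <;> simp; ring)
    have := hy.1.ne'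
    rw [hm y hy 2 0]
    simp [mono]
    field_simp
  · refine e (s - 1) (t - 1) (fun y hy => ?_) (by fin_cases i <;> simp)
    have := hy.1.ne'
    have := hy.2.ne'
    rw [hm y hy 1 1]
    simp [mono]
    field_simp
  · refine e (s - 1) (t - 1) (fun y hy => ?_) (by fin_cases i <;> simp)
    have := hy.1.ne'
    have := hy.2.ne'
    rw [hm y hy 1 1]
    simp [mono]
    field_simp
  · refine e s (t - 2) (fun y hy => ?_) (by fin_cases i <;> simp; ring)
    have := hy.2.ne'
    rw [hm y hy 0 2]
    simp [mono]
    field_simp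

/-- In logarithmic coordinates the metric is `exp (s x + t y)` times a constant matrix, and a
conformal factor with linear logarithm keeps a two-dimensional metric flat. Here this shows as
Christoffel symbols that are constants times `q_k / (q_i q_j)`, which makes the curvature an
algebraic identity. -/
lemma riemann_mono_eq_zero {g : (Fin 2 → ℝ) → Matrix (Fin 2) (Fin 2) ℝ} {a b c s t : ℝ}
    (hdet : a * c - b ^ 2 ≠ 0)
    (hg : ∀ q ∈ quadrant, ∀ i j, g q i j = !![a, b; b, c] i j * mono s t q / (q i * q j))
    {q : Fin 2 → ℝ} (hq : q ∈ quadrant) (k l i j : Fin 2) : riemann g k l i j q = 0 := by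
  set K : Matrix (Fin 2) (Fin 2) ℝ := !![c / (a * c - b ^ 2), -b / (a * c - b ^ 2);
    -b / (a * c - b ^ 2), a / (a * c - b ^ 2)] with hK
  set γ := monoChristoffel ![s, t] K !![a, b; b, c] with hγ
  have hinv : ∀ q ∈ quadrant, (g q)⁻¹ = Matrix.of fun i j => K i j * (q i * q j) / mono s t q := by
    intro q hq
    have ha := hq.1.ne'
    have hb := hq.2.ne'
    have hm := (mono_pos hq s t).ne'
    refine Matrix.inv_eq_right_inv ?_
    ext i j
    rw [Matrix.mul_apply, Fin.sum_univ_two, hg q hq, hg q hq]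
    fin_cases i <;> fin_cases j <;> simp [hK] <;> field_simp <;> ring
  have hch : ∀ q ∈ quadrant, ∀ k i j, christoffel g k i j q = γ k i j * q k / (q i * q j) := by
    intro q hq k i j
    have ha := hq.1.ne'
    have hb := hq.2.ne'
    have hm := (mono_pos hq s t).ne'
    have hpd : ∀ i j l, pd i (fun y => g y j l) q
        = (![s, t] i - (if i = j then 1 else 0) - (if i = l then 1 else 0)) / q i
          * (!![a, b; b, c] j l * mono s t q / (q j * q l)) := fun i j l => by
      rw [pd_congr_on isOpen_quadrant (fun y hy => hg y hy j l) hq i, pd_mono_div i j l hq]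
    have hne : ∀ i, q i ≠ 0 := fun i => by fin_cases i <;> assumption
    simp only [christoffel, hinv q hq, hpd, hγ, monoChristoffel, Matrix.of_apply,
      Fin.sum_univ_two]
    have h0 := hne 0
    have h1 := hne 1
    have hi := hne i
    have hj := hne j
    have hk := hne k
    field_simp
  have hpd : ∀ i k j l, pd i (christoffel g k j l) q
      = γ k j l * ((if i = k then 1 else 0) - (if i = j then 1 else 0)
        - (if i = l then 1 else 0)) * q k / (q i * q j * q l) := by
    intro i k j l
    have ha := hq.1.ne'
    have hb := hq.2.ne'
    have hne : ∀ i, q i ≠ 0 := fun i => by fin_cases i <;> assumption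
    have hi := hne i
    have hj := hne j
    have hl := hne l
    -- The indicator exponents write `q_k` as a monomial, so that `pd_mono_div` applies again.
    have e : ∀ y ∈ quadrant, christoffel g k j l y
        = γ k j l * mono (if k = 0 then 1 else 0) (if k = 1 then 1 else 0) y / (y j * y l) := by
      intro y hy
      rw [hch y hy]
      congr 2
      fin_cases k <;> simp [mono]
    rw [pd_congr_on isOpen_quadrant e hq i, pd_mono_div i j l hq]
    have e2 : mono (if k = 0 then 1 else 0) (if k = 1 then 1 else 0) q = q k := by
      fin_cases k <;> simp [mono]
    have e3 : (![if k = 0 then 1 else 0, if k = 1 then 1 else 0] : Fin 2 → ℝ) i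
        = if i = k then 1 else 0 := by
      fin_cases k <;> fin_cases i <;> simp
    rw [e2, e3]
    field_simp
  have ha := hq.1.ne'
  have hb := hq.2.ne'
  simp only [riemann, hpd, hch q hq, Fin.sum_univ_two]
  fin_cases k <;> fin_cases l <;> fin_cases i <;> fin_cases j <;>
    simp [hγ, monoChristoffel, hK, Fin.sum_univ_two] <;> field_simp <;> ring

namespace Model

variable {M : Model} {L G σ : ℝ} {cell : Set (Fin 3 → ℝ)} {q : Fin 2 → ℝ}

/-! ### The models in null coordinates -/

/-- The null coordinates as a map of the quadrant. -/
def nullMap (M : Model) (σ : ℝ) (q : Fin 2 → ℝ) : Fin 2 → ℝ := ![M.nullU σ q, M.nullV σ q]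

lemma monomial_eq_mono_nullMap (e : ℝ × ℝ) (q : Fin 2 → ℝ) :
    M.monomial σ e q = mono e.1 e.2 (M.nullMap σ q) := rfl

lemma exists_nullMap_chartMap (M : Model) (hσ : 0 < σ) :
    ∃ Ψ, ChartMap quadrant quadrant (M.nullMap σ) Ψ := by
  obtain ⟨K, K', α, β, γ, δ, hK, hK', hd, hU, hV⟩ := M.exists_null_eq_mono hσ
  refine ⟨_, ((powerMap_chartMap hd).trans (scaling_chartMap hK hK')).congr fun q _ => ?_⟩
  rw [nullMap, hU, hV]
  rfl

lemma monomial_pos (hσ : 0 < σ) (e : ℝ × ℝ) (hq : q ∈ quadrant) : 0 < M.monomial σ e q := by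
  obtain ⟨Ψ, h⟩ := M.exists_nullMap_chartMap hσ
  exact mono_pos (h.mapsTo q hq) _ _

lemma contDiffOn_monomial (hσ : 0 < σ) (e : ℝ × ℝ) :
    ContDiffOn ℝ ∞ (M.monomial σ e) quadrant := by
  obtain ⟨Ψ, h⟩ := M.exists_nullMap_chartMap hσ
  exact (contDiffOn_mono e.1 e.2).comp h.smooth h.mapsTo

lemma reduction_lapseMetric (hσ : 0 < σ) (N : (Fin 2 → ℝ) → ℝ) (hq : q ∈ quadrant) (μ ν : Fin 2) :
    (M.reduction L G cell).lapseMetric N q μ ν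
      = -(M.fiducialVolume L cell / G) * (N q)⁻¹ *
        (pd μ (M.nullU σ) q * pd ν (M.nullV σ) q + pd ν (M.nullU σ) q * pd μ (M.nullV σ) q) := by
  rw [lapseMetric, Matrix.smul_apply, smul_eq_mul]
  change _ * M.supermetric L G cell q μ ν = _
  rw [M.hasNullMetric hσ hq μ ν]
  ring

lemma reduction_transport (hσ : 0 < σ) {D D' : Set (Fin 2 → ℝ)} {Ψ : (Fin 2 → ℝ) → Fin 2 → ℝ}
    {N ρ W : (Fin 2 → ℝ) → ℝ} (hD : D ⊆ quadrant) (h : ChartMap D D' (M.nullMap σ) Ψ)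
    (hρ : ContDiffOn ℝ ∞ ρ D') (h0 : ∀ q ∈ D', ρ q ≠ 0) (hW : ContDiffOn ℝ ∞ W D')
    (hN : ∀ q ∈ D, -(M.fiducialVolume L cell / G) * (N q)⁻¹ = ρ (M.nullMap σ q))
    (hpot : ∀ q ∈ D, N q * M.reducedPotential L G cell q = W (M.nullMap σ q)) :
    Transport D D' (M.nullMap σ) Ψ (M.reduction L G cell) N (nullModel ρ W) (fun _ => 1) :=
  transport_nullModel h hρ h0 hW
    (fun q hq μ ν => by rw [reduction_lapseMetric hσ N (hD hq), hN q hq]; rfl) hpot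

lemma reduction_riemann_eq_zero (hG : 0 < G) (hσ : 0 < σ) (hcell : M.IsCell L cell)
    {N : (Fin 2 → ℝ) → ℝ} {r : ℝ} {e : ℝ × ℝ} (hr : r ≠ 0)
    (hN : ∀ q ∈ quadrant, (N q)⁻¹ = r * M.monomial σ e q) (hq : q ∈ quadrant)
    (k l i j : Fin 2) : riemann ((M.reduction L G cell).lapseMetric N) k l i j q = 0 := by
  obtain ⟨K, K', α, β, γ, δ, hK, hK', hd, hU, hV⟩ := M.exists_null_eq_mono hσ
  have hv := fiducialVolume_pos hcell
  set f : ℝ := -(M.fiducialVolume L cell / G) * r * (K ^ e.1 * K' ^ e.2) * (K * K') with hf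
  have hf0 : f ≠ 0 := by
    have h1 := Real.rpow_pos_of_pos hK e.1
    have h2 := Real.rpow_pos_of_pos hK' e.2
    refine mul_ne_zero (mul_ne_zero (mul_ne_zero (neg_ne_zero.2 ?_) hr) ?_) ?_ <;> positivity
  refine riemann_mono_eq_zero (a := f * (2 * α * γ)) (b := f * (α * δ + β * γ))
    (c := f * (2 * β * δ)) (s := α * e.1 + γ * e.2 + (α + γ)) (t := β * e.1 + δ * e.2 + (β + δ))
    ?_ (fun q hq i j => ?_) hq k l i j
  -- The determinant is minus a square because the metric is a product of two independent null
  -- factors.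
  · rw [show f * (2 * α * γ) * (f * (2 * β * δ)) - (f * (α * δ + β * γ)) ^ 2
      = -(f * (α * δ - β * γ)) ^ 2 by ring]
    exact neg_ne_zero.2 (pow_ne_zero _ (mul_ne_zero hf0 hd))
  · have ha := hq.1.ne'
    have hb := hq.2.ne'
    obtain ⟨b00, b01, b10, b11⟩ := pd_mono_symm (K := K) (K' := K') (α := α) (β := β) (γ := γ)
      (δ := δ) hq
    rw [reduction_lapseMetric hσ N hq, hN q hq, monomial_eq_mono hK hK' hU hV e hq, hU, hV,
      ← mono_mul hq (α * e.1 + γ * e.2) (β * e.1 + δ * e.2) (α + γ) (β + δ)]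
    fin_cases i <;> fin_cases j
    · refine (congrArg (_ * ·) b00).trans ?_
      simp [hf]
      field_simp
    · refine (congrArg (_ * ·) b01).trans ?_
      simp [hf]
      field_simp
    · refine (congrArg (_ * ·) b10).trans ?_
      simp [hf]
      field_simp
    · refine (congrArg (_ * ·) b11).trans ?_
      simp [hf]
      field_simp

/-! ### Models with one monomial -/

lemma reduction_hasFullAlgebra (hG : 0 < G) (hσ : 0 < σ) (hcell : M.IsCell L cell) {c : ℝ}
    {e : ℝ × ℝ} (hc : c ≠ 0)
    (hpot : ∀ q ∈ quadrant, M.reducedPotential L G cell q = c * M.monomial σ e q)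
    (he : e.2 + 1 ≠ 0) {κ : ℝ} (hκ : κ ≠ 0) :
    (M.reduction L G cell).HasFullAlgebra quadrant
      (fun q => κ / (M.reduction L G cell).potential q) := by
  obtain ⟨Ψ, h⟩ := M.exists_nullMap_chartMap hσ
  have hv := fiducialVolume_pos hcell
  have hr : -(M.fiducialVolume L cell / G) * (c / κ) ≠ 0 :=
    mul_ne_zero (neg_ne_zero.2 (by positivity)) (div_ne_zero hc hκ)
  have T : Transport quadrant quadrant (M.nullMap σ) Ψ (M.reduction L G cell)
      (fun q => κ / (M.reduction L G cell).potential q)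
      (nullModel (fun q => -(M.fiducialVolume L cell / G) * (c / κ) * mono e.1 e.2 q)
        (fun _ => κ)) (fun _ => 1) := by
    refine reduction_transport hσ subset_rfl h (contDiffOn_const.mul (contDiffOn_mono _ _))
      (fun q hq => mul_ne_zero hr (mono_pos hq _ _).ne') contDiffOn_const (fun q hq => ?_)
      (fun q hq => ?_)
    · change _ * (κ / M.reducedPotential L G cell q)⁻¹ = _
      rw [hpot q hq, inv_div, ← monomial_eq_mono_nullMap]
      ring
    · refine div_mul_cancel₀ κ ?_
      change M.reducedPotential L G cell q ≠ 0
      rw [hpot q hq]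
      exact mul_ne_zero hc (monomial_pos hσ e hq).ne'
  refine T.hasFullAlgebra ?_
  -- Among the one-monomial models the first exponent is `-1` exactly for VI₀.
  by_cases hn : e.1 + 1 = 0
  · rw [show e.1 = -1 by linarith]
    exact logModel_hasFullAlgebra hr he κ
  · exact powerModel_hasFullAlgebra hr hn he κ

/-! ### Models with two monomials -/

/-- The lapse turns the monomial `e` of the potential into the constant `κ c`, which is taken as
`U₀`; what is left is a single monomial, as the two-monomial criterion requires. -/
lemma reduction_exists_sl2 (hG : 0 < G) (hσ : 0 < σ) (hcell : M.IsCell L cell) {c c' : ℝ}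
    {e e' : ℝ × ℝ} (hc' : c' ≠ 0)
    (hpot : ∀ q ∈ quadrant, M.reducedPotential L G cell q
      = c * M.monomial σ e q + c' * M.monomial σ e' q)
    (h1 : e'.1 ≠ e.1) (h2 : e'.2 ≠ e.2) (hn : e.1 + 1 ≠ 0) (hn' : e'.1 + 1 ≠ 0)
    (hm' : e'.2 + 1 ≠ 0) (hP : PowerCondition e e') {κ : ℝ} (hκ : κ ≠ 0) :
    ∃ (U₀ : ℝ) (ξ : (Fin 2 → ℝ) → (Fin 2 → ℝ)),
      (M.reduction L G cell).IsUniqueAdmissible quadrant (fun q => κ / M.monomial σ e q) U₀ ξ ∧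
      (M.reduction L G cell).ChargesSpanSL2 quadrant (fun q => κ / M.monomial σ e q) U₀ ξ := by
  obtain ⟨Ψ, h⟩ := M.exists_nullMap_chartMap hσ
  have hv := fiducialVolume_pos hcell
  have hr : -(M.fiducialVolume L cell / G) * κ⁻¹ ≠ 0 :=
    mul_ne_zero (neg_ne_zero.2 (by positivity)) (inv_ne_zero hκ)
  have T : Transport quadrant quadrant (M.nullMap σ) Ψ (M.reduction L G cell)
      (fun q => κ / M.monomial σ e q)
      (nullModel (fun q => -(M.fiducialVolume L cell / G) * κ⁻¹ * mono e.1 e.2 q)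
        (fun q => κ * c' * mono (e'.1 - e.1) (e'.2 - e.2) q + κ * c)) (fun _ => 1) := by
    refine reduction_transport hσ subset_rfl h (contDiffOn_const.mul (contDiffOn_mono _ _))
      (fun q hq => mul_ne_zero hr (mono_pos hq _ _).ne')
      ((contDiffOn_const.mul (contDiffOn_mono _ _)).add contDiffOn_const) (fun q hq => ?_)
      (fun q hq => ?_)
    · rw [inv_div, ← monomial_eq_mono_nullMap]
      ring
    · have hm := (monomial_pos (M := M) hσ e hq).ne'
      rw [hpot q hq, ← mono_div (h.mapsTo q hq), ← monomial_eq_mono_nullMap,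
        ← monomial_eq_mono_nullMap]
      field_simp
      ring
  have hsm : e'.2 - e.2 + e.2 + 1 ≠ 0 := by simpa using hm'
  have hpn : e'.1 - e.1 + e.1 + 1 ≠ 0 := by simpa using hn'
  refine ⟨κ * c, _, T.isUniqueAdmissible (powerModel_isUniqueAdmissible hr
    (mul_ne_zero hκ hc') (sub_ne_zero.2 h1) (sub_ne_zero.2 h2) hsm),
    T.chargesSpanSL2 (contDiff_linField _ _).contDiffOn
      ((powerModel_chargesSpanSL2_iff hr hsm hpn hn).2 ?_)⟩
  rw [PowerCondition] at hP
  linear_combination hP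

/-! ### Obstructions for the models -/

/-- The common degree is what makes the quotient of any two monomials a function of `ũ / ṽ` alone;
all obstructions rest on it. -/
lemma exponents_add (M : Model) : ∀ e ∈ M.exponents, e.1 + e.2 = 2 / 3 := by
  intro e he
  cases M <;> simp only [exponents] at he
  case VII h =>
    split_ifs at he <;> simp at he
    · rcases he with rfl | rfl <;> ring
    · rcases he with rfl | rfl | rfl <;> ring
  all_goals simp at he
  all_goals first | (subst he; norm_num) | (rcases he with rfl | rfl <;> ring)

lemma exponents_nodup (M : Model) : M.exponents.Nodup := by
  have h3 : 0 < 4 / √3 := by positivity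
  have n1 : (1 / 3 : ℝ) ≠ 1 / 3 - 4 / √3 := by linarith
  have n2 : (1 / 3 : ℝ) ≠ 1 / 3 + 4 / √3 := by linarith
  have n3 : (1 / 3 + 4 / √3 : ℝ) ≠ 1 / 3 - 4 / √3 := by linarith
  cases M <;> simp only [exponents]
  case VII h =>
    split_ifs <;> simp only [List.nodup_cons, List.mem_cons, List.not_mem_nil, Prod.mk.injEq, n1,
      n2, n3, false_and, or_false, not_false_eq_true, List.nodup_nil, and_true]
  case VIII | IX => norm_num
  all_goals simp only [List.nodup_cons, List.mem_cons, List.not_mem_nil, Prod.mk.injEq, n1,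
    false_and, or_false, not_false_eq_true, List.nodup_nil, and_true]

/-- The form of the model over `D` in null coordinates. -/
lemma exists_null_transport (hG : 0 < G) (hσ : 0 < σ) (hcell : M.IsCell L cell)
    {c : ℝ × ℝ → ℝ} (hpot : ∀ q ∈ quadrant, M.reducedPotential L G cell q
      = ∑ e ∈ M.exponents.toFinset, c e * M.monomial σ e q)
    {D : Set (Fin 2 → ℝ)} {N : (Fin 2 → ℝ) → ℝ} (hD : IsOpen D) (hne : D.Nonempty)
    (hDq : D ⊆ quadrant) (hN : ContDiffOn ℝ ∞ N D) (hN0 : ∀ q ∈ D, N q ≠ 0) :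
    ∃ (D' : Set (Fin 2 → ℝ)) (Ψ : (Fin 2 → ℝ) → Fin 2 → ℝ) (ρ W : (Fin 2 → ℝ) → ℝ),
      Transport D D' (M.nullMap σ) Ψ (M.reduction L G cell) N (nullModel ρ W) (fun _ => 1) ∧
      IsOpen D' ∧ D'.Nonempty ∧ D' ⊆ quadrant ∧ ContDiffOn ℝ ∞ ρ D' ∧ (∀ q ∈ D', ρ q ≠ 0) ∧
      (∀ q ∈ D', ρ q * W q = ∑ e ∈ M.exponents.toFinset,
        -(M.fiducialVolume L cell / G) * c e * mono e.1 e.2 q) ∧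
      ∀ q ∈ D', Ψ q ∈ D ∧ M.nullMap σ (Ψ q) = q ∧
        ρ q = -(M.fiducialVolume L cell / G) * (N (Ψ q))⁻¹ ∧
        W q = N (Ψ q) * M.reducedPotential L G cell (Ψ q) := by
  obtain ⟨Ψ, h⟩ := M.exists_nullMap_chartMap hσ
  have hv := fiducialVolume_pos hcell
  have hv0 : -(M.fiducialVolume L cell / G) ≠ 0 := neg_ne_zero.2 (by positivity)
  have h' := h.restrict hD hDq
  have hps : ContDiffOn ℝ ∞ (M.reducedPotential L G cell) quadrant :=
    (ContDiffOn.sum fun e _ => contDiffOn_const.mul (contDiffOn_monomial hσ e)).congr hpot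
  have hρ : ContDiffOn ℝ ∞ (fun q => -(M.fiducialVolume L cell / G) * (N (Ψ q))⁻¹)
      (quadrant ∩ Ψ ⁻¹' D) :=
    contDiffOn_const.mul ((hN.comp h'.smooth' h'.mapsTo').inv fun q hq => hN0 _ hq.2)
  have h0 : ∀ q ∈ quadrant ∩ Ψ ⁻¹' D, -(M.fiducialVolume L cell / G) * (N (Ψ q))⁻¹ ≠ 0 :=
    fun q hq => mul_ne_zero hv0 (inv_ne_zero (hN0 _ hq.2))
  refine ⟨_, Ψ, fun q => -(M.fiducialVolume L cell / G) * (N (Ψ q))⁻¹,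
    fun q => N (Ψ q) * M.reducedPotential L G cell (Ψ q),
    reduction_transport hσ hDq h' hρ h0 ((hN.comp h'.smooth' h'.mapsTo').mul
      ((hps.mono hDq).comp h'.smooth' h'.mapsTo')) (fun q hq => by rw [h'.leftInv q hq])
      (fun q hq => by rw [h'.leftInv q hq]),
    h'.isOpen', hne.elim fun q hq => ⟨_, h'.mapsTo q hq⟩, Set.inter_subset_left, hρ, h0, fun q hq => ?_,
    fun q hq => ⟨hq.2, h'.rightInv q hq, rfl, rfl⟩⟩
  · have hn := hN0 _ hq.2
    dsimp only
    -- The lapse cancels between `ρ` and `W`.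
    rw [hpot _ (hDq hq.2), mul_assoc, inv_mul_cancel_left₀ hn, Finset.mul_sum]
    refine Finset.sum_congr rfl fun e _ => ?_
    rw [monomial_eq_mono_nullMap, h'.rightInv q hq, mul_assoc]

end Model

/-! ### The assertions for the individual models -/

namespace Model

variable {M : Model} {L G σ : ℝ} {cell : Set (Fin 3 → ℝ)}

lemma exists_finset_potential (hL : 0 < L) (hG : 0 < G) (hσ : 0 < σ) (hcell : M.IsCell L cell) :
    ∃ c : ℝ × ℝ → ℝ, (∀ e ∈ M.exponents, c e ≠ 0) ∧ ∀ q ∈ quadrant,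
      M.reducedPotential L G cell q
        = ∑ e ∈ M.exponents.toFinset, c e * M.monomial σ e q := by
  obtain ⟨c, hc, h⟩ := hasMonomialPotential hL hG hσ M hcell
  refine ⟨c, hc, fun q hq => ?_⟩
  rw [h q hq, List.sum_toFinset _ M.exponents_nodup]

lemma exponents_toFinset_nontrivial {e e' : ℝ × ℝ} (he : e ∈ M.exponents) (he' : e' ∈ M.exponents)
    (hne : e ≠ e') : M.exponents.toFinset.Nontrivial :=
  ⟨e, by simpa using he, e', by simpa using he', hne⟩

lemma reduction_not_hasFullAlgebra (hL : 0 < L) (hG : 0 < G) (hσ : 0 < σ)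
    (hcell : M.IsCell L cell) {e e' : ℝ × ℝ} (he : e ∈ M.exponents) (he' : e' ∈ M.exponents)
    (hee : e ≠ e') {D : Set (Fin 2 → ℝ)} {N : (Fin 2 → ℝ) → ℝ} (hD : IsOpen D)
    (hne : D.Nonempty) (hDq : D ⊆ quadrant) (hN : ContDiffOn ℝ ∞ N D)
    (hN0 : ∀ q ∈ D, N q ≠ 0) : ¬ (M.reduction L G cell).HasFullAlgebra D N := by
  obtain ⟨c, hc, hpot⟩ := exists_finset_potential hL hG hσ hcell
  have hv := fiducialVolume_pos hcell
  obtain ⟨D', Ψ, ρ, W, T, hD', hne', hDq', hρ, h0, hf, -⟩ :=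
    exists_null_transport hG hσ hcell hpot hD hne hDq hN hN0
  intro h
  exact nullModel_not_hasFullAlgebra hD' hne' hDq' hρ h0
    (fun e he => M.exponents_add e (List.mem_toFinset.1 he))
    (fun e he => mul_ne_zero (neg_ne_zero.2 (by positivity)) (hc e (List.mem_toFinset.1 he)))
    (exponents_toFinset_nontrivial he he' hee) hf (T.symm.hasFullAlgebra h)

/-- `N Ũ` constant makes `W` constant, and `N` inverse to a monomial makes `ρ` a monomial; each case
has its own obstruction in null coordinates. -/
lemma reduction_not_chargesSpanSL2 (hL : 0 < L) (hG : 0 < G) (hσ : 0 < σ)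
    (hcell : M.IsCell L cell) {e₁ e₂ : ℝ × ℝ} (he₁ : e₁ ∈ M.exponents) (he₂ : e₂ ∈ M.exponents)
    (hee : e₁ ≠ e₂) (hne1 : ∀ e ∈ M.exponents, e.1 + 1 ≠ 0 ∧ e.2 + 1 ≠ 0)
    (hP : ∀ e ∈ M.exponents, ∀ e' ∈ M.exponents, e ≠ e' → ¬ PowerCondition e e')
    {D : Set (Fin 2 → ℝ)} {N : (Fin 2 → ℝ) → ℝ} {κ : ℝ} (hD : IsOpen D) (hne : D.Nonempty)
    (hDq : D ⊆ quadrant) (hκ : κ ≠ 0)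
    (hN : (∀ q ∈ D, N q * M.reducedPotential L G cell q = κ) ∨
      ∃ e ∈ M.exponents, ∀ q ∈ D, N q * M.monomial σ e q = κ)
    {U₀ lam : ℝ} {ξ : (Fin 2 → ℝ) → (Fin 2 → ℝ)}
    (hξ : (M.reduction L G cell).IsAdmissible D N U₀ lam ξ) :
    ¬ (M.reduction L G cell).ChargesSpanSL2 D N U₀ ξ := by
  obtain ⟨c, hc, hpot⟩ := exists_finset_potential hL hG hσ hcell
  have hv := fiducialVolume_pos hcell
  have hv0 : -(M.fiducialVolume L cell / G) ≠ 0 := neg_ne_zero.2 (by positivity)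
  have hps : ContDiffOn ℝ ∞ (M.reducedPotential L G cell) quadrant :=
    (ContDiffOn.sum fun e _ => contDiffOn_const.mul (contDiffOn_monomial hσ e)).congr hpot
  have hE : ∀ e ∈ M.exponents.toFinset, e.1 + e.2 = 2 / 3 :=
    fun e he => M.exponents_add e (List.mem_toFinset.1 he)
  have hcE : ∀ e ∈ M.exponents.toFinset, -(M.fiducialVolume L cell / G) * c e ≠ 0 :=
    fun e he => mul_ne_zero hv0 (hc e (List.mem_toFinset.1 he))
  -- No smoothness of `N` is assumed: it follows, with nonvanishing, from `N = κ / F` for a smooth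
  -- `F`.
  have hdiv : ∀ F : (Fin 2 → ℝ) → ℝ, ContDiffOn ℝ ∞ F D → (∀ q ∈ D, N q * F q = κ) →
      ContDiffOn ℝ ∞ N D ∧ ∀ q ∈ D, N q ≠ 0 := by
    intro F hF h
    have hF0 : ∀ q ∈ D, F q ≠ 0 := fun q hq h0 => hκ (by rw [← h q hq, h0, mul_zero])
    exact ⟨(contDiffOn_const.div hF hF0).congr fun q hq => eq_div_of_mul_eq (hF0 q hq) (h q hq),
      fun q hq h0 => hκ (by rw [← h q hq, h0, zero_mul])⟩
  have hNs : ContDiffOn ℝ ∞ N D ∧ ∀ q ∈ D, N q ≠ 0 := by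
    rcases hN with h | ⟨e, -, h⟩
    exacts [hdiv _ (hps.mono hDq) h, hdiv _ ((contDiffOn_monomial hσ e).mono hDq) h]
  obtain ⟨D', Ψ, ρ, W, T, hD', hne', hDq', hρ, h0, hf, hrel⟩ :=
    exists_null_transport hG hσ hcell hpot hD hne hDq hNs.1 hNs.2
  intro h
  have hξ' := T.symm.isAdmissible hξ
  have h' := T.symm.chargesSpanSL2 hξ.1 h
  rcases hN with hN | ⟨e, he, hN⟩
  · exact nullModel_not_chargesSpanSL2_of_const hD' hDq' hρ h0 hE hcE
      (exponents_toFinset_nontrivial he₁ he₂ hee) hf (κ := κ)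
      (fun q hq => by rw [(hrel q hq).2.2.2, hN _ (hrel q hq).1]) hξ' h'
  · obtain ⟨e', he', hne''⟩ : ∃ e' ∈ M.exponents, e' ≠ e := by
      by_cases h1 : e₁ = e
      · exact ⟨e₂, he₂, h1 ▸ hee.symm⟩
      · exact ⟨e₁, he₁, h1⟩
    refine nullModel_not_chargesSpanSL2_of_mono hD' hDq' hE hcE
      (mul_ne_zero hv0 (inv_ne_zero hκ)) (List.mem_toFinset.2 he) (List.mem_toFinset.2 he')
      (hP e he e' he' hne''.symm) hne'' (hne1 e he).1 (hne1 e he).2 (fun q hq => ?_) hf hξ' h'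
    obtain ⟨h1, h2, h3, -⟩ := hrel q hq
    have h4 := hN _ h1
    have h5 := hNs.2 _ h1
    rw [monomial_eq_mono_nullMap, h2] at h4
    rw [h3, ← h4]
    have h6 := (mono_pos (hDq' hq) e.1 e.2).ne'
    field_simp

lemma reduction_flat_and_hasFullAlgebra (hL : 0 < L) (hG : 0 < G) (hσ : 0 < σ)
    (hcell : M.IsCell L cell) {e : ℝ × ℝ} (hE : M.exponents = [e]) (he : e.2 + 1 ≠ 0) {κ : ℝ}
    (hκ : κ ≠ 0) :
    (∀ q ∈ quadrant, ∀ k l i j, riemann ((M.reduction L G cell).lapseMetric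
      (fun q => κ / (M.reduction L G cell).potential q)) k l i j q = 0) ∧
    (M.reduction L G cell).HasFullAlgebra quadrant
      (fun q => κ / (M.reduction L G cell).potential q) := by
  obtain ⟨c, hc, h⟩ := hasMonomialPotential hL hG hσ M hcell
  simp only [hE, List.map_cons, List.map_nil, List.sum_cons, List.sum_nil, add_zero] at h
  have hce := hc e (by simp [hE])
  refine ⟨fun q hq k l i j => reduction_riemann_eq_zero hG hσ hcell (r := c e / κ) (e := e)
    (div_ne_zero hce hκ) (fun q hq => ?_) hq k l i j,
    reduction_hasFullAlgebra hG hσ hcell hce h he hκ⟩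
  change (κ / M.reducedPotential L G cell q)⁻¹ = _
  rw [h q hq, inv_div]
  ring

lemma powerCondition_two_axisymmetric :
    PowerCondition (1, -1 / 3) (3, -7 / 3) ∧ PowerCondition (3, -7 / 3) (1, -1 / 3) := by
  constructor <;> norm_num [PowerCondition]

lemma reduction_sl2_of_two (hL : 0 < L) (hG : 0 < G) (hσ : 0 < σ) (hcell : M.IsCell L cell)
    (hE : M.exponents = [(1, -1 / 3), (3, -7 / 3)]) :
    ∀ e ∈ M.exponents, ∀ κ : ℝ, κ ≠ 0 →
      (∀ q ∈ quadrant, ∀ k l i j, riemann ((M.reduction L G cell).lapseMetric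
        (fun q => κ / M.monomial σ e q)) k l i j q = 0) ∧
      ∃ (U₀ : ℝ) (ξ : (Fin 2 → ℝ) → (Fin 2 → ℝ)),
        (M.reduction L G cell).IsUniqueAdmissible quadrant (fun q => κ / M.monomial σ e q) U₀ ξ ∧
        (M.reduction L G cell).ChargesSpanSL2 quadrant (fun q => κ / M.monomial σ e q) U₀ ξ := by
  obtain ⟨c, hc, h⟩ := hasMonomialPotential hL hG hσ M hcell
  intro e he κ hκ
  refine ⟨fun q hq k l i j => reduction_riemann_eq_zero hG hσ hcell (inv_ne_zero hκ)
    (fun q _ => by rw [inv_div]; ring) hq k l i j, ?_⟩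
  simp only [hE, List.map_cons, List.map_nil, List.sum_cons, List.sum_nil, add_zero] at h
  have hc1 := hc (1, -1 / 3) (by simp [hE])
  have hc2 := hc (3, -7 / 3) (by simp [hE])
  rw [hE, List.mem_cons, List.mem_singleton] at he
  rcases he with rfl | rfl
  · exact reduction_exists_sl2 hG hσ hcell hc2 h (by norm_num) (by norm_num) (by norm_num)
      (by norm_num) (by norm_num) powerCondition_two_axisymmetric.1 hκ
  · exact reduction_exists_sl2 hG hσ hcell hc1 (fun q hq => by rw [h q hq, add_comm])
      (by norm_num) (by norm_num) (by norm_num) (by norm_num) (by norm_num)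
      powerCondition_two_axisymmetric.2 hκ

/-- A common parameter `d ∈ {0, 1, -1}` reduces the arithmetic of all pairs to that of `d` and of
`(4 / √3)² = 16 / 3`. -/
lemma mem_exponents_tilted (hM : M = .IV ∨ ∃ h, M = .VII h) {e : ℝ × ℝ} (he : e ∈ M.exponents) :
    ∃ d : ℝ, (d = 0 ∨ d = 1 ∨ d = -1) ∧
      e = (1 / 3 + d * (4 / √3), 1 / 3 - d * (4 / √3)) := by
  have h0 : ((1 / 3, 1 / 3) : ℝ × ℝ) = (1 / 3 + 0 * (4 / √3), 1 / 3 - 0 * (4 / √3)) := by simp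
  have h1 : ((1 / 3 + 4 / √3, 1 / 3 - 4 / √3) : ℝ × ℝ)
      = (1 / 3 + 1 * (4 / √3), 1 / 3 - 1 * (4 / √3)) := by simp
  have h2 : ((1 / 3 - 4 / √3, 1 / 3 + 4 / √3) : ℝ × ℝ)
      = (1 / 3 + -1 * (4 / √3), 1 / 3 - -1 * (4 / √3)) := by
    ext <;> ring
  rcases hM with rfl | ⟨h, rfl⟩
  · simp only [exponents, List.mem_cons, List.not_mem_nil, or_false] at he
    rcases he with rfl | rfl
    exacts [⟨0, by simp, h0⟩, ⟨-1, by simp, h2⟩]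
  · simp only [exponents] at he
    split_ifs at he
    · simp only [List.mem_cons, List.not_mem_nil, or_false] at he
      rcases he with rfl | rfl
      exacts [⟨1, by simp, h1⟩, ⟨-1, by simp, h2⟩]
    · simp only [List.mem_cons, List.not_mem_nil, or_false] at he
      rcases he with rfl | rfl | rfl
      exacts [⟨0, by simp, h0⟩, ⟨1, by simp, h1⟩, ⟨-1, by simp, h2⟩]

lemma sq_four_div_sqrt_three : (4 / √3) ^ 2 = 16 / 3 := by
  rw [div_pow, Real.sq_sqrt (by norm_num)]
  norm_num

lemma exponents_tilted_ne_neg_one (hM : M = .IV ∨ ∃ h, M = .VII h) :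
    ∀ e ∈ M.exponents, e.1 + 1 ≠ 0 ∧ e.2 + 1 ≠ 0 := by
  intro e he
  obtain ⟨d, hd, rfl⟩ := mem_exponents_tilted hM he
  have h := sq_four_div_sqrt_three
  have h0 : 0 < 4 / √3 := by positivity
  generalize 4 / √3 = x at h h0 ⊢
  constructor <;> intro hx <;> simp only at hx <;> rcases hd with rfl | rfl | rfl <;> nlinarith

/-- For the parameters `d, d'` the condition reads `32/9 - (32/3) d d' = 0`, that is `d d' = 1/3`,
which no integers satisfy. -/
lemma not_powerCondition_tilted (hM : M = .IV ∨ ∃ h, M = .VII h) :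
    ∀ e ∈ M.exponents, ∀ e' ∈ M.exponents, e ≠ e' → ¬ PowerCondition e e' := by
  intro e he e' he' hne hP
  obtain ⟨d, hd, rfl⟩ := mem_exponents_tilted hM he
  obtain ⟨d', hd', rfl⟩ := mem_exponents_tilted hM he'
  have h := sq_four_div_sqrt_three
  have h1 : 32 / 9 - 2 * (d * d') * (4 / √3) ^ 2 = 0 := by
    rw [← hP]
    ring
  rw [h] at h1
  rcases hd with rfl | rfl | rfl <;> rcases hd' with rfl | rfl | rfl <;>
    first | exact hne rfl | (norm_num at h1)

lemma exists_exponents_ne (hM : M = .IV ∨ ∃ h, M = .VII h) :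
    ∃ e ∈ M.exponents, ∃ e' ∈ M.exponents, e ≠ e' := by
  have h0 : 0 < 4 / √3 := by positivity
  rcases hM with rfl | ⟨h, rfl⟩
  · refine ⟨(1 / 3, 1 / 3), by simp [exponents], (1 / 3 - 4 / √3, 1 / 3 + 4 / √3),
      by simp [exponents], fun h => ?_⟩
    have := congrArg Prod.fst h
    simp only at this
    linarith
  · refine ⟨(1 / 3 + 4 / √3, 1 / 3 - 4 / √3), ?_, (1 / 3 - 4 / √3, 1 / 3 + 4 / √3), ?_,
      fun h => ?_⟩
    · simp only [exponents]
      split_ifs <;> simp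
    · simp only [exponents]
      split_ifs <;> simp
    · have := congrArg Prod.fst h
      simp only at this
      linarith

end Model

/-! ### The two-monomial criterion -/

/-- The coordinates are null from the start, so the identity serves as change of coordinates; the
chosen lapse gives `ρ = -u^(n₁) v^(m₁)` and turns the first term of the potential into `U₀`. -/
lemma twoMonomial_criterion {V₀ G c₁ c₂ : ℝ} {e e' : ℝ × ℝ} (hV : 0 < V₀) (hG : 0 < G)
    (hc : c₂ ≠ 0) (h1 : e.1 ≠ -1) (h1' : e'.1 ≠ -1) (h2' : e'.2 ≠ -1)
    (hne1 : e'.1 ≠ e.1) (hne2 : e'.2 ≠ e.2) :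
    ∃ ξ : (Fin 2 → ℝ) → (Fin 2 → ℝ),
      (twoMonomial V₀ G c₁ c₂ e e').IsUniqueAdmissible quadrant
        (fun q => V₀ / G / (q 0 ^ e.1 * q 1 ^ e.2)) (-(V₀ / G) ^ 2 * c₁) ξ ∧
      ((twoMonomial V₀ G c₁ c₂ e e').ChargesSpanSL2 quadrant
        (fun q => V₀ / G / (q 0 ^ e.1 * q 1 ^ e.2)) (-(V₀ / G) ^ 2 * c₁) ξ ↔
          PowerCondition e e') := by
  have hk : V₀ / G ≠ 0 := by positivity
  have hneg : ∀ x : ℝ, x ≠ -1 → x + 1 ≠ 0 := fun x hx h => hx (by linarith)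
  have hid : ChartMap quadrant quadrant (fun q => q) (fun q => q) :=
    ⟨isOpen_quadrant, isOpen_quadrant, fun _ h => h, fun _ h => h, fun _ _ => rfl,
      fun _ _ => rfl, contDiffOn_id, contDiffOn_id⟩
  have T : Transport quadrant quadrant (fun q => q) (fun q => q) (twoMonomial V₀ G c₁ c₂ e e')
      (fun q => V₀ / G / (q 0 ^ e.1 * q 1 ^ e.2))
      (nullModel (fun q => -1 * mono e.1 e.2 q) (fun q => -(V₀ / G) ^ 2 * c₂ *
        mono (e'.1 - e.1) (e'.2 - e.2) q + -(V₀ / G) ^ 2 * c₁)) (fun _ => 1) := by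
    refine transport_nullModel hid (contDiffOn_const.mul (contDiffOn_mono _ _))
      (fun q hq => mul_ne_zero (by norm_num) (mono_pos hq _ _).ne')
      ((contDiffOn_const.mul (contDiffOn_mono _ _)).add contDiffOn_const)
      (fun q hq μ ν => ?_) (fun q hq => ?_)
    · have hm : q 0 ^ e.1 * q 1 ^ e.2 ≠ 0 := (mono_pos hq e.1 e.2).ne'
      simp only [pd_coord, lapseMetric, twoMonomial, Matrix.smul_apply, smul_eq_mul, mono]
      fin_cases μ <;> fin_cases ν <;> simp <;> field_simp
    · have hm := (mono_pos hq e.1 e.2).ne'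
      rw [← mono_div hq]
      change V₀ / G / mono e.1 e.2 q *
        (-(V₀ / G) * (c₁ * mono e.1 e.2 q + c₂ * mono e'.1 e'.2 q)) = _
      field_simp
      ring
  have hsm : e'.2 - e.2 + e.2 + 1 ≠ 0 := by simpa using hneg _ h2'
  have hpn : e'.1 - e.1 + e.1 + 1 ≠ 0 := by simpa using hneg _ h1'
  have hw : -(V₀ / G) ^ 2 * c₂ ≠ 0 := mul_ne_zero (neg_ne_zero.2 (pow_ne_zero _ hk)) hc
  have hu := powerModel_isUniqueAdmissible (r := -1) (U₀ := -(V₀ / G) ^ 2 * c₁) (n := e.1)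
    (m := e.2) (by norm_num) hw (sub_ne_zero.2 hne1) (sub_ne_zero.2 hne2) hsm
  refine ⟨_, T.isUniqueAdmissible hu, ?_⟩
  have hiff := powerModel_chargesSpanSL2_iff (r := -1) (w := -(V₀ / G) ^ 2 * c₂)
    (U₀ := -(V₀ / G) ^ 2 * c₁) (n := e.1) (m := e.2) (by norm_num) hsm hpn (hneg _ h1)
  -- The converse needs the transport in the opposite direction; pulling back along the identity
  -- does nothing to the field.
  have hback : (twoMonomial V₀ G c₁ c₂ e e').ChargesSpanSL2 quadrant
        (fun q => V₀ / G / (q 0 ^ e.1 * q 1 ^ e.2)) (-(V₀ / G) ^ 2 * c₁)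
        (pullField (fun q => q) (fun q => q)
          (linField (e'.2 - e.2 + e.2 + 1) (-(e'.1 - e.1 + e.1 + 1)))) →
      (nullModel (fun q => -1 * mono e.1 e.2 q) (fun q => -(V₀ / G) ^ 2 * c₂ *
        mono (e'.1 - e.1) (e'.2 - e.2) q + -(V₀ / G) ^ 2 * c₁)).ChargesSpanSL2 quadrant
        (fun _ => 1) (-(V₀ / G) ^ 2 * c₁)
        (linField (e'.2 - e.2 + e.2 + 1) (-(e'.1 - e.1 + e.1 + 1))) := by
    intro h
    have hpf : ∀ ζ : (Fin 2 → ℝ) → Fin 2 → ℝ, pullField (fun q => q) (fun q => q) ζ = ζ := by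
      intro ζ
      ext q i
      fin_cases i <;> simp [pullField, jac, Matrix.mulVec, dotProduct, pd_coord]
    have h3 := T.symm.chargesSpanSL2 (by
      rw [hpf]
      exact (contDiff_linField _ _).contDiffOn) h
    rwa [hpf, hpf] at h3
  constructor
  · intro h
    have h4 := hiff.1 (hback h)
    rw [PowerCondition]
    linear_combination h4
  · intro h
    refine T.chargesSpanSL2 (contDiff_linField _ _).contDiffOn (hiff.2 ?_)
    rw [PowerCondition] at h
    linear_combination h

end Minisuperspace

end

/-! ### Assembly of the theorem -/

open Minisuperspace in
theorem mainTheorem7 :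
    -- the two-monomial criterion
    (∀ (V₀ G c₁ c₂ : ℝ) (e e' : ℝ × ℝ), 0 < V₀ → 0 < G → c₂ ≠ 0 →
      e.1 ≠ -1 → e.2 ≠ -1 → e'.1 ≠ -1 → e'.2 ≠ -1 → e'.1 ≠ e.1 → e'.2 ≠ e.2 →
      ∃ ξ : (Fin 2 → ℝ) → (Fin 2 → ℝ),
        (twoMonomial V₀ G c₁ c₂ e e').IsUniqueAdmissible quadrant
          (fun q => V₀ / G / (q 0 ^ e.1 * q 1 ^ e.2)) (-(V₀ / G) ^ 2 * c₁) ξ ∧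
        ((twoMonomial V₀ G c₁ c₂ e e').ChargesSpanSL2 quadrant
          (fun q => V₀ / G / (q 0 ^ e.1 * q 1 ^ e.2)) (-(V₀ / G) ^ 2 * c₁) ξ ↔
            PowerCondition e e')) ∧
    -- the models
    ∀ (M : Model) (L G σ : ℝ) (cell : Set (Fin 3 → ℝ)),
      0 < L → 0 < G → 0 < σ → M.IsCell L cell →
      -- the reduced action in null coordinates
      ((∀ q ∈ quadrant, ∀ μ ν, (M.reduction L G cell).metric q μ ν =
          -(M.fiducialVolume L cell / G) *
            (pd μ (M.nullU σ) q * pd ν (M.nullV σ) q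
              + pd ν (M.nullU σ) q * pd μ (M.nullV σ) q)) ∧
        ∃ c : ℝ × ℝ → ℝ, (∀ e ∈ M.exponents, c e ≠ 0) ∧
          ∀ q ∈ quadrant, (M.reduction L G cell).potential q =
            (M.exponents.map (fun e => c e * M.monomial σ e q)).sum) ∧
      -- III, V, VI₀, Kantowski–Sachs: the full algebra
      ((M = .III ∨ M = .V ∨ M = .VI0 ∨ M = .KS) → ∀ κ : ℝ, κ ≠ 0 →
        (∀ q ∈ quadrant, ∀ k l i j, riemann ((M.reduction L G cell).lapseMetric
          (fun q => κ / (M.reduction L G cell).potential q)) k l i j q = 0) ∧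
        (M.reduction L G cell).HasFullAlgebra quadrant
          (fun q => κ / (M.reduction L G cell).potential q)) ∧
      -- VIII, IX: `sl(2, ℝ)`, and only that
      ((M = .VIII ∨ M = .IX) →
        (∀ e ∈ M.exponents, ∀ e' ∈ M.exponents, e ≠ e' → PowerCondition e e') ∧
        (∀ e ∈ M.exponents, ∀ κ : ℝ, κ ≠ 0 →
          (∀ q ∈ quadrant, ∀ k l i j, riemann ((M.reduction L G cell).lapseMetric
            (fun q => κ / M.monomial σ e q)) k l i j q = 0) ∧
          ∃ (U₀ : ℝ) (ξ : (Fin 2 → ℝ) → (Fin 2 → ℝ)),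
            (M.reduction L G cell).IsUniqueAdmissible quadrant
              (fun q => κ / M.monomial σ e q) U₀ ξ ∧
            (M.reduction L G cell).ChargesSpanSL2 quadrant
              (fun q => κ / M.monomial σ e q) U₀ ξ) ∧
        ∀ (D : Set (Fin 2 → ℝ)) (N : (Fin 2 → ℝ) → ℝ),
          IsOpen D → D.Nonempty → D ⊆ quadrant → ContDiffOn ℝ ∞ N D → (∀ q ∈ D, N q ≠ 0) →
          ¬ (M.reduction L G cell).HasFullAlgebra D N) ∧
      -- IV, VII: the condition fails and there is no `sl(2, ℝ)`
      ((M = .IV ∨ ∃ h, M = .VII h) →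
        (∀ e ∈ M.exponents, ∀ e' ∈ M.exponents, e ≠ e' → ¬ PowerCondition e e') ∧
        ∀ (D : Set (Fin 2 → ℝ)) (N : (Fin 2 → ℝ) → ℝ) (κ : ℝ),
          IsOpen D → D.Nonempty → D ⊆ quadrant → κ ≠ 0 →
          ((∀ q ∈ D, N q * (M.reduction L G cell).potential q = κ) ∨
            ∃ e ∈ M.exponents, ∀ q ∈ D, N q * M.monomial σ e q = κ) →
          ∀ (U₀ lam : ℝ) (ξ : (Fin 2 → ℝ) → (Fin 2 → ℝ)),
            (M.reduction L G cell).IsAdmissible D N U₀ lam ξ →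
            ¬ (M.reduction L G cell).ChargesSpanSL2 D N U₀ ξ) := by
  refine ⟨fun V₀ G c₁ c₂ e e' hV hG hc h1 _ h1' h2' hne1 hne2 =>
    twoMonomial_criterion hV hG hc h1 h1' h2' hne1 hne2, fun M L G σ cell hL hG hσ hcell =>
    ⟨⟨fun q hq μ ν => M.hasNullMetric hσ hq μ ν, Model.hasMonomialPotential hL hG hσ M hcell⟩,
      ?_, ?_, fun hM => ⟨Model.not_powerCondition_tilted hM, ?_⟩⟩⟩
  · rintro (rfl | rfl | rfl | rfl) κ hκ
    all_goals
      exact Model.reduction_flat_and_hasFullAlgebra hL hG hσ hcell rfl (by norm_num) hκ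
  · intro hM
    have hE : M.exponents = [(1, -1 / 3), (3, -7 / 3)] := by
      rcases hM with rfl | rfl <;> rfl
    refine ⟨?_, Model.reduction_sl2_of_two hL hG hσ hcell hE, fun D N hD hne hDq hN hN0 =>
      Model.reduction_not_hasFullAlgebra hL hG hσ hcell (e := (1, -1 / 3)) (e' := (3, -7 / 3))
        (by simp [hE]) (by simp [hE]) (by norm_num) hD hne hDq hN hN0⟩
    intro e he e' he' hne
    simp only [hE, List.mem_cons, List.not_mem_nil, or_false] at he he'
    rcases he with rfl | rfl <;> rcases he' with rfl | rfl
    exacts [absurd rfl hne, Model.powerCondition_two_axisymmetric.1,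
      Model.powerCondition_two_axisymmetric.2, absurd rfl hne]
  · intro D N κ hD hne hDq hκ hN U₀ lam ξ hξ
    obtain ⟨e₁, he₁, e₂, he₂, hee⟩ := Model.exists_exponents_ne hM
    exact Model.reduction_not_chargesSpanSL2 hL hG hσ hcell he₁ he₂ hee
      (Model.exponents_tilted_ne_neg_one hM) (Model.not_powerCondition_tilted hM) hD hne hDq hκ
      hN hξ
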